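/- Let $d\ge 0$ and let $K\in C^1(\mathbf{R}^d\times\mathbf{R}^d,\mathbf{R}^d)$ satisfy (HK1) $K(z,z')=-K(z',z)$ for all $z,z'\in\mathbf{R}^d$, and (HK2) there is $L\ge 0$ such that $|\nabla_zK(z,z')|\le L$ and $|\nabla_{z'}K(z,z')|\le L$ for all $z,z'\in\mathbf{R}^d$. Let $f^{in}$ be a probability density on $\mathbf{R}^d$ with respect to Lebesgue measure $\mathscr{L}^d$, such that $\int_{\mathbf{R}^d}|z|^{d+5}f^{in}(z)\,dz<\infty$. Then the following holds. (1) For each $N\ge 1$ the $N$-particle system $\dot z_i(t)=\frac1N\sum_{j=1}^NK(z_i(t),z_j(t))$, $i=1,\dots,N$, has a unique flow $T_t$ on $(\mathbf{R}^d)^N$ defined for all $t\in\mathbf{R}$: $t\mapsto T_tZ$ is a solution and $T_0Z=Z$ for every $Z\in(\mathbf{R}^d)^N$. (2) The mean-field PDE $$\partial_tf(t,z)+\operatorname{div}_z\Big(f(t,z)\int_{\mathbf{R}^d}K(z,z')f(t,z')\,dz'\Big)=0,\qquad f|_{t=0}=f^{in},$$ has a unique weak solution $f\in C(\mathbf{R};L^1(\mathbf{R}^d))$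 such that every $f(t,\cdot)$ is a probability density with finite first moment and $t\mapsto\int|z|f(t,z)\,dz$ is locally integrable. (3) For each $N\ge 1$, the formula $F_N(t)=T_t\#(f^{in}\mathscr{L}^d)^{\otimes N}$ (push-forward by $T_t$) defines a curve of probability measures on $(\mathbf{R}^d)^N$, and this curve is the unique weak solution, among curves $t\in\mathbf{R}\mapsto P(t)$ of probability measures on $(\mathbf{R}^d)^N$ which are continuous for the weak topology and have finite, locally integrable in $t$, first moment, of the $N$-particle Liouville equation $$\partial_tF_N+\frac1N\sum_{i,j=1}^N\operatorname{div}_{z_i}\big(K(z_i,z_j)F_N\big)=0,\qquad F_N|_{t=0}=(f^{in}\mathscr{L}^d)^{\otimes N}.$$ (4) For each $t\in\mathbf{R}$ the sequence $(F_N(t))_{N\ge 1}$ is $f(t,\cdot)\mathscr{L}^d$-chaotic: each $F_N(t)$ is invariant under permutations of the $N$ particles and, for each $j\ge 1$, $$F_{N:j}(t)\to(f(t,\cdot)\mathscr{L}^d)^{\otimes j}\quad\text{as }N\to\infty,$$ weakly, i.e. against all bounded continuous functions on $(\mathbf{R}^d)^j$, where $F_{N:j}(t)$ denotes the law of the first $j$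 particles under $F_N(t)$ (and $F_{N:j}=0$ if $j>N$). In (2) and (3), weak solutions are tested against $C^1$ functions that are bounded with bounded first derivatives: for all such $\phi$ on $\mathbf{R}^d$ and $\Phi$ on $(\mathbf{R}^d)^N$, and all $t\in\mathbf{R}$, $$\int\phi f(t)\,dz=\int\phi f^{in}\,dz+\int_0^t\!\int\Big(\int K(z,z')f(s,z')\,dz'\Big)\cdot\nabla\phi(z)\,f(s,z)\,dz\,ds,$$ $$\int\Phi\,dP(t)=\int\Phi\,dP(0)+\int_0^t\!\int\frac1N\sum_{i,j=1}^NK(z_i,z_j)\cdot\nabla_{z_i}\Phi\,dP(s)\,ds .$$ -/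

import Mathlib

open MeasureTheory Filter Topology

/-- The single-particle phase space `ℝ^d`, with its Euclidean norm. -/
abbrev Phase (d : ℕ) : Type := EuclideanSpace ℝ (Fin d)

/-- The `N`-particle phase space `(ℝ^d)^N`. -/
abbrev PhaseN (d N : ℕ) : Type := Fin N → Phase d

noncomputable section

/-- (HK1): the interaction kernel is skew-symmetric. -/
def HK1 {d : ℕ} (K : Phase d → Phase d → Phase d) : Prop :=
  ∀ z z', K z z' = -K z' z

/-- (HK2): both partial gradients of the interaction kernel are bounded. -/
def HK2 {d : ℕ} (K : Phase d → Phase d → Phase d) : Prop :=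
  ∃ L : ℝ, 0 ≤ L ∧ ∀ z z' : Phase d,
    ‖fderiv ℝ (fun x => K x z') z‖ ≤ L ∧ ‖fderiv ℝ (fun x' => K z x') z'‖ ≤ L

/-- `g` is a probability density with respect to Lebesgue measure. -/
structure IsProbDensity {d : ℕ} (g : Phase d → ℝ) : Prop where
  nonneg : 0 ≤ᵐ[volume] g
  integrable : Integrable g volume
  integral_eq_one : ∫ z, g z = 1

/-- The probability measure `g ℒ^d` attached to a probability density `g`. -/
def densityMeasure {d : ℕ} (g : Phase d → ℝ) (hg : IsProbDensity g) :
    ProbabilityMeasure (Phase d) :=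
  ⟨volume.withDensity (fun z => ENNReal.ofReal (g z)), by
    refine ⟨?_⟩
    rw [withDensity_apply _ MeasurableSet.univ, Measure.restrict_univ,
      ← ofReal_integral_eq_lintegral_ofReal hg.integrable hg.nonneg, hg.integral_eq_one,
      ENNReal.ofReal_one]⟩

/-- The tensor power `p^{⊗ N}`. -/
def tensorPower {d : ℕ} (p : ProbabilityMeasure (Phase d)) (N : ℕ) :
    ProbabilityMeasure (PhaseN d N) :=
  ⟨Measure.pi (fun _ => (p : Measure (Phase d))), inferInstance⟩

/-- The vector field of the `N`-particle system: its `i`-th component is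
`(1/N) ∑_j K(z_i, z_j)`. -/
def nBodyField {d : ℕ} (K : Phase d → Phase d → Phase d) (N : ℕ) (Z : PhaseN d N) : PhaseN d N :=
  fun i => (N : ℝ)⁻¹ • ∑ j, K (Z i) (Z j)

/-- `T` is the flow of the `N`-particle ODE system: for every `Z`, the curve `t ↦ T t Z` is a
solution, defined on all of `ℝ`, with value `Z` at time `0`. -/
structure IsNBodyFlow {d : ℕ} (K : Phase d → Phase d → Phase d) (N : ℕ)
    (T : ℝ → PhaseN d N → PhaseN d N) : Prop where
  init : ∀ Z, T 0 Z = Z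
  ode : ∀ Z t, HasDerivAt (fun s => T s Z) (nBodyField K N (T t Z)) t

/-- Test functions of class `C^1_b`. -/
def IsC1b {X : Type*} [NormedAddCommGroup X] [NormedSpace ℝ X] (φ : X → ℝ) : Prop :=
  ContDiff ℝ 1 φ ∧ (∃ C : ℝ, ∀ x, |φ x| ≤ C) ∧ ∃ C : ℝ, ∀ x, ‖fderiv ℝ φ x‖ ≤ C

/-- `P ∈ C(ℝ; w-𝒫((ℝ^d)^N))` is a weak solution of the `N`-particle Liouville equation
`∂_t P + (1/N) ∑_{i,j} div_{z_i} (K(z_i, z_j) P) = 0` with initial data `P₀`. The equation is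
tested against `C^1_b` functions and integrated in time; the moment condition is what makes
its right-hand side meaningful. Note that
`fderiv ℝ Φ Z (nBodyField K N Z) = (1/N) ∑_{i,j} K(z_i, z_j) · ∇_{z_i} Φ(Z)`. -/
structure IsLiouvilleSolution {d : ℕ} (K : Phase d → Phase d → Phase d) (N : ℕ)
    (P₀ : ProbabilityMeasure (PhaseN d N)) (P : ℝ → ProbabilityMeasure (PhaseN d N)) : Prop where
  continuous : Continuous P
  moment : ∀ t, Integrable (fun Z : PhaseN d N => ‖Z‖) (P t : Measure (PhaseN d N))
  moment_locallyIntegrable :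
    LocallyIntegrable (fun t => ∫ Z, ‖Z‖ ∂(P t : Measure (PhaseN d N))) volume
  init : P 0 = P₀
  weak : ∀ Φ : PhaseN d N → ℝ, IsC1b Φ → ∀ t : ℝ,
    ∫ Z, Φ Z ∂(P t : Measure (PhaseN d N)) = ∫ Z, Φ Z ∂(P₀ : Measure (PhaseN d N)) +
      ∫ s in (0 : ℝ)..t, ∫ Z, fderiv ℝ Φ Z (nBodyField K N Z) ∂(P s : Measure (PhaseN d N))

/-- The mean-field vector field `𝒦 g (z) = ∫ K(z, z') g(z') dz'`. -/
def meanField {d : ℕ} (K : Phase d → Phase d → Phase d) (g : Phase d → ℝ) (z : Phase d) :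
    Phase d :=
  ∫ z', g z' • K z z'

/-- `f ∈ C(ℝ; L^1(ℝ^d))`, with values in the probability densities of finite first moment, is a
weak solution of the mean-field PDE `∂_t f + div_z (f 𝒦 f) = 0` with initial data `f₀`. The
equation is tested against `C^1_b` functions and integrated in time; the moment condition is
what makes its right-hand side meaningful. -/
structure IsMeanFieldSolution {d : ℕ} (K : Phase d → Phase d → Phase d) (f₀ : Phase d → ℝ)
    (f : ℝ → (Phase d →₁[volume] ℝ)) : Prop where
  continuous : Continuous f
  density : ∀ t, IsProbDensity (f t)
  moment : ∀ t, Integrable (fun z : Phase d => ‖z‖ * f t z) volume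
  moment_locallyIntegrable : LocallyIntegrable (fun t => ∫ z, ‖z‖ * f t z) volume
  init : f 0 =ᵐ[volume] f₀
  weak : ∀ φ : Phase d → ℝ, IsC1b φ → ∀ t : ℝ,
    ∫ z, φ z * f t z = (∫ z, φ z * f₀ z) +
      ∫ s in (0 : ℝ)..t, ∫ z, fderiv ℝ φ z (meanField K (f s) z) * f s z

/-- The `j`-particle marginal `P_{N:j}` (law of the first `j` particles), with the convention
that it is `0` when `j > N`. -/
def marginal {d N : ℕ} (P : ProbabilityMeasure (PhaseN d N)) (j : ℕ) :
    FiniteMeasure (PhaseN d j) :=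
  if h : j ≤ N then P.toFiniteMeasure.map (fun Z i => Z (Fin.castLE h i)) else 0

/-- `P` is invariant under all permutations of the particles. -/
def IsSymmetric {d N : ℕ} (P : ProbabilityMeasure (PhaseN d N)) : Prop :=
  ∀ σ : Equiv.Perm (Fin N),
    (P : Measure (PhaseN d N)).map (fun Z i => Z (σ i)) = (P : Measure (PhaseN d N))

/-- The sequence `(P_N)_{N ≥ 1}` of symmetric `N`-particle probability measures is `p`-chaotic:
for each `j ≥ 1`, `P_{N:j} → p^{⊗ j}` weakly (tested against bounded continuous functions). -/
def IsChaotic {d : ℕ} (P : (N : ℕ) → ProbabilityMeasure (PhaseN d N))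
    (p : ProbabilityMeasure (Phase d)) : Prop :=
  (∀ N, 1 ≤ N → IsSymmetric (P N)) ∧
    ∀ j, 1 ≤ j →
      Tendsto (fun N => marginal (P N) j) atTop (𝓝 (tensorPower p j).toFiniteMeasure)

end

/-! Bounded gradients make K Lipschitz and skew-symmetry gives K(0,0) = 0, so K grows at most
linearly and every velocity field met below is globally Lipschitz in space. Such fields have global
flows, by a Picard iteration in a weighted norm (`IsLipschitzField.exists_solution`); in particular
the N-particle flow exists and is unique.

Both PDEs are continuity equations. For a Lipschitz field the push-forward by the flow Φ is a weak
solution, and it is the only one (`IsFlow.eq_map_of_solves`). The uniqueness is a duality argument.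
If φ is Lipschitz with compact support, ψ_s = φ ∘ Φ(s,τ) is constant along trajectories, so ∫ ψ_s
dP(s) should not depend on s. As ψ_s is only Lipschitz, it is mollified at scale ε; mollification
commutes with the flow between s and t up to O(ε(t-s)), so the integral varies by O(ε), and ε tends
to 0. This settles the Liouville equation.

For the mean-field equation, a solution is transported by the flow of its own velocity field, hence
by maps X_t solving dX_t(ζ)/dt = ∫ K(X_t ζ, X_t ζ') dμ(ζ') with μ the initial law. This is a
Lipschitz ODE in a Banach space of maps of linear growth (`exists_isMeanFieldFlow`), and Grönwall
applied to ∫ |X - X'| dμ gives uniqueness. The image law keeps a density because the flow has a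
Lipschitz inverse; the volume distortion between times s and t tends to 1 as t tends to s, whence
continuity in L¹.

Chaos follows by coupling. The particles and independent copies of X start from the same i.i.d.
points ζ_i. Along the copies, the empirical velocity minus the mean-field velocity is an average of
centred, pairwise uncorrelated terms, of mean size O(N^{-1/2}) by the second moment
(`integral_norm_average_le`). Grönwall gives E|T_t ζ_i - X_t(ζ_i)| = O(N^{-1/2})
(`IsMeanFieldFlow.exists_coupling_le`). As the X_t(ζ_i) are independent with law f(t), bounded
Lipschitz test functions yield the convergence of marginals (`IsMeanFieldFlow.tendsto_marginal`). -/

set_option linter.unusedSectionVars false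

/-! ### Global solutions and flows of Lipschitz fields -/

/-- A time-dependent vector field that is continuous in time and Lipschitz in space, with a
constant that does not depend on time. -/
structure IsLipschitzField {E : Type*} [NormedAddCommGroup E] (b : ℝ → E → E) (L : NNReal) :
    Prop where
  lipschitz : ∀ t, LipschitzWith L (b t)
  continuous_left : ∀ x, Continuous fun t => b t x

namespace IsLipschitzField

variable {E : Type*} [NormedAddCommGroup E] {b : ℝ → E → E} {L : NNReal}

theorem continuous_uncurry (hb : IsLipschitzField b L) :
    Continuous (Function.uncurry b) :=
  continuous_prod_of_continuous_lipschitzWith' _ L hb.lipschitz hb.continuous_left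

theorem continuous_comp (hb : IsLipschitzField b L) {X : Type*} [TopologicalSpace X] {s : X → ℝ}
    {x : X → E} (hs : Continuous s) (hx : Continuous x) : Continuous fun p => b (s p) (x p) :=
  hb.continuous_uncurry.comp (hs.prodMk hx)

theorem norm_sub_le (hb : IsLipschitzField b L) (t : ℝ) (x y : E) :
    ‖b t x - b t y‖ ≤ L * ‖x - y‖ := by
  simpa [dist_eq_norm] using (hb.lipschitz t).dist_le_mul x y

theorem norm_le (hb : IsLipschitzField b L) (t : ℝ) (x : E) :
    ‖b t x‖ ≤ ‖b t 0‖ + L * ‖x‖ := by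
  have := hb.norm_sub_le t x 0
  have h2 := norm_le_norm_add_norm_sub' (b t x) (b t 0)
  simp only [sub_zero] at this
  linarith

/-- Reversal of time. -/
theorem reverse (hb : IsLipschitzField b L) : IsLipschitzField (fun t x => -b (-t) x) L :=
  ⟨fun t => (hb.lipschitz (-t)).neg, fun x => ((hb.continuous_left x).comp continuous_neg).neg⟩

variable [NormedSpace ℝ E]

/-- A fixed point on the whole line at once, with no gluing of local solutions. The unknown is x =
x₀ + w u with u bounded and w a fixed weight growing so fast that the Picard map contracts by 1/2 in
u. Since E is any Banach space, the result also applies to the mean-field characteristics, seen as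
an ODE in a space of maps. -/
theorem exists_solution [CompleteSpace E] (hb : IsLipschitzField b L) (t₀ : ℝ) (x₀ : E) :
    ∃ x : ℝ → E, x t₀ = x₀ ∧ ∀ t, HasDerivAt x (b t (x t)) t := by
  classical
  -- The term 2(L + 1) makes L at most a/2, which yields the contraction factor 1/2; the term ‖b t
  -- x₀‖ absorbs the inhomogeneity, whatever its growth in time.
  let a : ℝ → ℝ := fun t => 2 * (L + 1) + ‖b t x₀‖
  have ha : Continuous a := continuous_const.add (hb.continuous_left x₀).norm
  have hL : (0 : ℝ) ≤ L := L.2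
  have ha0 : ∀ t, 0 ≤ a t := fun t => by positivity
  let A : ℝ → ℝ := fun t => ∫ s in t₀..t, a s
  have hA : ∀ t, HasDerivAt A (a t) t := fun t => ha.integral_hasStrictDerivAt t₀ t |>.hasDerivAt
  -- The hyperbolic cosine serves both directions of time: the integral of a · cosh A from t₀ is
  -- sinh A, and |sinh A| ≤ cosh A whatever the sign of A.
  let w : ℝ → ℝ := fun t => Real.cosh (A t)
  have hAc : Continuous A := continuous_iff_continuousAt.2 fun t => (hA t).continuousAt
  have hw : Continuous w := Real.continuous_cosh.comp hAc
  have hw1 : ∀ t, 1 ≤ w t := fun t => Real.one_le_cosh _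
  have hw0 : ∀ t, 0 < w t := fun t => Real.cosh_pos _
  have hint : ∀ t, |∫ s in t₀..t, a s * w s| ≤ w t := by
    intro t
    have : ∫ s in t₀..t, a s * w s = Real.sinh (A t) - Real.sinh (A t₀) := by
      refine intervalIntegral.integral_eq_sub_of_hasDerivAt (f := fun t => Real.sinh (A t))
        (fun s _ => ?_) ((ha.mul hw).intervalIntegrable _ _)
      simpa [mul_comm] using (hA s).sinh
    rw [this]
    have h0 : A t₀ = 0 := by simp [A]
    rw [h0, Real.sinh_zero, sub_zero, Real.abs_sinh]
    exact (Real.sinh_lt_cosh _).le.trans_eq (Real.cosh_abs _)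
  let F : BoundedContinuousFunction ℝ E → ℝ → E := fun u s => b s (x₀ + w s • u s)
  have hF : ∀ u, Continuous (F u) := fun u =>
    hb.continuous_comp continuous_id (continuous_const.add (hw.smul u.continuous))
  have hbound : ∀ (g : ℝ → E) (C : ℝ), (∀ s, ‖g s‖ ≤ C * (a s * w s)) → 0 ≤ C →
      ∀ t, ‖(w t)⁻¹ • ∫ s in t₀..t, g s‖ ≤ C := by
    intro g C hg hC t
    rw [norm_smul, norm_inv, Real.norm_of_nonneg (hw0 t).le, inv_mul_le_iff₀ (hw0 t)]
    refine (intervalIntegral.norm_integral_le_abs_of_norm_le (g := fun s => C * (a s * w s))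
      (ae_of_all _ hg)
      ((continuous_const.mul (ha.mul hw)).intervalIntegrable _ _)).trans ?_
    rw [intervalIntegral.integral_const_mul, abs_mul, abs_of_nonneg hC, mul_comm]
    exact mul_le_mul_of_nonneg_right (hint t) hC
  have haw : ∀ s, ‖b s x₀‖ ≤ a s * w s := fun s => by
    have : ‖b s x₀‖ ≤ a s := by simp only [a]; linarith
    exact this.trans (le_mul_of_one_le_right (ha0 s) (hw1 s))
  have hLw : ∀ s, L * w s ≤ (1 / 2) * (a s * w s) := fun s => by
    have : (L : ℝ) ≤ (1 / 2) * a s := by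
      have := norm_nonneg (b s x₀)
      simp only [a]; linarith
    nlinarith [hw0 s]
  have hFb : ∀ u s, ‖F u s‖ ≤ (1 + ‖u‖) * (a s * w s) := by
    intro u s
    have h1 := hb.norm_sub_le s (x₀ + w s • u s) x₀
    have h2 := norm_le_norm_add_norm_sub' (b s (x₀ + w s • u s)) (b s x₀)
    rw [add_sub_cancel_left, norm_smul, Real.norm_of_nonneg (hw0 s).le] at h1
    have h3 := u.norm_coe_le_norm s
    have h4 : L * (w s * ‖u s‖) ≤ (1 / 2) * (a s * w s) * ‖u‖ := by
      rw [← mul_assoc]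
      exact mul_le_mul (hLw s) h3 (norm_nonneg _)
        (by have := mul_nonneg (ha0 s) (hw0 s).le; positivity)
    have h5 := mul_nonneg (mul_nonneg (ha0 s) (hw0 s).le) (norm_nonneg u)
    change ‖b s (x₀ + w s • u s)‖ ≤ _
    nlinarith [haw s]
  have hFd : ∀ u v s, ‖F u s - F v s‖ ≤ (1 / 2 * dist u v) * (a s * w s) := by
    intro u v s
    have h1 := hb.norm_sub_le s (x₀ + w s • u s) (x₀ + w s • v s)
    rw [add_sub_add_left_eq_sub, ← smul_sub, norm_smul, Real.norm_of_nonneg (hw0 s).le,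
      ← dist_eq_norm (u s)] at h1
    have h3 := u.dist_coe_le_dist (g := v) s
    have h4 : L * (w s * dist (u s) (v s)) ≤ (1 / 2) * (a s * w s) * dist u v := by
      rw [← mul_assoc]
      exact mul_le_mul (hLw s) h3 dist_nonneg
        (by have := mul_nonneg (ha0 s) (hw0 s).le; positivity)
    exact h1.trans (h4.trans_eq (by ring))
  have hprim : ∀ g : ℝ → E, Continuous g → Continuous fun t => (w t)⁻¹ • ∫ s in t₀..t, g s :=
    fun g hg => (hw.inv₀ fun t => (hw0 t).ne').smul
      (intervalIntegral.continuous_primitive (fun _ _ => hg.intervalIntegrable _ _) _)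
  let Ψ : BoundedContinuousFunction ℝ E → BoundedContinuousFunction ℝ E := fun u =>
    BoundedContinuousFunction.ofNormedAddCommGroup (fun t => (w t)⁻¹ • ∫ s in t₀..t, F u s)
      (hprim _ (hF u)) (1 + ‖u‖) (hbound _ _ (hFb u) (by positivity))
  have hΨ : ContractingWith (1 / 2) Ψ := by
    refine ⟨by norm_num, LipschitzWith.of_dist_le_mul fun u v => ?_⟩
    have hnn : (((1 / 2 : NNReal)) : ℝ) = 1 / 2 := by norm_num
    rw [hnn, BoundedContinuousFunction.dist_le (by positivity)]
    intro t
    change dist ((w t)⁻¹ • ∫ s in t₀..t, F u s) ((w t)⁻¹ • ∫ s in t₀..t, F v s) ≤ _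
    rw [dist_eq_norm, ← smul_sub, ← intervalIntegral.integral_sub
      ((hF u).intervalIntegrable _ _) ((hF v).intervalIntegrable _ _)]
    exact hbound _ _ (hFd u v) (by positivity) t
  let u := ContractingWith.fixedPoint Ψ hΨ
  have hu : Ψ u = u := hΨ.fixedPoint_isFixedPt
  have hux : ∀ t, w t • u t = ∫ s in t₀..t, F u s := by
    intro t
    conv_lhs => rw [← hu]
    change w t • ((w t)⁻¹ • ∫ s in t₀..t, F u s) = _
    rw [smul_smul, mul_inv_cancel₀ (hw0 t).ne', one_smul]
  refine ⟨fun t => x₀ + w t • u t, by simp [hux], fun t => ?_⟩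
  have h := ((hF u).integral_hasStrictDerivAt t₀ t).hasDerivAt
  have h2 : (fun t => x₀ + w t • u t) = fun t => x₀ + ∫ s in t₀..t, F u s := by
    funext t; rw [hux]
  rw [h2]
  have h3 := h.const_add x₀
  convert h3 using 1
  change b t _ = b t _
  rw [hux]

theorem solution_unique (hb : IsLipschitzField b L) {x y : ℝ → E} {t₀ : ℝ}
    (hx : ∀ t, HasDerivAt x (b t (x t)) t) (hy : ∀ t, HasDerivAt y (b t (y t)) t)
    (h : x t₀ = y t₀) : x = y :=
  ODE_solution_unique_univ (v := b) (s := fun _ => Set.univ) (K := L)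
    (fun t => (hb.lipschitz t).lipschitzOnWith) (fun t => ⟨hx t, trivial⟩)
    (fun t => ⟨hy t, trivial⟩) h

theorem norm_solution_sub_le_of_le (hb : IsLipschitzField b L) {x y : ℝ → E}
    (hx : ∀ t, HasDerivAt x (b t (x t)) t) (hy : ∀ t, HasDerivAt y (b t (y t)) t)
    {s t : ℝ} (hst : s ≤ t) : ‖x t - y t‖ ≤ Real.exp (L * (t - s)) * ‖x s - y s‖ := by
  have := dist_le_of_trajectories_ODE (a := s) (b := t) hb.lipschitz
    (fun r _ => (hx r).continuousAt.continuousWithinAt) (fun r _ => (hx r).hasDerivWithinAt)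
    (fun r _ => (hy r).continuousAt.continuousWithinAt) (fun r _ => (hy r).hasDerivWithinAt)
    le_rfl t ⟨hst, le_rfl⟩
  rwa [dist_eq_norm, dist_eq_norm, mul_comm] at this

theorem hasDerivAt_reverse {x : ℝ → E} (hx : ∀ t, HasDerivAt x (b t (x t)) t) (t : ℝ) :
    HasDerivAt (fun t => x (-t)) (-b (-t) (x (-t))) t := by
  have := (hx (-t)).scomp t (hasDerivAt_neg t)
  rwa [neg_one_smul] at this

theorem norm_solution_sub_le (hb : IsLipschitzField b L) {x y : ℝ → E}
    (hx : ∀ t, HasDerivAt x (b t (x t)) t) (hy : ∀ t, HasDerivAt y (b t (y t)) t)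
    (s t : ℝ) : ‖x t - y t‖ ≤ Real.exp (L * |t - s|) * ‖x s - y s‖ := by
  rcases le_total s t with h | h
  · rw [abs_of_nonneg (sub_nonneg.2 h)]
    exact hb.norm_solution_sub_le_of_le hx hy h
  · rw [abs_of_nonpos (sub_nonpos.2 h)]
    have := hb.reverse.norm_solution_sub_le_of_le (hasDerivAt_reverse hx) (hasDerivAt_reverse hy)
      (neg_le_neg h)
    simpa [sub_eq_add_neg, add_comm] using this

end IsLipschitzField

/-- `Φ s t x` is the value at time `t` of the solution of `x' = b(t, x)` which starts from `x`
at time `s`. -/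
structure IsFlow {E : Type*} [NormedAddCommGroup E] [NormedSpace ℝ E] (b : ℝ → E → E)
    (Φ : ℝ → ℝ → E → E) : Prop where
  init : ∀ s x, Φ s s x = x
  ode : ∀ s x t, HasDerivAt (fun t => Φ s t x) (b t (Φ s t x)) t

namespace IsFlow

variable {E : Type*} [NormedAddCommGroup E] [NormedSpace ℝ E] {b : ℝ → E → E} {L : NNReal}
  {Φ : ℝ → ℝ → E → E}

theorem exists_of_lipschitz [CompleteSpace E] (hb : IsLipschitzField b L) : ∃ Φ, IsFlow b Φ := by
  choose x hx using hb.exists_solution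
  exact ⟨fun s t y => x s y t, fun s y => (hx s y).1, fun s y => (hx s y).2⟩

theorem reverse (hΦ : IsFlow b Φ) :
    IsFlow (fun t x => -b (-t) x) (fun s t => Φ (-s) (-t)) :=
  ⟨fun _ x => hΦ.init _ x, fun s x t => IsLipschitzField.hasDerivAt_reverse (hΦ.ode (-s) x) t⟩

theorem eq_of_solution (hΦ : IsFlow b Φ) (hb : IsLipschitzField b L) {x : ℝ → E}
    (hx : ∀ t, HasDerivAt x (b t (x t)) t) (s t : ℝ) : x t = Φ s t (x s) :=
  congrFun (hb.solution_unique (t₀ := s) hx (hΦ.ode s (x s)) (hΦ.init s _).symm) t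

theorem comp (hΦ : IsFlow b Φ) (hb : IsLipschitzField b L) (r s t : ℝ) (x : E) :
    Φ s t (Φ r s x) = Φ r t x :=
  (hΦ.eq_of_solution hb (hΦ.ode r x) s t).symm

theorem comp_symm (hΦ : IsFlow b Φ) (hb : IsLipschitzField b L) (s t : ℝ) (x : E) :
    Φ t s (Φ s t x) = x := by
  rw [hΦ.comp hb, hΦ.init]

theorem norm_sub_le (hΦ : IsFlow b Φ) (hb : IsLipschitzField b L) (s t : ℝ) (x y : E) :
    ‖Φ s t x - Φ s t y‖ ≤ Real.exp (L * |t - s|) * ‖x - y‖ := by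
  simpa [hΦ.init] using hb.norm_solution_sub_le (hΦ.ode s x) (hΦ.ode s y) s t

theorem lipschitzWith (hΦ : IsFlow b Φ) (hb : IsLipschitzField b L) (s t : ℝ) :
    LipschitzWith (Real.exp (L * |t - s|)).toNNReal (Φ s t) :=
  LipschitzWith.of_dist_le_mul fun x y => by
    rw [Real.coe_toNNReal _ (Real.exp_pos _).le, dist_eq_norm, dist_eq_norm]
    exact hΦ.norm_sub_le hb s t x y

theorem continuous_right (hΦ : IsFlow b Φ) (s : ℝ) (x : E) : Continuous fun t => Φ s t x :=
  continuous_iff_continuousAt.2 fun t => (hΦ.ode s x t).continuousAt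

/-- A family of maps that is continuous in the parameter and Lipschitz with a constant depending
continuously on the parameter is jointly continuous. -/
theorem _root_.continuous_uncurry_of_lipschitz {T X Y : Type*} [TopologicalSpace T]
    [SeminormedAddCommGroup X] [SeminormedAddCommGroup Y] {f : T → X → Y} {l : T → ℝ}
    (hl : Continuous l) (hf : ∀ x, Continuous fun t => f t x)
    (h : ∀ t x y, ‖f t x - f t y‖ ≤ l t * ‖x - y‖) : Continuous (Function.uncurry f) := by
  refine continuous_iff_continuousAt.2 fun ⟨t₀, x₀⟩ => ?_
  rw [ContinuousAt, tendsto_iff_norm_sub_tendsto_zero]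
  have h1 : Tendsto (fun p : T × X => l p.1 * ‖p.2 - x₀‖ + ‖f p.1 x₀ - f t₀ x₀‖) (𝓝 (t₀, x₀))
      (𝓝 0) := by
    have : Continuous fun p : T × X => l p.1 * ‖p.2 - x₀‖ + ‖f p.1 x₀ - f t₀ x₀‖ :=
      ((hl.comp continuous_fst).mul (by fun_prop)).add
        ((((hf x₀).comp continuous_fst).sub continuous_const).norm)
    simpa using this.tendsto (t₀, x₀)
  refine squeeze_zero (fun _ => norm_nonneg _) (fun p => ?_) h1
  have := norm_add_le (f p.1 p.2 - f p.1 x₀) (f p.1 x₀ - f t₀ x₀)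
  rw [sub_add_sub_cancel] at this
  exact this.trans (add_le_add_left (h _ _ _) _)

theorem continuous_to (hΦ : IsFlow b Φ) (hb : IsLipschitzField b L) (s : ℝ) :
    Continuous fun p : ℝ × E => Φ s p.1 p.2 :=
  continuous_uncurry_of_lipschitz (f := fun t x => Φ s t x)
    (l := fun t => Real.exp (L * |t - s|)) (by fun_prop) (hΦ.continuous_right s)
    (hΦ.norm_sub_le hb s)

/-- A change of starting time is a change of starting point: Φ s₀ t x = Φ s t (Φ s₀ s x), and Φ s t
is Lipschitz. -/
theorem continuous_left (hΦ : IsFlow b Φ) (hb : IsLipschitzField b L) (t : ℝ) (x : E) :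
    Continuous fun s => Φ s t x := by
  refine continuous_iff_continuousAt.2 fun s₀ => ?_
  rw [ContinuousAt, tendsto_iff_norm_sub_tendsto_zero]
  have h1 : Tendsto (fun s => Real.exp (L * |t - s|) * ‖x - Φ s₀ s x‖) (𝓝 s₀) (𝓝 0) := by
    have : Continuous fun s => Real.exp (L * |t - s|) * ‖x - Φ s₀ s x‖ :=
      (by fun_prop : Continuous fun s => Real.exp (L * |t - s|)).mul
        (continuous_const.sub (hΦ.continuous_right s₀ x)).norm
    simpa [hΦ.init] using this.tendsto s₀
  refine squeeze_zero (fun _ => norm_nonneg _) (fun s => ?_) h1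
  have := hΦ.norm_sub_le hb s t x (Φ s₀ s x)
  rwa [hΦ.comp hb] at this

/-- Factoring Φ s t through time 0 separates the dependence on s from the dependence on t. -/
theorem continuous (hΦ : IsFlow b Φ) (hb : IsLipschitzField b L) :
    Continuous fun p : ℝ × ℝ × E => Φ p.1 p.2.1 p.2.2 := by
  have h : Continuous fun p : ℝ × E => Φ p.1 0 p.2 :=
    continuous_uncurry_of_lipschitz (f := fun s x => Φ s 0 x)
      (l := fun s => Real.exp (L * |0 - s|)) (by fun_prop) (hΦ.continuous_left hb 0)
      (fun s => hΦ.norm_sub_le hb s 0)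
  have h2 := (hΦ.continuous_to hb 0).comp
    ((continuous_fst.comp continuous_snd).prodMk
      (h.comp (continuous_fst.prodMk (continuous_snd.comp continuous_snd))))
  convert! h2 using 2 with p
  exact (hΦ.comp hb _ _ _ _).symm

theorem continuous_map (hΦ : IsFlow b Φ) (hb : IsLipschitzField b L) (s t : ℝ) :
    Continuous (Φ s t) :=
  (hΦ.lipschitzWith hb s t).continuous

/-- Linear growth of the flow, locally uniformly in time. -/
theorem exists_norm_le (hΦ : IsFlow b Φ) (hb : IsLipschitzField b L) (T : ℝ) :
    ∃ C, 0 ≤ C ∧ ∀ s t, |s| ≤ T → |t| ≤ T → ∀ x, ‖Φ s t x‖ ≤ C * (1 + ‖x‖) := by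
  have hc : Continuous fun p : ℝ × ℝ => Φ p.1 p.2 0 :=
    (hΦ.continuous hb).comp (continuous_fst.prodMk (continuous_snd.prodMk continuous_const))
  obtain ⟨M, hM⟩ := ((isCompact_Icc (a := -T) (b := T)).prod
    (isCompact_Icc (a := -T) (b := T))).exists_bound_of_continuousOn hc.continuousOn
  refine ⟨|M| + Real.exp (L * (2 * T)), by positivity, fun s t hs ht x => ?_⟩
  have h1 := hM (s, t) ⟨abs_le.1 hs, abs_le.1 ht⟩
  have h2 := hΦ.norm_sub_le hb s t x 0
  have h3 : Real.exp (L * |t - s|) ≤ Real.exp (L * (2 * T)) := by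
    gcongr
    exact (abs_sub _ _).trans (by linarith)
  have h4 := norm_le_norm_add_norm_sub' (Φ s t x) (Φ s t 0)
  rw [sub_zero] at h2
  have h5 := mul_le_mul_of_nonneg_right h3 (norm_nonneg x)
  have h6 := mul_nonneg (abs_nonneg M) (norm_nonneg x)
  have h7 := Real.exp_pos (L * (2 * T))
  simp only at h1
  nlinarith [le_abs_self M]

end IsFlow

/-- The integral form of Grönwall's inequality. -/
theorem le_gronwallBound_of_le_integral {u : ℝ → ℝ} {k ε T : ℝ} (hu : Continuous u) (hk : 0 ≤ k)
    (h : ∀ t ∈ Set.Icc 0 T, u t ≤ ∫ s in (0 : ℝ)..t, (k * u s + ε)) :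
    ∀ t ∈ Set.Icc 0 T, u t ≤ gronwallBound 0 k ε t := by
  have hc : Continuous fun s => k * u s + ε := by fun_prop
  have hd : ∀ t, HasDerivAt (fun t => ∫ s in (0 : ℝ)..t, (k * u s + ε)) (k * u t + ε) t :=
    fun t => (hc.integral_hasStrictDerivAt 0 t).hasDerivAt
  intro t ht
  -- The differential inequality is applied to the integral on the right of `h`, which is
  -- differentiable although u is only continuous.
  have := le_gronwallBound_of_liminf_deriv_right_le (a := 0) (b := T) (δ := 0) (K := k) (ε := ε)
    (f := fun t => ∫ s in (0 : ℝ)..t, (k * u s + ε)) (f' := fun t => k * u t + ε)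
    (fun t _ => (hd t).continuousAt.continuousWithinAt)
    (fun t _ r hr => (hd t).hasDerivWithinAt.liminf_right_slope_le hr) (by simp)
    (fun t ht => by
      have := mul_le_mul_of_nonneg_left (h t (Set.Ico_subset_Icc_self ht)) hk
      linarith) t ht
  rw [sub_zero] at this
  exact (h t ht).trans this

/-! ### The continuity equation: existence by push-forward -/

section Transport

variable {E : Type*} [NormedAddCommGroup E] [NormedSpace ℝ E]

theorem IsC1b.continuous {φ : E → ℝ} (hφ : IsC1b φ) : Continuous φ := hφ.1.continuous

theorem IsC1b.continuous_fderiv {φ : E → ℝ} (hφ : IsC1b φ) : Continuous (fderiv ℝ φ) :=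
  hφ.1.continuous_fderiv one_ne_zero

theorem IsC1b.hasFDerivAt {φ : E → ℝ} (hφ : IsC1b φ) (x : E) :
    HasFDerivAt φ (fderiv ℝ φ x) x :=
  (hφ.1.differentiable one_ne_zero x).hasFDerivAt

variable [MeasurableSpace E] [BorelSpace E]

theorem IsC1b.integrable [SecondCountableTopology E] {φ : E → ℝ} (hφ : IsC1b φ) (μ : Measure E)
    [IsFiniteMeasure μ] : Integrable φ μ := by
  obtain ⟨C, hC⟩ := hφ.2.1
  exact .of_bound hφ.continuous.aestronglyMeasurable C (ae_of_all _ hC)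

/-- The integrated weak form of the continuity equation `∂_t P + div (b P) = 0`. -/
def SolvesContinuityEquation (b : ℝ → E → E) (P : ℝ → Measure E) : Prop :=
  ∀ φ : E → ℝ, IsC1b φ → ∀ t : ℝ,
    ∫ x, φ x ∂(P t) = ∫ x, φ x ∂(P 0) + ∫ s in (0 : ℝ)..t, ∫ x, fderiv ℝ φ x (b s x) ∂(P s)

variable {b : ℝ → E → E} {L : NNReal} {Φ : ℝ → ℝ → E → E}

namespace IsFlow

theorem measurable_map (hΦ : IsFlow b Φ) (hb : IsLipschitzField b L) (s t : ℝ) :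
    Measurable (Φ s t) :=
  (hΦ.continuous_map hb s t).measurable

theorem integrable_norm (hΦ : IsFlow b Φ) (hb : IsLipschitzField b L) {μ : Measure E}
    [IsFiniteMeasure μ] (hμ : Integrable (fun x => ‖x‖) μ) (s t : ℝ) :
    Integrable (fun x => ‖Φ s t x‖) μ := by
  obtain ⟨C, _, h⟩ := hΦ.exists_norm_le hb (max |s| |t|)
  refine Integrable.mono' (((integrable_const (1 : ℝ)).add hμ).const_mul C)
    (hΦ.continuous_map hb s t).norm.aestronglyMeasurable (ae_of_all _ fun x => ?_)
  simpa using h s t (le_max_left _ _) (le_max_right _ _) x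

theorem continuous_integral_norm (hΦ : IsFlow b Φ) (hb : IsLipschitzField b L) {μ : Measure E}
    [IsFiniteMeasure μ] (hμ : Integrable (fun x => ‖x‖) μ) (s : ℝ) :
    Continuous fun t => ∫ x, ‖Φ s t x‖ ∂μ := by
  refine continuous_iff_continuousAt.2 fun t => ?_
  obtain ⟨C, _, h⟩ := hΦ.exists_norm_le hb (max |s| (|t| + 1))
  refine continuousAt_of_dominated (bound := fun x => C * (1 + ‖x‖))
    (Eventually.of_forall fun r => (hΦ.continuous_map hb s r).norm.aestronglyMeasurable) ?_
    (((integrable_const (1 : ℝ)).add hμ).const_mul C)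
    (ae_of_all _ fun x => (hΦ.continuous_right s x).norm.continuousAt)
  have : ∀ᶠ r in 𝓝 t, |r| < |t| + 1 :=
    continuous_abs.tendsto t |>.eventually (gt_mem_nhds (lt_add_one _))
  filter_upwards [this] with r hr
  refine ae_of_all _ fun x => ?_
  simpa using h s r (le_max_left _ _) (hr.le.trans (le_max_right _ _)) x

variable [SecondCountableTopology E]

/-- The fundamental theorem of calculus along a flow, integrated over the initial position. -/
theorem integral_comp_sub (hΦ : IsFlow b Φ) (hb : IsLipschitzField b L) {μ : Measure E}
    [IsFiniteMeasure μ] (hμ : Integrable (fun x => ‖x‖) μ) {φ : E → ℝ} (hφ : IsC1b φ) (s t : ℝ) :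
    ∫ x, φ (Φ s t x) ∂μ - ∫ x, φ x ∂μ =
      ∫ r in s..t, ∫ x, fderiv ℝ φ (Φ s r x) (b r (Φ s r x)) ∂μ := by
  have hjoint : Continuous fun p : ℝ × E => fderiv ℝ φ (Φ s p.1 p.2) (b p.1 (Φ s p.1 p.2)) :=
    (hφ.continuous_fderiv.comp (hΦ.continuous_to hb s)).clm_apply
      (hb.continuous_comp continuous_fst (hΦ.continuous_to hb s))
  have hpt : ∀ x, φ (Φ s t x) - φ x =
      ∫ r in s..t, fderiv ℝ φ (Φ s r x) (b r (Φ s r x)) := by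
    intro x
    rw [intervalIntegral.integral_eq_sub_of_hasDerivAt (f := fun r => φ (Φ s r x))
      (fun r _ => (hφ.hasFDerivAt (Φ s r x)).comp_hasDerivAt r (hΦ.ode s x r))
      ((hjoint.comp (Continuous.prodMk_left x)).intervalIntegrable _ _), hΦ.init]
  have hi1 : Integrable (fun x => φ (Φ s t x)) μ := by
    obtain ⟨C, hC⟩ := hφ.2.1
    exact .of_bound (hφ.continuous.comp (hΦ.continuous_map hb s t)).aestronglyMeasurable C
      (ae_of_all _ fun x => hC _)
  rw [← integral_sub hi1 (hφ.integrable μ)]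
  simp_rw [hpt]
  obtain ⟨C, hC0, hC⟩ := hΦ.exists_norm_le hb (max |s| |t|)
  obtain ⟨D, hD⟩ := hφ.2.2
  obtain ⟨M, hM⟩ := (isCompact_uIcc (a := s) (b := t)).exists_bound_of_continuousOn
    (hb.continuous_left 0).continuousOn
  have : IsFiniteMeasure (volume.restrict (Set.uIoc s t)) := ⟨by simp [Set.uIoc]⟩
  refine (intervalIntegral_integral_swap ?_).symm
  -- Domination for Fubini: D bounds the gradient of φ, M bounds b(r, 0) for r between s and t, and
  -- C is the linear growth constant of the flow. The first moment of μ makes the bound integrable.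
  refine Integrable.mono' (g := fun p : ℝ × E => D * (M + L * (C * (1 + ‖p.2‖)))) ?_
    hjoint.aestronglyMeasurable ?_
  · refine Integrable.const_mul ((integrable_const M).add (Integrable.const_mul
      (Integrable.const_mul ((integrable_const 1).add ?_) _) _)) _
    exact hμ.comp_snd _
  · have : ∀ᵐ p : ℝ × E ∂((volume.restrict (Set.uIoc s t)).prod μ), p.1 ∈ Set.uIoc s t :=
      Measure.quasiMeasurePreserving_fst.ae (ae_restrict_mem measurableSet_uIoc)
    filter_upwards [this] with p hp
    have hp' : |p.1| ≤ max |s| |t| := by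
      have h1 := Set.uIoc_subset_uIcc hp
      rcases Set.mem_uIcc.1 h1 with h | h
      · exact abs_le_max_abs_abs h.1 h.2
      · rw [max_comm]; exact abs_le_max_abs_abs h.1 h.2
    have h1 := hC s p.1 (le_max_left _ _) hp' p.2
    have h2 := hb.norm_le p.1 (Φ s p.1 p.2)
    have h3 := hM p.1 (Set.uIoc_subset_uIcc hp)
    refine (ContinuousLinearMap.le_opNorm _ _).trans ?_
    have hD0 : 0 ≤ D := (norm_nonneg _).trans (hD 0)
    refine mul_le_mul (hD _) (h2.trans (add_le_add h3 ?_)) (norm_nonneg _) hD0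
    exact mul_le_mul_of_nonneg_left h1 L.2

/-- The push-forward by the flow solves the continuity equation. -/
theorem solvesContinuityEquation (hΦ : IsFlow b Φ) (hb : IsLipschitzField b L) {μ : Measure E}
    [IsFiniteMeasure μ] (hμ : Integrable (fun x => ‖x‖) μ) :
    SolvesContinuityEquation b fun t => μ.map (Φ 0 t) := by
  intro φ hφ t
  have hm := fun r => (hΦ.measurable_map hb 0 r).aemeasurable (μ := μ)
  have h0 : μ.map (Φ 0 0) = μ := by
    rw [funext (hΦ.init 0)]; exact Measure.map_id
  beta_reduce
  rw [h0, integral_map (hm t) hφ.continuous.aestronglyMeasurable, ← sub_eq_iff_eq_add',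
    hΦ.integral_comp_sub hb hμ hφ 0 t]
  refine intervalIntegral.integral_congr fun r _ => ?_
  exact (integral_map (hm r) (hφ.continuous_fderiv.clm_apply
    (hb.continuous_comp continuous_const continuous_id)).aestronglyMeasurable).symm

theorem continuous_map_probabilityMeasure (hΦ : IsFlow b Φ) (hb : IsLipschitzField b L)
    (μ : ProbabilityMeasure E) (s : ℝ) :
    Continuous fun t => μ.map (hΦ.measurable_map hb s t).aemeasurable := by
  refine continuous_iff_continuousAt.2 fun t => ?_
  refine ProbabilityMeasure.tendsto_iff_forall_integral_tendsto.2 fun f => ?_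
  simp only [ProbabilityMeasure.toMeasure_map]
  simp_rw [fun r => integral_map (μ := (μ : Measure E)) (hΦ.measurable_map hb s r).aemeasurable
    f.continuous.aestronglyMeasurable]
  refine tendsto_integral_filter_of_dominated_convergence (fun _ => ‖f‖)
    (Eventually.of_forall fun r =>
      (f.continuous.comp (hΦ.continuous_map hb s r)).aestronglyMeasurable)
    (Eventually.of_forall fun r => ae_of_all _ fun x => f.norm_coe_le_norm _)
    (integrable_const _)
    (ae_of_all _ fun x => (f.continuous.comp (hΦ.continuous_right s x)).continuousAt)

end IsFlow

end Transport

/-! ### Test functions that determine a finite measure -/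

section Uniqueness

variable {E : Type*} [NormedAddCommGroup E] [MeasurableSpace E]

theorem measure_ext_of_isCompact {μ ν : Measure E} [IsFiniteMeasure μ] [IsFiniteMeasure ν]
    [μ.InnerRegular] [ν.InnerRegular] (h : ∀ k, IsCompact k → μ k = ν k) : μ = ν := by
  ext s hs
  rw [hs.measure_eq_iSup_isCompact, hs.measure_eq_iSup_isCompact]
  simp +contextual only [h]

variable [BorelSpace E]

/-- Integrals of uniformly compactly supported functions, jointly continuous in a parameter, depend
continuously on the parameter and on the measure. -/
theorem continuous_integral_of_compact_support {X Y : Type*} [TopologicalSpace X]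
    [TopologicalSpace Y] {G : X → E → ℝ} (hG : Continuous (Function.uncurry G)) {k : Set E}
    (hk : IsCompact k) (hGk : ∀ p, ∀ x ∉ k, G p x = 0) {P : Y → ProbabilityMeasure E}
    (hP : Continuous P) :
    Continuous fun q : X × Y => ∫ x, G q.1 x ∂(P q.2 : Measure E) := by
  have hGc : ∀ p, Continuous (G p) := fun p => hG.comp (Continuous.prodMk_right p)
  have hGs : ∀ p, HasCompactSupport (G p) := fun p => HasCompactSupport.intro hk (hGk p)
  have hGi : ∀ p y, Integrable (G p) (P y : Measure E) := fun p y =>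
    (hGc p).integrable_of_hasCompactSupport (hGs p)
  refine continuous_iff_continuousAt.2 fun ⟨p₀, y₀⟩ => ?_
  obtain ⟨C, hC⟩ := (hGc p₀).bounded_above_of_compact_support (hGs p₀)
  have h1 := ProbabilityMeasure.tendsto_iff_forall_integral_tendsto.1 (hP.tendsto y₀)
    (BoundedContinuousFunction.ofNormedAddCommGroup (G p₀) (hGc p₀) C hC)
  simp only [BoundedContinuousFunction.coe_ofNormedAddCommGroup] at h1
  rw [Metric.continuousAt_iff']
  intro ε hε
  -- On the compact k the integrands converge uniformly as p tends to p₀. This handles the parameter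
  -- uniformly in the measure, and weak convergence then handles the measure with p₀ fixed.
  have h2 : ∀ᶠ p in 𝓝 p₀, ∀ x ∈ k, ‖G p x - G p₀ x‖ < ε / 2 := by
    refine hk.eventually_forall_of_forall_eventually fun x _ => ?_
    have : Continuous fun z : X × E => ‖G z.1 z.2 - G p₀ z.2‖ :=
      (hG.sub ((hGc p₀).comp continuous_snd)).norm
    refine this.tendsto (p₀, x) |>.eventually (gt_mem_nhds ?_)
    simpa using hε
  rw [Metric.tendsto_nhds] at h1
  rw [nhds_prod_eq]
  filter_upwards [h2.prod_mk (h1 (ε / 2) (half_pos hε))] with q hq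
  have h3 : dist (∫ x, G q.1 x ∂(P q.2 : Measure E)) (∫ x, G p₀ x ∂(P q.2 : Measure E)) ≤ ε / 2 := by
    rw [dist_eq_norm, ← integral_sub (hGi _ _) (hGi _ _)]
    refine (norm_integral_le_of_norm_le_const (C := ε / 2) (ae_of_all _ fun x => ?_)).trans_eq
      (by simp)
    by_cases hx : x ∈ k
    · exact (hq.1 x hx).le
    · simp only [hGk _ x hx, sub_self, norm_zero]; positivity
  calc _ ≤ _ := dist_triangle _ (∫ x, G p₀ x ∂(P q.2 : Measure E)) _
    _ < ε / 2 + ε / 2 := add_lt_add_of_le_of_lt h3 hq.2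
    _ = ε := add_halves ε

/-- Finite measures which agree on compactly supported Lipschitz functions are equal. -/
theorem measure_ext_of_lipschitz_compact_support [ProperSpace E] {μ ν : Measure E}
    [IsFiniteMeasure μ] [IsFiniteMeasure ν]
    (h : ∀ (φ : E → ℝ) (l : NNReal), LipschitzWith l φ → HasCompactSupport φ →
      ∫ x, φ x ∂μ = ∫ x, φ x ∂ν) : μ = ν := by
  refine measure_ext_of_isCompact fun k hk => ?_
  -- Thickened indicators of a compact set are Lipschitz and decrease to its indicator; their
  -- supports are compact because closed thickenings of compact sets are compact in a proper space.
  have hδ : ∀ n : ℕ, 0 < (1 : ℝ) / (n + 1) := fun n => by positivity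
  have hlim := tendsto_one_div_add_atTop_nhds_zero_nat (𝕜 := ℝ)
  have h1 := tendsto_integral_thickenedIndicator_of_isClosed μ hk.isClosed hδ hlim
  have h2 := tendsto_integral_thickenedIndicator_of_isClosed ν hk.isClosed hδ hlim
  have h3 : ∀ n : ℕ, ∫ x, (thickenedIndicator (hδ n) k x : ℝ) ∂μ =
      ∫ x, (thickenedIndicator (hδ n) k x : ℝ) ∂ν := by
    intro n
    refine h _ _ (fun x y => lipschitzWith_thickenedIndicator (hδ n) k x y) ?_
    refine HasCompactSupport.intro (hk.cthickening (r := (1 : ℝ) / (n + 1))) fun x hx => ?_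
    exact NNReal.coe_eq_zero.2 (thickenedIndicator_zero (hδ n) k
      (fun hx' => hx (Metric.thickening_subset_cthickening _ _ hx')))
  simp only [h3] at h1
  have h4 := tendsto_nhds_unique h1 h2
  exact (measureReal_eq_measureReal_iff).1 h4

end Uniqueness

/-! ### Mollification of Lipschitz functions -/

section Uniqueness

open scoped Pointwise

variable {E : Type*} [NormedAddCommGroup E] [NormedSpace ℝ E]
  {b : ℝ → E → E} {L : NNReal} {Φ : ℝ → ℝ → E → E}

/-- The flow almost commutes with translations, for short times. -/
theorem IsFlow.norm_sub_sub_le (hΦ : IsFlow b Φ) (hb : IsLipschitzField b L) {s t τ : ℝ}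
    (hst : s ≤ t) (hτ : t - s ≤ τ) (x y : E) :
    ‖(Φ s t x - Φ s t y) - (x - y)‖ ≤ L * Real.exp (L * τ) * ‖x - y‖ * (t - s) := by
  have h := norm_image_sub_le_of_norm_deriv_le_segment' (f := fun r => Φ s r x - Φ s r y)
    (f' := fun r => b r (Φ s r x) - b r (Φ s r y)) (a := s) (b := t)
    (C := L * Real.exp (L * τ) * ‖x - y‖)
    (fun r _ => ((hΦ.ode s x r).sub (hΦ.ode s y r)).hasDerivWithinAt) (fun r hr => ?_) t ⟨hst, le_rfl⟩
  · simpa [hΦ.init] using h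
  · refine (hb.norm_sub_le r _ _).trans ?_
    rw [mul_assoc]
    refine mul_le_mul_of_nonneg_left ((hΦ.norm_sub_le hb s r x y).trans ?_) L.2
    refine mul_le_mul_of_nonneg_right (Real.exp_le_exp.2 ?_) (norm_nonneg _)
    rw [abs_of_nonneg (sub_nonneg.2 hr.1)]
    exact mul_le_mul_of_nonneg_left (by linarith [hr.2]) L.2

variable [MeasurableSpace E]

/-- The weak form of the continuity equation is additive in time. -/
theorem SolvesContinuityEquation.integral_sub {P : ℝ → Measure E}
    (hP : SolvesContinuityEquation b P) {φ : E → ℝ} (hφ : IsC1b φ)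
    (hi : Continuous fun r => ∫ x, fderiv ℝ φ x (b r x) ∂(P r)) (s t : ℝ) :
    ∫ x, φ x ∂(P t) - ∫ x, φ x ∂(P s) = ∫ r in s..t, ∫ x, fderiv ℝ φ x (b r x) ∂(P r) := by
  rw [hP φ hφ t, hP φ hφ s, add_sub_add_left_eq_sub,
    intervalIntegral.integral_interval_sub_left (hi.intervalIntegrable _ _)
      (hi.intervalIntegrable _ _)]

/-- Reversal of time. -/
theorem SolvesContinuityEquation.reverse {P : ℝ → Measure E}
    (hP : SolvesContinuityEquation b P) :
    SolvesContinuityEquation (fun t x => -b (-t) x) fun t => P (-t) := by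
  intro φ hφ t
  beta_reduce
  rw [hP φ hφ (-t), neg_zero]
  congr 1
  simp only [map_neg, integral_neg]
  rw [intervalIntegral.integral_neg,
    intervalIntegral.integral_comp_neg (fun s => ∫ x, fderiv ℝ φ x (b s x) ∂(P s)),
    neg_zero, ← intervalIntegral.integral_symm]

variable [BorelSpace E] [FiniteDimensional ℝ E]

local notation "haarE" => (Measure.addHaar : Measure E)

/-- The normed bump is a probability density carried by a ball of radius `rOut`, so a pointwise
bound on that ball passes to the averages. It yields both the distance from ψ to its mollification
and the commutator of mollification with the flow. -/
theorem integral_mollifier_mul_sub_le (r : ContDiffBump (0 : E)) {f g : E → ℝ} {C : ℝ}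
    (hf : Continuous f) (hg : Continuous g) (h : ∀ y, ‖y‖ ≤ r.rOut → |f y - g y| ≤ C) :
    |∫ y, r.normed haarE y * f y ∂haarE - ∫ y, r.normed haarE y * g y ∂haarE| ≤ C := by
  have hi : ∀ f : E → ℝ, Continuous f → Integrable (fun y => r.normed haarE y * f y) haarE := fun f hf =>
    (r.continuous_normed.mul hf).integrable_of_hasCompactSupport
      r.hasCompactSupport_normed.mul_right
  rw [← integral_sub (hi f hf) (hi g hg), ← Real.norm_eq_abs]
  have h1 : ∀ y, ‖r.normed haarE y * f y - r.normed haarE y * g y‖ ≤ r.normed haarE y * C := by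
    intro y
    rw [← mul_sub, norm_mul, Real.norm_of_nonneg (r.nonneg_normed y)]
    by_cases hy : ‖y‖ ≤ r.rOut
    · exact mul_le_mul_of_nonneg_left (h y hy) (r.nonneg_normed y)
    · have : r.normed haarE y = 0 := by
        by_contra h0
        have : y ∈ Function.support (r.normed haarE) := h0
        rw [r.support_normed_eq] at this
        exact hy (by simpa using (Metric.mem_ball.1 this).le)
      simp [this]
  refine (norm_integral_le_of_norm_le (r.integrable_normed.mul_const C) (ae_of_all _ h1)).trans_eq ?_
  rw [integral_mul_const, r.integral_normed, one_mul]

/-- Convolution with a mollifier. -/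
noncomputable def mollify (r : ContDiffBump (0 : E)) (ψ : E → ℝ) : E → ℝ :=
  convolution (r.normed haarE) ψ (ContinuousLinearMap.lsmul ℝ ℝ) haarE

theorem mollify_apply (r : ContDiffBump (0 : E)) (ψ : E → ℝ) (x : E) :
    mollify r ψ x = ∫ y, r.normed haarE y * ψ (x - y) ∂haarE := rfl

/-- The derivative of the convolution with a mollifier. -/
noncomputable def mollifyDeriv (r : ContDiffBump (0 : E)) (ψ : E → ℝ) : E → (E →L[ℝ] ℝ) :=
  convolution (fderiv ℝ (r.normed haarE)) ψ ((ContinuousLinearMap.lsmul ℝ ℝ).precompL E) haarE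

theorem hasFDerivAt_mollify (r : ContDiffBump (0 : E)) {ψ : E → ℝ} (hψ : Continuous ψ) (x : E) :
    HasFDerivAt (mollify r ψ) (mollifyDeriv r ψ x) x :=
  r.hasCompactSupport_normed.hasFDerivAt_convolution_left _ r.contDiff_normed
    hψ.locallyIntegrable x

theorem mollify_eq_zero (r : ContDiffBump (0 : E)) {ψ : E → ℝ} {k : Set E}
    (hψ : ∀ x ∉ k, ψ x = 0) {x : E} (hx : x ∉ k + Metric.closedBall 0 r.rOut) :
    mollify r ψ x = 0 := by
  by_contra h
  have h1 := support_convolution_subset (μ := haarE) (ContinuousLinearMap.lsmul ℝ ℝ)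
    (f := r.normed haarE) (g := ψ) h
  rw [add_comm] at h1
  refine hx ((Set.add_subset_add (fun y hy => ?_) (fun y hy => ?_) h1))
  · by_contra h2; exact hy (hψ y h2)
  · rw [r.support_normed_eq] at hy; exact Metric.ball_subset_closedBall hy

theorem mollifyDeriv_eq_zero (r : ContDiffBump (0 : E)) {ψ : E → ℝ} {k : Set E}
    (hψ : ∀ x ∉ k, ψ x = 0) {x : E} (hx : x ∉ k + Metric.closedBall 0 r.rOut) :
    mollifyDeriv r ψ x = 0 := by
  by_contra h
  have h1 := support_convolution_subset (μ := haarE) ((ContinuousLinearMap.lsmul ℝ ℝ).precompL E)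
    (f := fderiv ℝ (r.normed haarE)) (g := ψ) h
  rw [add_comm] at h1
  refine hx ((Set.add_subset_add (fun y hy => ?_) (fun y hy => ?_) h1))
  · by_contra h2; exact hy (hψ y h2)
  · have := support_fderiv_subset ℝ hy
    rwa [r.tsupport_normed_eq] at this

/-- Joint continuity is needed because the test function ψ_s moves with time, and is integrated
against a measure that moves as well. -/
theorem continuous_mollify_param (r : ContDiffBump (0 : E)) {X : Type*} [TopologicalSpace X]
    {ψ : X → E → ℝ} (hψ : Continuous (Function.uncurry ψ)) {k : Set E} (hk : IsCompact k)
    (hψk : ∀ p, ∀ x ∉ k, ψ p x = 0) : Continuous fun q : X × E => mollify r (ψ q.1) q.2 := by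
  have := continuousOn_convolution_right_with_param (μ := haarE) (ContinuousLinearMap.lsmul ℝ ℝ)
    (s := Set.univ) (f := r.normed haarE) (g := ψ) hk (fun p x _ hx => hψk p x hx)
    r.continuous_normed.locallyIntegrable hψ.continuousOn
  rwa [Set.univ_prod_univ, continuousOn_univ] at this

theorem continuous_mollifyDeriv_param (r : ContDiffBump (0 : E)) {X : Type*} [TopologicalSpace X]
    {ψ : X → E → ℝ} (hψ : Continuous (Function.uncurry ψ)) {k : Set E} (hk : IsCompact k)
    (hψk : ∀ p, ∀ x ∉ k, ψ p x = 0) :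
    Continuous fun q : X × E => mollifyDeriv r (ψ q.1) q.2 := by
  have := continuousOn_convolution_right_with_param (μ := haarE)
    ((ContinuousLinearMap.lsmul ℝ ℝ).precompL E)
    (s := Set.univ) (f := fderiv ℝ (r.normed haarE)) (g := ψ) hk (fun p x _ hx => hψk p x hx)
    ((r.contDiff_normed (n := 1)).continuous_fderiv one_ne_zero).locallyIntegrable hψ.continuousOn
  rwa [Set.univ_prod_univ, continuousOn_univ] at this

/-- Mollification turns the merely Lipschitz dual function into an admissible test function for the
weak formulation. -/
theorem isC1b_mollify (r : ContDiffBump (0 : E)) {ψ : E → ℝ} (hψ : Continuous ψ) {k : Set E}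
    (hk : IsCompact k) (hψk : ∀ x ∉ k, ψ x = 0) : IsC1b (mollify r ψ) := by
  have hd : fderiv ℝ (mollify r ψ) = mollifyDeriv r ψ :=
    funext fun x => (hasFDerivAt_mollify r hψ x).fderiv
  have hk' : IsCompact (k + Metric.closedBall (0 : E) r.rOut) :=
    hk.add (isCompact_closedBall _ _)
  have hc : ContDiff ℝ 1 (mollify r ψ) :=
    r.hasCompactSupport_normed.contDiff_convolution_left _ r.contDiff_normed hψ.locallyIntegrable
  refine ⟨hc, ?_, ?_⟩
  · exact hc.continuous.bounded_above_of_compact_support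
      (HasCompactSupport.intro hk' fun x hx => mollify_eq_zero r hψk hx)
  · refine (hc.continuous_fderiv one_ne_zero).bounded_above_of_compact_support
      (HasCompactSupport.intro hk' fun x hx => ?_)
    rw [hd]
    exact mollifyDeriv_eq_zero r hψk hx

theorem abs_mollify_sub_le (r : ContDiffBump (0 : E)) {ψ : E → ℝ} {l : ℝ} (hψ : Continuous ψ)
    (hl0 : 0 ≤ l) (hl : ∀ x y, |ψ x - ψ y| ≤ l * ‖x - y‖) (x : E) :
    |mollify r ψ x - ψ x| ≤ l * r.rOut := by
  have h := integral_mollifier_mul_sub_le r (f := fun y => ψ (x - y)) (g := fun _ => ψ x)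
    (C := l * r.rOut) (by fun_prop) continuous_const fun y hy => by
      refine (hl _ _).trans (mul_le_mul_of_nonneg_left ?_ hl0)
      simpa using hy
  rwa [integral_mul_const, r.integral_normed, one_mul] at h

end Uniqueness

/-! ### The continuity equation: uniqueness by duality -/

section Uniqueness

open scoped Pointwise

variable {E : Type*} [NormedAddCommGroup E] [NormedSpace ℝ E]
  {b : ℝ → E → E} {L : NNReal} {Φ : ℝ → ℝ → E → E}
  [MeasurableSpace E] [BorelSpace E] [FiniteDimensional ℝ E]

/-- A weak solution of the continuity equation moves, over a short time, almost like the flow. The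
two functions compared here are `∫ φ dP` at the end and at the beginning. -/
theorem IsFlow.eventually_abs_integral_sub_le (hΦ : IsFlow b Φ) (hb : IsLipschitzField b L)
    {P : ℝ → ProbabilityMeasure E} (hPc : Continuous P)
    (hPm : ∀ t, Integrable (fun x => ‖x‖) (P t : Measure E))
    (hPs : SolvesContinuityEquation b fun t => (P t : Measure E))
    {f : ℝ → E → ℝ} {f' : ℝ → E → (E →L[ℝ] ℝ)} (hf : ∀ t, IsC1b (f t))
    (hff' : ∀ t x, HasFDerivAt (f t) (f' t x) x)
    (hf' : Continuous fun q : ℝ × E => f' q.1 q.2) {k : Set E} (hk : IsCompact k)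
    (hfk : ∀ t, ∀ x ∉ k, f' t x = 0) (s : ℝ) {η : ℝ} (hη : 0 < η) :
    ∀ᶠ t in 𝓝[>] s,
      |∫ x, f t x ∂(P t : Measure E) - ∫ x, f t (Φ s t x) ∂(P s : Measure E)| ≤ η * (t - s) := by
  have hfd : ∀ t, fderiv ℝ (f t) = f' t := fun t => funext fun x => (hff' t x).fderiv
  let G : ℝ × ℝ → E → ℝ := fun q x => f' q.1 x (b q.2 x)
  have hG : Continuous (Function.uncurry G) :=
    (hf'.comp (by fun_prop : Continuous fun p : (ℝ × ℝ) × E => (p.1.1, p.2))).clm_apply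
      (hb.continuous_comp (by fun_prop) (by fun_prop))
  have hGk : ∀ q, ∀ x ∉ k, G q x = 0 := fun q x hx => by simp [G, hfk q.1 x hx]
  -- Q restarts from P s and follows the flow. Both P and Q solve the equation and agree at time s,
  -- so their rates of change against one test function agree to leading order.
  let Q : ℝ → ProbabilityMeasure E := fun t => (P s).map (hΦ.measurable_map hb s t).aemeasurable
  have hQ : Continuous Q := hΦ.continuous_map_probabilityMeasure hb (P s) s
  have hQs : Q s = P s := by
    apply Subtype.ext
    change (P s : Measure E).map (Φ s s) = _
    rw [funext (hΦ.init s)]; exact Measure.map_id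
  -- The first coordinate is the time at which the test function is frozen, the second the running
  -- time. D is jointly continuous and vanishes at (s, s), so it is below η nearby and its integral
  -- over [s, t] is at most η(t - s).
  let D : ℝ × ℝ → ℝ := fun q =>
    ∫ x, G q x ∂(P q.2 : Measure E) - ∫ x, G q x ∂(Q q.2 : Measure E)
  have hΔ : Continuous fun q : ℝ × ℝ => (q, q.2) := by fun_prop
  have hD1 : Continuous fun q : ℝ × ℝ => ∫ x, G q x ∂(P q.2 : Measure E) :=
    (continuous_integral_of_compact_support hG hk hGk hPc).comp hΔ
  have hD2 : Continuous fun q : ℝ × ℝ => ∫ x, G q x ∂(Q q.2 : Measure E) :=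
    (continuous_integral_of_compact_support hG hk hGk hQ).comp hΔ
  have hD : Continuous D := hD1.sub hD2
  have hD0 : D (s, s) = 0 := by simp only [D, hQs, sub_self]
  have hkey : ∀ t, ∫ x, f t x ∂(P t : Measure E) - ∫ x, f t (Φ s t x) ∂(P s : Measure E) =
      ∫ r in s..t, D (t, r) := by
    intro t
    have h1 := hPs.integral_sub (hf t) (by
      simp only [hfd]
      exact hD1.comp (by fun_prop : Continuous fun r : ℝ => (t, r))) s t
    have h2 := hΦ.integral_comp_sub hb (hPm s) (hf t) s t
    have h3 : ∀ r, ∫ x, fderiv ℝ (f t) (Φ s r x) (b r (Φ s r x)) ∂(P s : Measure E) =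
        ∫ x, G (t, r) x ∂(Q r : Measure E) := by
      intro r
      rw [hfd]
      change _ = ∫ x, G (t, r) x ∂((P s : Measure E).map (Φ s r))
      have hGc : Continuous (G (t, r)) := hG.comp (Continuous.prodMk_right (t, r))
      exact (integral_map (hΦ.measurable_map hb s r).aemeasurable hGc.aestronglyMeasurable).symm
    simp only [h3] at h2
    rw [intervalIntegral.integral_sub, ← h2]
    · simp only [hfd] at h1
      rw [← h1]
      ring
    · exact (hD1.comp (by fun_prop : Continuous fun r : ℝ => (t, r))).intervalIntegrable _ _
    · exact (hD2.comp (by fun_prop : Continuous fun r : ℝ => (t, r))).intervalIntegrable _ _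
  have hnear : ∀ᶠ q in 𝓝 (s, s), |D q| < η :=
    (hD.abs.tendsto (s, s)).eventually (gt_mem_nhds (by simpa [hD0] using hη))
  obtain ⟨δ, hδ, hball⟩ := Metric.eventually_nhds_iff.1 hnear
  filter_upwards [Ioo_mem_nhdsGT (show s < s + δ by linarith)] with t ht
  rw [hkey, ← Real.norm_eq_abs]
  refine (intervalIntegral.norm_integral_le_of_norm_le_const (C := η) fun r hr => ?_).trans_eq ?_
  · rw [Set.uIoc_of_le ht.1.le] at hr
    refine (hball ?_).le
    rw [Prod.dist_eq, max_lt_iff]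
    simp only [Real.dist_eq]
    constructor <;> rw [abs_of_nonneg] <;> linarith [ht.1, ht.2, hr.1, hr.2]
  · rw [abs_of_nonneg (sub_nonneg.2 ht.1.le)]

/-- Duality between the continuity equation and the flow, forward in time. -/
theorem IsFlow.integral_eq_of_solves (hΦ : IsFlow b Φ) (hb : IsLipschitzField b L)
    {P : ℝ → ProbabilityMeasure E} (hPc : Continuous P)
    (hPm : ∀ t, Integrable (fun x => ‖x‖) (P t : Measure E))
    (hPs : SolvesContinuityEquation b fun t => (P t : Measure E)) {φ : E → ℝ} {l : NNReal}
    (hφ : LipschitzWith l φ) (hφc : HasCompactSupport φ) {τ : ℝ} (hτ : 0 ≤ τ) :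
    ∫ x, φ x ∂(P τ : Measure E) = ∫ x, φ (Φ 0 τ x) ∂(P 0 : Measure E) := by
  -- Clamping the time to [0, τ] makes ψ defined for every s, with one Lipschitz constant l' and one
  -- compact k containing all the supports.
  let c : ℝ → ℝ := fun s => max 0 (min s τ)
  have hc : Continuous c := by fun_prop
  have hc1 : ∀ s, c s ∈ Set.Icc 0 τ := fun s => ⟨le_max_left _ _, max_le hτ (min_le_right _ _)⟩
  have hc2 : ∀ s ∈ Set.Icc 0 τ, c s = s := fun s hs => by simp [c, hs.1, hs.2]
  let ψ : ℝ → E → ℝ := fun s x => φ (Φ (c s) τ x)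
  have hψ : Continuous (Function.uncurry ψ) :=
    hφ.continuous.comp ((hΦ.continuous hb).comp
      ((hc.comp continuous_fst).prodMk (continuous_const.prodMk continuous_snd)))
  have hψc : ∀ s, Continuous (ψ s) := fun s => hψ.comp (Continuous.prodMk_right s)
  let l' : ℝ := l * Real.exp (L * τ)
  have hl' : 0 ≤ l' := by positivity
  have hψl : ∀ s x y, |ψ s x - ψ s y| ≤ l' * ‖x - y‖ := by
    intro s x y
    have h1 := hφ.dist_le_mul (Φ (c s) τ x) (Φ (c s) τ y)
    rw [Real.dist_eq, dist_eq_norm] at h1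
    refine h1.trans ?_
    simp only [l', mul_assoc]
    refine mul_le_mul_of_nonneg_left ((hΦ.norm_sub_le hb _ _ x y).trans ?_) l.2
    refine mul_le_mul_of_nonneg_right (Real.exp_le_exp.2 ?_) (norm_nonneg _)
    rw [abs_of_nonneg (sub_nonneg.2 (hc1 s).2)]
    exact mul_le_mul_of_nonneg_left (by linarith [(hc1 s).1]) L.2
  -- If φ(Φ(s, τ) x) ≠ 0 then x is the backward image of a point of the support of φ; k gathers
  -- these images for all s in [0, τ].
  let k : Set E := (fun q : ℝ × E => Φ τ q.1 q.2) '' (Set.Icc 0 τ ×ˢ tsupport φ)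
  have hk : IsCompact k := (isCompact_Icc.prod hφc).image (hΦ.continuous_to hb τ)
  have hψk : ∀ s, ∀ x ∉ k, ψ s x = 0 := by
    intro s x hx
    by_contra h
    exact hx ⟨(c s, Φ (c s) τ x), ⟨hc1 s, subset_tsupport _ h⟩, hΦ.comp_symm hb _ _ _⟩
  have main : ∀ ε : ℝ, 0 < ε →
      |∫ x, φ x ∂(P τ : Measure E) - ∫ x, φ (Φ 0 τ x) ∂(P 0 : Measure E)| ≤
        (2 * l' + (l' * (L * Real.exp (L * τ)) + 1) * τ) * ε := by
    intro ε hε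
    let r : ContDiffBump (0 : E) := ⟨ε / 2, ε, half_pos hε, half_lt_self hε⟩
    have hr : r.rOut = ε := rfl
    let f : ℝ → E → ℝ := fun s => mollify r (ψ s)
    let f' : ℝ → E → (E →L[ℝ] ℝ) := fun s => mollifyDeriv r (ψ s)
    let k' : Set E := k + Metric.closedBall (0 : E) r.rOut
    have hk' : IsCompact k' := hk.add (isCompact_closedBall _ _)
    have hf : Continuous (Function.uncurry f) := continuous_mollify_param r hψ hk hψk
    have hfb : ∀ s, IsC1b (f s) := fun s => isC1b_mollify r (hψc s) hk (hψk s)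
    let h : ℝ → ℝ := fun s => ∫ x, f s x ∂(P s : Measure E)
    have hh : Continuous h :=
      (continuous_integral_of_compact_support hf hk'
        (fun s x hx => mollify_eq_zero r (hψk s) hx) hPc).comp
        (by fun_prop : Continuous fun s : ℝ => (s, s))
    -- The commutator estimate. As ψ_s = ψ_t ∘ Φ(s,t), both sides are averages over |y| ≤ ε of ψ_t,
    -- at Φ(s,t)x - y and at Φ(s,t)(x - y). These points differ by O(ε(t - s)): the flow almost
    -- commutes with translations.
    have hcomm : ∀ s t, 0 ≤ s → s ≤ t → t ≤ τ → ∀ x,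
        |f t (Φ s t x) - f s x| ≤ l' * (L * Real.exp (L * τ)) * ε * (t - s) := by
      intro s t hs hst ht x
      simp only [f, mollify_apply]
      refine integral_mollifier_mul_sub_le r (by fun_prop) (by fun_prop) fun y hy => ?_
      have h1 : ψ s (x - y) = ψ t (Φ s t (x - y)) := by
        simp only [ψ]
        rw [hc2 s ⟨hs, hst.trans ht⟩, hc2 t ⟨hs.trans hst, ht⟩, hΦ.comp hb]
      rw [h1]
      refine (hψl _ _ _).trans ?_
      have h2 := hΦ.norm_sub_sub_le hb hst (by linarith : t - s ≤ τ) x (x - y)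
      rw [sub_sub_cancel] at h2
      have h3 : Φ s t x - y - Φ s t (x - y) = Φ s t x - Φ s t (x - y) - y := by abel
      rw [h3, mul_assoc l', mul_assoc l']
      refine mul_le_mul_of_nonneg_left (h2.trans ?_) hl'
      have := sub_nonneg.2 hst
      gcongr
    have hstep : ∀ s ∈ Set.Ico 0 τ, ∀ η : ℝ, 0 < η → ∀ᶠ t in 𝓝[>] s,
        |h t - h s| ≤ (l' * (L * Real.exp (L * τ)) * ε + η) * (t - s) := by
      intro s hs η hη
      filter_upwards [hΦ.eventually_abs_integral_sub_le hb hPc hPm hPs hfb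
        (fun t x => hasFDerivAt_mollify r (hψc t) x)
        (continuous_mollifyDeriv_param r hψ hk hψk) hk'
        (fun t x hx => mollifyDeriv_eq_zero r (hψk t) hx) s hη,
        Ioo_mem_nhdsGT hs.2] with t h1 ht
      have h2 : |∫ x, f t (Φ s t x) ∂(P s : Measure E) - ∫ x, f s x ∂(P s : Measure E)| ≤
          l' * (L * Real.exp (L * τ)) * ε * (t - s) := by
        have hi : Integrable (fun x => f t (Φ s t x)) (P s : Measure E) := by
          obtain ⟨C, hC⟩ := (hfb t).2.1
          exact .of_bound ((hfb t).continuous.comp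
            (hΦ.continuous_map hb s t)).aestronglyMeasurable C (ae_of_all _ fun x => hC _)
        rw [← integral_sub hi ((hfb s).integrable _), ← Real.norm_eq_abs]
        refine (norm_integral_le_of_norm_le_const (ae_of_all _ fun x =>
          hcomm s t hs.1 ht.1.le ht.2.le x)).trans_eq (by simp)
      have h3 := abs_sub_le (h t) (∫ x, f t (Φ s t x) ∂(P s : Measure E)) (h s)
      calc |h t - h s| ≤ _ := h3
        _ ≤ η * (t - s) + l' * (L * Real.exp (L * τ)) * ε * (t - s) := add_le_add h1 h2
        _ = _ := by ring
    -- A mean value inequality from right slopes alone, as h is not known to be differentiable. The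
    -- added 1 in the constant makes the comparison of slopes strict.
    have hdini : |h τ - h 0| ≤ (l' * (L * Real.exp (L * τ)) + 1) * ε * τ := by
      have := image_norm_le_of_liminf_right_slope_norm_lt_deriv_boundary (f := fun s => h s - h 0)
        (f' := fun _ => l' * (L * Real.exp (L * τ)) * ε) (a := 0) (b := τ)
        (B := fun s => (l' * (L * Real.exp (L * τ)) + 1) * ε * s)
        (B' := fun _ => (l' * (L * Real.exp (L * τ)) + 1) * ε)
        (hh.sub continuous_const).continuousOn ?_ (by simp) (by fun_prop)
        (fun s _ => by
          simpa using ((hasDerivAt_id s).const_mul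
            ((l' * (L * Real.exp (L * τ)) + 1) * ε)).hasDerivWithinAt)
        (fun s _ _ => by nlinarith) ⟨hτ, le_rfl⟩
      · exact this
      · intro s hs ρ hρ
        refine Eventually.frequently ?_
        filter_upwards [hstep s hs ((ρ - l' * (L * Real.exp (L * τ)) * ε) / 2) (by linarith),
          self_mem_nhdsWithin] with t ht hst
        have hst' : 0 < t - s := sub_pos.2 hst
        rw [slope_def_field, div_lt_iff₀ hst']
        have h1 := abs_sub_abs_le_abs_sub (h t - h 0) (h s - h 0)
        rw [sub_sub_sub_cancel_right] at h1
        simp only [Function.comp_apply, Real.norm_eq_abs]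
        nlinarith
    -- Undoing the mollification costs l'ε at each of the two ends, hence the 2 l' in the final
    -- constant.
    have hend : ∀ s, |h s - ∫ x, ψ s x ∂(P s : Measure E)| ≤ l' * ε := by
      intro s
      rw [← integral_sub ((hfb s).integrable _) ((hψc s).integrable_of_hasCompactSupport
        (HasCompactSupport.intro hk (hψk s))), ← Real.norm_eq_abs]
      exact (norm_integral_le_of_norm_le_const (ae_of_all _ fun x =>
          abs_mollify_sub_le r (hψc s) hl' (hψl s) x)).trans_eq (by simp [hr])
    have e0 := hend 0
    have e1 := hend τ
    have hψ0 : ∀ x, ψ 0 x = φ (Φ 0 τ x) := fun x => by simp only [ψ, hc2 0 ⟨le_rfl, hτ⟩]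
    have hψτ : ∀ x, ψ τ x = φ x := fun x => by simp only [ψ, hc2 τ ⟨hτ, le_rfl⟩, hΦ.init]
    simp only [hψ0] at e0
    simp only [hψτ] at e1
    rw [abs_le] at e0 e1 hdini ⊢
    constructor <;> nlinarith [e0.1, e0.2, e1.1, e1.2, hdini.1, hdini.2]
  have hlim : Tendsto (fun ε : ℝ => (2 * l' + (l' * (L * Real.exp (L * τ)) + 1) * τ) * ε)
      (𝓝[>] 0) (𝓝 0) := by
    have : Continuous fun ε : ℝ => (2 * l' + (l' * (L * Real.exp (L * τ)) + 1) * τ) * ε := by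
      fun_prop
    have h := this.tendsto 0
    rw [mul_zero] at h
    exact h.mono_left nhdsWithin_le_nhds
  have h0 := ge_of_tendsto hlim (eventually_nhdsWithin_of_forall main)
  exact sub_eq_zero.1 (abs_nonpos_iff.1 h0)

theorem IsFlow.eq_map_of_solves_of_nonneg (hΦ : IsFlow b Φ) (hb : IsLipschitzField b L)
    {P : ℝ → ProbabilityMeasure E} (hPc : Continuous P)
    (hPm : ∀ t, Integrable (fun x => ‖x‖) (P t : Measure E))
    (hPs : SolvesContinuityEquation b fun t => (P t : Measure E)) {t : ℝ} (ht : 0 ≤ t) :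
    (P t : Measure E) = (P 0 : Measure E).map (Φ 0 t) := by
  have hm := (hΦ.measurable_map hb 0 t).aemeasurable (μ := (P 0 : Measure E))
  have := Measure.isProbabilityMeasure_map hm
  have := FiniteDimensional.proper_real E
  refine measure_ext_of_lipschitz_compact_support fun φ l hφ hφc => ?_
  rw [integral_map hm hφ.continuous.aestronglyMeasurable]
  exact hΦ.integral_eq_of_solves hb hPc hPm hPs hφ hφc ht

/-- Uniqueness for the continuity equation driven by a Lipschitz field: every weak solution is
transported by the flow. -/
theorem IsFlow.eq_map_of_solves (hΦ : IsFlow b Φ) (hb : IsLipschitzField b L)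
    {P : ℝ → ProbabilityMeasure E} (hPc : Continuous P)
    (hPm : ∀ t, Integrable (fun x => ‖x‖) (P t : Measure E))
    (hPs : SolvesContinuityEquation b fun t => (P t : Measure E)) (t : ℝ) :
    (P t : Measure E) = (P 0 : Measure E).map (Φ 0 t) := by
  rcases le_total 0 t with ht | ht
  · exact hΦ.eq_map_of_solves_of_nonneg hb hPc hPm hPs ht
  · have := hΦ.reverse.eq_map_of_solves_of_nonneg hb.reverse (P := fun t => P (-t))
      (hPc.comp continuous_neg) (fun t => hPm (-t)) hPs.reverse (neg_nonneg.2 ht)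
    simpa using this

end Uniqueness

/-! ### Lipschitz maps and Lebesgue measure -/

section Density

variable {E : Type*} [NormedAddCommGroup E] [NormedSpace ℝ E] [FiniteDimensional ℝ E]
  [MeasurableSpace E] [BorelSpace E]

/-- A Lipschitz map multiplies the Lebesgue measure at most by the power of its constant. -/
theorem LipschitzWith.addHaar_image_le {C : NNReal} {f : E → E} (hf : LipschitzWith C f)
    (μ : Measure E) [μ.IsAddHaarMeasure] (s : Set E) :
    μ (f '' s) ≤ (C : ENNReal) ^ (Module.finrank ℝ E) * μ s := by
  -- Haar measure is a multiple of the Hausdorff measure of the same dimension, for which the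
  -- Lipschitz bound is immediate. No Jacobian is involved.
  have hc := Measure.isAddLeftInvariant_eq_smul μ
    (Measure.hausdorffMeasure (X := E) (Module.finrank ℝ E))
  rw [hc, Measure.smul_apply, Measure.smul_apply, ENNReal.smul_def, ENNReal.smul_def, smul_eq_mul,
    smul_eq_mul, mul_left_comm]
  gcongr
  simpa using hf.hausdorffMeasure_image_le (d := Module.finrank ℝ E) (by positivity) s

/-- The preimage of s under f lies in the image of s under the left inverse g, whose volume the
Lipschitz constant of g controls. -/
theorem map_le_smul_of_lipschitz_inverse (μ : Measure E) [μ.IsAddHaarMeasure] {C : NNReal}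
    {f g : E → E} (hf : Measurable f) (hg : LipschitzWith C g) (hgf : ∀ x, g (f x) = x) :
    μ.map f ≤ (C ^ (Module.finrank ℝ E)) • μ := by
  refine Measure.le_iff.2 fun s hs => ?_
  rw [Measure.map_apply hf hs]
  have h1 : f ⁻¹' s ⊆ g '' s := fun x hx => ⟨f x, hx, hgf x⟩
  refine (measure_mono h1).trans ((hg.addHaar_image_le μ s).trans_eq ?_)
  simp [ENNReal.smul_def]

end Density

/-! ### Integrals under maps of small distortion -/

section Distortion

variable {X : Type*} [MeasurableSpace X] {μ : Measure X} {c : NNReal} {T : X → X}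

theorem MeasureTheory.Integrable.comp_of_map_le {F : X → ℝ} (hF : Integrable F μ)
    (hT : Measurable T) (h : μ.map T ≤ c • μ) : Integrable (fun x => F (T x)) μ :=
  (hF.smul_measure_nnreal.mono_measure h).comp_measurable hT

theorem integral_comp_le_mul (hT : Measurable T) (h : μ.map T ≤ c • μ) {F : X → ℝ}
    (hF : Integrable F μ) (hF0 : 0 ≤ F) : ∫ x, F (T x) ∂μ ≤ c * ∫ x, F x ∂μ := by
  have hi : Integrable F (c • μ) := hF.smul_measure_nnreal
  rw [← integral_map hT.aemeasurable (hi.mono_measure h).1]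
  refine (integral_mono_measure h (ae_of_all _ hF0) hi).trans_eq ?_
  rw [integral_smul_nnreal_measure, NNReal.smul_def, smul_eq_mul]

theorem integral_le_mul_integral_comp (hT : Measurable T) (h : μ.map T ≤ c • μ)
    (h' : μ ≤ c • μ.map T) {F : X → ℝ} (hF : Integrable F μ) (hF0 : 0 ≤ F) :
    ∫ x, F x ∂μ ≤ c * ∫ x, F (T x) ∂μ := by
  have hi : Integrable F (μ.map T) := hF.smul_measure_nnreal.mono_measure h
  rw [← integral_map hT.aemeasurable hi.1]
  refine (integral_mono_measure h' (ae_of_all _ hF0) hi.smul_measure_nnreal).trans_eq ?_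
  rw [integral_smul_nnreal_measure, NNReal.smul_def, smul_eq_mul]

/-- A map that distorts the measure by a factor at most `c` changes integrals by a factor at most
`c`. -/
theorem abs_integral_comp_sub_le (hT : Measurable T) (h : μ.map T ≤ c • μ)
    (h' : μ ≤ c • μ.map T) {F : X → ℝ} (hF : Integrable F μ) :
    |∫ x, F (T x) ∂μ - ∫ x, F x ∂μ| ≤ (c - 1) * ∫ x, |F x| ∂μ := by
  have key : ∀ G : X → ℝ, Integrable G μ → 0 ≤ G →
      |∫ x, G (T x) ∂μ - ∫ x, G x ∂μ| ≤ (c - 1) * ∫ x, G x ∂μ := by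
    intro G hG hG0
    have h1 := integral_comp_le_mul hT h hG hG0
    have h2 := integral_le_mul_integral_comp hT h h' hG hG0
    have h3 : 0 ≤ ∫ x, G x ∂μ := integral_nonneg hG0
    have h4 : 0 ≤ ∫ x, G (T x) ∂μ := integral_nonneg fun x => hG0 (T x)
    have hc : (0 : ℝ) ≤ c := c.2
    rw [abs_le]
    constructor
    -- The bound c ≥ 1 is not assumed: `h1` and `h2` force it as soon as ∫ G is positive, and if ∫ G
    -- = 0 both integrals vanish.
    · by_cases h5 : ∫ x, G x ∂μ ≤ ∫ x, G (T x) ∂μ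
      · rcases h3.eq_or_lt with h6 | h6
        · rw [← h6] at h5 ⊢; linarith
        · have : (1 : ℝ) ≤ c := by
            by_contra hlt
            nlinarith
          nlinarith
      · have h7 : 1 ≤ (c : ℝ) := by
          by_contra hlt
          nlinarith
        nlinarith
    · linarith
  have e1 := key _ hF.pos_part (fun x => le_max_right _ _)
  have e2 := key _ hF.neg_part (fun x => le_max_right _ _)
  have hFT := hF.comp_of_map_le hT h
  have d1 : ∫ x, F x ∂μ = ∫ x, max (F x) 0 ∂μ - ∫ x, max (-F x) 0 ∂μ := by
    rw [← integral_sub hF.pos_part hF.neg_part]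
    exact integral_congr_ae (ae_of_all _ fun x => (max_zero_sub_eq_self _).symm)
  have d2 : ∫ x, F (T x) ∂μ = ∫ x, max (F (T x)) 0 ∂μ - ∫ x, max (-F (T x)) 0 ∂μ := by
    rw [← integral_sub hFT.pos_part hFT.neg_part]
    exact integral_congr_ae (ae_of_all _ fun x => (max_zero_sub_eq_self _).symm)
  have d3 : ∫ x, |F x| ∂μ = ∫ x, max (F x) 0 ∂μ + ∫ x, max (-F x) 0 ∂μ := by
    rw [← integral_add hF.pos_part hF.neg_part]
    exact integral_congr_ae (ae_of_all _ fun x => (max_zero_add_max_neg_zero_eq_abs_self _).symm)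
  rw [d1, d2, d3]
  rw [abs_le] at e1 e2 ⊢
  constructor <;> nlinarith [e1.1, e1.2, e2.1, e2.2]

theorem integral_withDensity_ofReal {F : Type*} [NormedAddCommGroup F] [NormedSpace ℝ F]
    {g : X → ℝ} (hg : AEMeasurable g μ) (hg0 : 0 ≤ᵐ[μ] g) (f : X → F) :
    ∫ x, f x ∂(μ.withDensity fun x => ENNReal.ofReal (g x)) = ∫ x, g x • f x ∂μ := by
  rw [integral_withDensity_eq_integral_toReal_smul₀ hg.ennreal_ofReal
    (ae_of_all _ fun x => ENNReal.ofReal_lt_top)]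
  refine integral_congr_ae ?_
  filter_upwards [hg0] with x hx
  rw [ENNReal.toReal_ofReal hx]

/-- The `L¹` distance between a density and the density of its image by a map that is close to the
identity. -/
theorem integral_abs_sub_le_of_map_eq (hT : Measurable T) (h : μ.map T ≤ c • μ)
    (h' : μ ≤ c • μ.map T) {f g k : X → ℝ} (hfm : Measurable f) (hgm : Measurable g)
    (hf : Integrable f μ) (hg : Integrable g μ) (hf0 : 0 ≤ᵐ[μ] f) (hg0 : 0 ≤ᵐ[μ] g)
    (hfg : μ.withDensity (fun x => ENNReal.ofReal (f x)) =
      (μ.withDensity fun x => ENNReal.ofReal (g x)).map T) (hk : Integrable k μ) :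
    ∫ x, |f x - g x| ∂μ ≤ 2 * ∫ x, |g x - k x| ∂μ + ∫ x, |k x - k (T x)| ∂μ +
      (c - 1) * ∫ x, |k x| ∂μ := by
  classical
  -- With σ the sign of f - g, the L¹ distance is ∫ σ f - ∫ σ g, and the transport relation turns ∫
  -- σ f into ∫ (σ ∘ T) g.
  let σ : X → ℝ := fun x => if 0 ≤ f x - g x then 1 else -1
  have hσ : Measurable σ :=
    Measurable.ite (measurableSet_le measurable_const (hfm.sub hgm)) measurable_const
      measurable_const
  have hσ1 : ∀ x, |σ x| = 1 := fun x => by simp only [σ]; split_ifs <;> simp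
  have hmul : ∀ {a b : X → ℝ}, Measurable a → (∀ x, |a x| = 1) → Integrable b μ →
      Integrable (fun x => a x * b x) μ := fun ha ha1 hb =>
    hb.bdd_mul ha.aestronglyMeasurable (c := 1) (ae_of_all _ fun x => (ha1 x).le)
  have hσT : Measurable fun x => σ (T x) := hσ.comp hT
  have hkT : Integrable (fun x => k (T x)) μ := hk.comp_of_map_le hT h
  have e1 : ∫ x, |f x - g x| ∂μ = ∫ x, σ x * f x ∂μ - ∫ x, σ x * g x ∂μ := by
    rw [← integral_sub (hmul hσ hσ1 hf) (hmul hσ hσ1 hg)]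
    refine integral_congr_ae (ae_of_all _ fun x => ?_)
    simp only [σ]
    split_ifs with h0
    · rw [abs_of_nonneg h0]; ring
    · rw [abs_of_neg (not_le.1 h0)]; ring
  have e2 : ∫ x, σ x * f x ∂μ = ∫ x, σ (T x) * g x ∂μ := by
    have h1 := integral_withDensity_ofReal hf.1.aemeasurable hf0 σ
    have h2 := integral_withDensity_ofReal hg.1.aemeasurable hg0 fun x => σ (T x)
    rw [hfg, integral_map hT.aemeasurable hσ.aestronglyMeasurable, h2] at h1
    simpa only [smul_eq_mul, mul_comm] using h1.symm
  have hgk : Integrable (fun x => g x - k x) μ := hg.sub hk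
  have hkk : Integrable (fun x => k x - k (T x)) μ := hk.sub hkT
  -- Since σ has no regularity, it cannot be compared with σ ∘ T directly. Replacing g by k costs
  -- 2‖g - k‖₁, replacing k by k ∘ T costs ‖k - k ∘ T‖₁, and what remains compares (σ k) ∘ T with σ
  -- k, where only the distortion of T enters.
  have e3 : ∫ x, σ (T x) * g x ∂μ - ∫ x, σ x * g x ∂μ =
      (∫ x, σ (T x) * (g x - k x) ∂μ - ∫ x, σ x * (g x - k x) ∂μ) +
      ∫ x, σ (T x) * (k x - k (T x)) ∂μ +
      (∫ x, σ (T x) * k (T x) ∂μ - ∫ x, σ x * k x ∂μ) := by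
    have hσT1 : ∀ x, |σ (T x)| = 1 := fun x => hσ1 _
    simp only [mul_sub]
    rw [integral_sub (hmul hσT hσT1 hg) (hmul hσT hσT1 hk), integral_sub (hmul hσ hσ1 hg)
      (hmul hσ hσ1 hk), integral_sub (hmul hσT hσT1 hk) (hmul hσT hσT1 hkT)]
    ring
  have hle : ∀ {a b : X → ℝ}, (∀ x, |a x| = 1) →
      |∫ x, a x * b x ∂μ| ≤ ∫ x, |b x| ∂μ := fun {a b} ha => by
    refine (abs_integral_le_integral_abs).trans_eq ?_
    simp only [abs_mul, ha, one_mul]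
  have f1 := hle (a := fun x => σ (T x)) (b := fun x => g x - k x) fun x => hσ1 _
  have f2 := hle (a := σ) (b := fun x => g x - k x) hσ1
  have f3 := hle (a := fun x => σ (T x)) (b := fun x => k x - k (T x)) fun x => hσ1 _
  have f4 := abs_integral_comp_sub_le hT h h' (hmul hσ hσ1 hk)
  simp only [abs_mul, hσ1, one_mul] at f4
  rw [e1, e2, e3]
  rw [abs_le] at f1 f2 f3 f4
  linarith [f1.2, f2.1, f3.2, f4.2]

end Distortion

/-! ### Continuity in L¹ of transported densities -/

section Density

variable {E : Type*} [NormedAddCommGroup E] [NormedSpace ℝ E] [FiniteDimensional ℝ E]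
  [MeasurableSpace E] [BorelSpace E] {b : ℝ → E → E} {L : NNReal} {Φ : ℝ → ℝ → E → E}

/-- The factor by which the flow distorts volumes. -/
noncomputable def flowDistortion (E : Type*) [NormedAddCommGroup E] [NormedSpace ℝ E] (L : NNReal)
    (s t : ℝ) : NNReal :=
  (Real.exp (L * |t - s|)).toNNReal ^ Module.finrank ℝ E

theorem IsFlow.map_le (hΦ : IsFlow b Φ) (hb : IsLipschitzField b L) (μ : Measure E)
    [μ.IsAddHaarMeasure] (s t : ℝ) : μ.map (Φ s t) ≤ flowDistortion E L s t • μ := by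
  refine map_le_smul_of_lipschitz_inverse μ (hΦ.measurable_map hb s t) ?_ (hΦ.comp_symm hb s t)
  rw [abs_sub_comm]
  exact hΦ.lipschitzWith hb t s

/-- The upper bound for the reverse map Φ t s, pushed forward by Φ s t. -/
theorem IsFlow.le_map (hΦ : IsFlow b Φ) (hb : IsLipschitzField b L) (μ : Measure E)
    [μ.IsAddHaarMeasure] (s t : ℝ) : μ ≤ flowDistortion E L s t • μ.map (Φ s t) := by
  have h := hΦ.map_le hb μ t s
  have hm := Measure.map_mono h (hΦ.measurable_map hb s t)
  have hid : Φ s t ∘ Φ t s = id := funext fun x => hΦ.comp_symm hb t s x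
  rw [Measure.map_map (hΦ.measurable_map hb s t) (hΦ.measurable_map hb t s), hid, Measure.map_id,
    Measure.map_smul] at hm
  simpa only [flowDistortion, abs_sub_comm s t] using hm

theorem IsFlow.map_absolutelyContinuous (hΦ : IsFlow b Φ) (hb : IsLipschitzField b L)
    {μ ν : Measure E} [μ.IsAddHaarMeasure] (hν : ν ≪ μ) (s t : ℝ) : ν.map (Φ s t) ≪ μ :=
  (hν.map (hΦ.measurable_map hb s t)).trans
    ((Measure.absolutelyContinuous_of_le (hΦ.map_le hb μ s t)).trans
      (Measure.smul_absolutelyContinuous))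

theorem IsFlow.tendsto_integral_abs_sub (hΦ : IsFlow b Φ) (hb : IsLipschitzField b L)
    (μ : Measure E) [μ.IsAddHaarMeasure] {k : E → ℝ} (hk : Continuous k)
    (hkc : HasCompactSupport k) (s : ℝ) :
    Tendsto (fun t => ∫ x, |k x - k (Φ s t x)| ∂μ) (𝓝 s) (𝓝 0) := by
  obtain ⟨C, hC⟩ := hk.bounded_above_of_compact_support hkc
  -- One compact set containing the supports of all k ∘ Φ(s,t) with |t - s| ≤ 1, so that a multiple
  -- of its indicator dominates.
  let A : Set E := (fun q : ℝ × E => Φ q.1 s q.2) '' (Set.Icc (s - 1) (s + 1) ×ˢ tsupport k)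
  have hA : IsCompact A := (isCompact_Icc.prod hkc).image
    ((hΦ.continuous hb).comp (by fun_prop : Continuous fun q : ℝ × E => (q.1, s, q.2)))
  have hA' : ∀ t ∈ Set.Icc (s - 1) (s + 1), ∀ x ∉ A, k (Φ s t x) = 0 := by
    intro t ht x hx
    by_contra h
    exact hx ⟨(t, Φ s t x), ⟨ht, subset_tsupport _ h⟩, hΦ.comp_symm hb _ _ _⟩
  have hkA : ∀ x ∉ A, k x = 0 := fun x hx => by
    simpa [hΦ.init] using hA' s ⟨by linarith, by linarith⟩ x hx
  have h0 : ∫ x, |k x - k (Φ s s x)| ∂μ = 0 := by simp [hΦ.init]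
  rw [← h0]
  refine tendsto_integral_filter_of_dominated_convergence (A.indicator fun _ => C + C)
    (Eventually.of_forall fun t =>
      (hk.sub (hk.comp (hΦ.continuous_map hb s t))).abs.aestronglyMeasurable) ?_
    ((integrable_indicator_iff hA.measurableSet).2
      (integrableOn_const (hs := hA.measure_lt_top.ne))) (ae_of_all _ fun x => ?_)
  · filter_upwards [Icc_mem_nhds (by linarith : s - 1 < s) (by linarith : s < s + 1)] with t ht
    refine ae_of_all _ fun x => ?_
    by_cases hx : x ∈ A
    · rw [Set.indicator_of_mem hx, Real.norm_eq_abs, abs_abs]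
      exact (abs_sub _ _).trans (add_le_add (hC x) (hC _))
    · rw [Set.indicator_of_notMem hx, hkA x hx, hA' t ht x hx]; simp
  · exact ((continuous_const.sub (hk.comp (hΦ.continuous_right s x))).abs).tendsto s

/-- Densities transported by the flow of a Lipschitz field depend continuously on time in `L¹`. -/
theorem IsFlow.tendsto_integral_abs_density_sub (hΦ : IsFlow b Φ) (hb : IsLipschitzField b L)
    (μ : Measure E) [μ.IsAddHaarMeasure] {ν : Measure E} {f : ℝ → E → ℝ}
    (hfm : ∀ t, Measurable (f t)) (hf : ∀ t, Integrable (f t) μ) (hf0 : ∀ t, 0 ≤ᵐ[μ] f t)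
    (hfν : ∀ t, μ.withDensity (fun x => ENNReal.ofReal (f t x)) = ν.map (Φ 0 t)) (s : ℝ) :
    Tendsto (fun t => ∫ x, |f t x - f s x| ∂μ) (𝓝 s) (𝓝 0) := by
  have := FiniteDimensional.proper_real E
  rw [Metric.tendsto_nhds]
  intro ε hε
  -- The approximation error ε/4 enters twice; the other half of ε is left for the two terms that
  -- vanish as t tends to s.
  obtain ⟨k, hkc, hk1, hk, hki⟩ := (hf s).exists_hasCompactSupport_integral_sub_le
    (ε := ε / 4) (by positivity)
  have h1 := hΦ.tendsto_integral_abs_sub hb μ hk hkc s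
  have h2 : Tendsto (fun t => ((flowDistortion E L s t : ℝ) - 1) * ∫ x, |k x| ∂μ) (𝓝 s) (𝓝 0) := by
    have hc : Continuous fun t => ((flowDistortion E L s t : ℝ) - 1) * ∫ x, |k x| ∂μ := by
      simp only [flowDistortion]
      fun_prop
    simpa [flowDistortion] using hc.tendsto s
  have h3 := h1.add h2
  rw [add_zero] at h3
  filter_upwards [h3.eventually (gt_mem_nhds (half_pos hε))] with t ht
  have hfs : μ.withDensity (fun x => ENNReal.ofReal (f t x)) =
      (μ.withDensity fun x => ENNReal.ofReal (f s x)).map (Φ s t) := by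
    rw [hfν, hfν, Measure.map_map (hΦ.measurable_map hb _ _) (hΦ.measurable_map hb _ _)]
    congr 1
    exact funext fun x => (hΦ.comp hb _ _ _ _).symm
  have h4 := integral_abs_sub_le_of_map_eq (hΦ.measurable_map hb s t) (hΦ.map_le hb μ s t)
    (hΦ.le_map hb μ s t) (hfm t) (hfm s) (hf t) (hf s) (hf0 t) (hf0 s) hfs hki
  rw [Real.dist_eq, sub_zero, abs_of_nonneg (integral_nonneg fun x => abs_nonneg _)]
  simp only [Real.norm_eq_abs] at hk1
  linarith

end Density

/-! ### Mean-field characteristics -/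

section MeanFieldFlow

variable {E : Type*} [NormedAddCommGroup E]

/-- A Lipschitz interaction kernel which vanishes at the origin. -/
structure IsLipschitzKernel (K : E → E → E) (L : NNReal) : Prop where
  norm_sub_le : ∀ z z' w w', ‖K z z' - K w w'‖ ≤ L * (‖z - w‖ + ‖z' - w'‖)
  zero : K 0 0 = 0

namespace IsLipschitzKernel

variable {K : E → E → E} {L : NNReal}

theorem norm_le (hK : IsLipschitzKernel K L) (z z' : E) : ‖K z z'‖ ≤ L * (‖z‖ + ‖z'‖) := by
  simpa [hK.zero] using hK.norm_sub_le z z' 0 0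

theorem neg (hK : IsLipschitzKernel K L) : IsLipschitzKernel (fun z z' => -K z z') L :=
  ⟨fun z z' w w' => by
    rw [← neg_add', norm_neg, ← sub_eq_add_neg]; exact hK.norm_sub_le z z' w w', by simp [hK.zero]⟩

theorem continuous (hK : IsLipschitzKernel K L) : Continuous fun p : E × E => K p.1 p.2 := by
  refine (LipschitzWith.of_dist_le_mul (K := 2 * L) fun p q => ?_).continuous
  rw [dist_eq_norm, dist_eq_norm]
  refine (hK.norm_sub_le _ _ _ _).trans ?_
  have h1 := norm_fst_le (p - q)
  have h2 := norm_snd_le (p - q)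
  have hL : (0 : ℝ) ≤ L := L.2
  push_cast
  simp only [Prod.fst_sub, Prod.snd_sub] at h1 h2
  nlinarith

theorem continuous_comp (hK : IsLipschitzKernel K L) {X : Type*} [TopologicalSpace X] {f g : X → E}
    (hf : Continuous f) (hg : Continuous g) : Continuous fun x => K (f x) (g x) :=
  hK.continuous.comp (hf.prodMk hg)

variable [NormedSpace ℝ E] [MeasurableSpace E] [BorelSpace E] [SecondCountableTopology E]
  {μ : Measure E} [IsProbabilityMeasure μ]

theorem integrable (hK : IsLipschitzKernel K L) {g : E → E} (hg : AEStronglyMeasurable g μ)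
    (hgi : Integrable (fun x => ‖g x‖) μ) (z : E) : Integrable (fun x => K z (g x)) μ := by
  refine Integrable.mono' (((integrable_const ‖z‖).add hgi).const_mul (L : ℝ))
    ((hK.continuous_comp continuous_const continuous_id).comp_aestronglyMeasurable hg)
    (ae_of_all _ fun x => ?_)
  simpa using hK.norm_le z (g x)

/-- The stability estimate behind this section: it gives the Lipschitz bounds on the velocity
fields, the Lipschitz bound for the ODE in the space of maps, and the Grönwall inequality for two
flows. -/
theorem norm_integral_sub_le (hK : IsLipschitzKernel K L) {g h : E → E}
    (hg : AEStronglyMeasurable g μ) (hh : AEStronglyMeasurable h μ)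
    (hgi : Integrable (fun x => ‖g x‖) μ) (hhi : Integrable (fun x => ‖h x‖) μ) (z w : E) :
    ‖∫ x, K z (g x) ∂μ - ∫ x, K w (h x) ∂μ‖ ≤ L * (‖z - w‖ + ∫ x, ‖g x - h x‖ ∂μ) := by
  rw [← integral_sub (hK.integrable hg hgi z) (hK.integrable hh hhi w)]
  have hi : Integrable (fun x => ‖g x - h x‖) μ :=
    (((integrable_norm_iff hg).1 hgi).sub ((integrable_norm_iff hh).1 hhi)).norm
  refine (norm_integral_le_of_norm_le (((integrable_const ‖z - w‖).add hi).const_mul (L : ℝ))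
    (ae_of_all _ fun x => hK.norm_sub_le _ _ _ _)).trans_eq ?_
  simp only [Pi.add_apply]
  rw [integral_const_mul, integral_add (integrable_const _) hi]
  simp

theorem norm_integral_le (hK : IsLipschitzKernel K L) {g : E → E}
    (hgi : Integrable (fun x => ‖g x‖) μ) (z : E) :
    ‖∫ x, K z (g x) ∂μ‖ ≤ L * (‖z‖ + ∫ x, ‖g x‖ ∂μ) := by
  refine (norm_integral_le_of_norm_le (((integrable_const ‖z‖).add hgi).const_mul (L : ℝ))
    (ae_of_all _ fun x => hK.norm_le _ _)).trans_eq ?_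
  simp only [Pi.add_apply]
  rw [integral_const_mul, integral_add (integrable_const _) hgi]
  simp

end IsLipschitzKernel

variable [NormedSpace ℝ E] [MeasurableSpace E] [BorelSpace E] [SecondCountableTopology E]

/-- The characteristics of the mean-field equation: `X t ζ` is the position at time `t` of the
particle which starts from `ζ`, when the initial positions are distributed according to `μ`. -/
structure IsMeanFieldFlow (K : E → E → E) (μ : Measure E) (X : ℝ → E → E) : Prop where
  init : ∀ ζ, X 0 ζ = ζ
  continuous : ∀ t, Continuous (X t)
  growth : ∀ T, ∃ C, 0 ≤ C ∧ ∀ t, |t| ≤ T → ∀ ζ, ‖X t ζ‖ ≤ C * (1 + ‖ζ‖)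
  ode : ∀ ζ t, HasDerivAt (fun t => X t ζ) (∫ ζ', K (X t ζ) (X t ζ') ∂μ) t

variable {K : E → E → E} {L : NNReal} {μ : Measure E} [IsProbabilityMeasure μ]

-- Writing X_t(ζ) = ζ + (1 + |ζ|) u_t(ζ) with u_t bounded and continuous turns the coupled
-- characteristics into one autonomous ODE for u_t in a Banach space. The first moment of μ makes
-- its right-hand side finite and Lipschitz, with constant L(1 + m) where m = ∫ (1 + |ζ|) dμ.
open BoundedContinuousFunction in
theorem exists_isMeanFieldFlow [CompleteSpace E] (hK : IsLipschitzKernel K L)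
    (hμ : Integrable (fun x => ‖x‖) μ) : ∃ X, IsMeanFieldFlow K μ X := by
  let w : E → ℝ := fun ζ => 1 + ‖ζ‖
  have hw : Continuous w := by fun_prop
  have hw1 : ∀ ζ, 1 ≤ w ζ := fun ζ => by simp [w]
  have hw0 : ∀ ζ, 0 < w ζ := fun ζ => zero_lt_one.trans_le (hw1 ζ)
  have hwi : Integrable w μ := (integrable_const _).add hμ
  let m : ℝ := ∫ ζ, w ζ ∂μ
  have hm : 0 ≤ m := integral_nonneg fun ζ => (hw0 ζ).le
  let Y : (E →ᵇ E) → E → E := fun u ζ => ζ + w ζ • u ζ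
  have hYc : ∀ u, Continuous (Y u) := fun u => continuous_id.add (hw.smul u.continuous)
  have hYn : ∀ u ζ, ‖Y u ζ‖ ≤ (1 + ‖u‖) * w ζ := by
    intro u ζ
    have h1 := norm_add_le ζ (w ζ • u ζ)
    rw [norm_smul, Real.norm_of_nonneg (hw0 ζ).le] at h1
    have h2 := mul_le_mul_of_nonneg_left (u.norm_coe_le_norm ζ) (hw0 ζ).le
    have h3 : ‖ζ‖ ≤ w ζ := by simp [w]
    change ‖ζ + w ζ • u ζ‖ ≤ _
    nlinarith
  have hYi : ∀ u, Integrable (fun ζ => ‖Y u ζ‖) μ := fun u =>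
    (hwi.const_mul (1 + ‖u‖)).mono' (hYc u).norm.aestronglyMeasurable
      (ae_of_all _ fun ζ => by simpa using hYn u ζ)
  have hYd : ∀ u v ζ, ‖Y u ζ - Y v ζ‖ ≤ w ζ * ‖u - v‖ := by
    intro u v ζ
    have : Y u ζ - Y v ζ = w ζ • (u - v) ζ := by simp [Y, smul_sub]
    rw [this, norm_smul, Real.norm_of_nonneg (hw0 ζ).le]
    exact mul_le_mul_of_nonneg_left ((u - v).norm_coe_le_norm ζ) (hw0 ζ).le
  have hYdi : ∀ u v, ∫ ζ, ‖Y u ζ - Y v ζ‖ ∂μ ≤ m * ‖u - v‖ := fun u v => by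
    rw [← integral_mul_const]
    exact integral_mono_of_nonneg (ae_of_all _ fun _ => norm_nonneg _) (hwi.mul_const _)
      (ae_of_all _ (hYd u v))
  let V : (E →ᵇ E) → E → E := fun u ζ => (w ζ)⁻¹ • ∫ ζ', K (Y u ζ) (Y u ζ') ∂μ
  have hVc : ∀ u, Continuous (V u) := by
    intro u
    have h1 : LipschitzWith L fun z => ∫ ζ', K z (Y u ζ') ∂μ :=
      LipschitzWith.of_dist_le_mul fun z z' => by
        simpa [dist_eq_norm] using hK.norm_integral_sub_le (hYc u).aestronglyMeasurable
          (hYc u).aestronglyMeasurable (hYi u) (hYi u) z z'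
    exact (hw.inv₀ fun ζ => (hw0 ζ).ne').smul (h1.continuous.comp (hYc u))
  have hVn : ∀ u ζ, ‖V u ζ‖ ≤ L * ((1 + ‖u‖) * (1 + m)) := by
    intro u ζ
    simp only [V]
    rw [norm_smul, norm_inv, Real.norm_of_nonneg (hw0 ζ).le, inv_mul_le_iff₀ (hw0 ζ)]
    refine (hK.norm_integral_le (hYi u) (Y u ζ)).trans ?_
    have h1 : ∫ ζ', ‖Y u ζ'‖ ∂μ ≤ (1 + ‖u‖) * m := by
      rw [← integral_const_mul]
      exact integral_mono (hYi u) (hwi.const_mul _) (hYn u)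
    rw [mul_left_comm]
    refine mul_le_mul_of_nonneg_left ?_ L.2
    have h2 := hYn u ζ
    have h3 : 0 ≤ (1 + ‖u‖) * m := by positivity
    nlinarith [hw1 ζ]
  let W : (E →ᵇ E) → (E →ᵇ E) := fun u =>
    ofNormedAddCommGroup (V u) (hVc u) (L * ((1 + ‖u‖) * (1 + m))) (hVn u)
  let M : NNReal := L * (1 + ⟨m, hm⟩)
  have hW : IsLipschitzField (fun _ : ℝ => W) M := by
    refine ⟨fun _ => LipschitzWith.of_dist_le_mul fun u v => ?_, fun _ => continuous_const⟩
    rw [dist_le (by positivity)]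
    intro ζ
    change dist ((w ζ)⁻¹ • ∫ ζ', K (Y u ζ) (Y u ζ') ∂μ) ((w ζ)⁻¹ • ∫ ζ', K (Y v ζ) (Y v ζ') ∂μ) ≤ _
    rw [dist_eq_norm, ← smul_sub, norm_smul, norm_inv, Real.norm_of_nonneg (hw0 ζ).le,
      inv_mul_le_iff₀ (hw0 ζ)]
    refine (hK.norm_integral_sub_le (hYc u).aestronglyMeasurable (hYc v).aestronglyMeasurable
      (hYi u) (hYi v) _ _).trans ?_
    have h1 := hYd u v ζ
    have h2 := hYdi u v
    have h3 : 0 ≤ m * ‖u - v‖ := by positivity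
    have hM : (M : ℝ) = L * (1 + m) := rfl
    rw [dist_eq_norm, hM, mul_left_comm, mul_assoc]
    refine (mul_le_mul_of_nonneg_left (add_le_add h1 h2) L.2).trans ?_
    have h4 : m * ‖u - v‖ ≤ w ζ * (m * ‖u - v‖) := le_mul_of_one_le_left h3 (hw1 ζ)
    calc (L : ℝ) * (w ζ * ‖u - v‖ + m * ‖u - v‖)
        ≤ L * (w ζ * ‖u - v‖ + w ζ * (m * ‖u - v‖)) :=
          mul_le_mul_of_nonneg_left (add_le_add_right h4 _) L.2
      _ = _ := by ring
  obtain ⟨u, hu0, hu⟩ := hW.exists_solution 0 0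
  have huc : Continuous u := continuous_iff_continuousAt.2 fun t => (hu t).continuousAt
  refine ⟨fun t => Y (u t), fun ζ => by simp [Y, hu0], fun t => hYc _, fun T => ?_, fun ζ t => ?_⟩
  · obtain ⟨C, hC⟩ := (isCompact_Icc (a := -T) (b := T)).exists_bound_of_continuousOn
      huc.continuousOn
    refine ⟨1 + |C|, by positivity, fun t ht ζ => (hYn (u t) ζ).trans ?_⟩
    refine mul_le_mul_of_nonneg_right ?_ (hw0 ζ).le
    exact add_le_add_right ((hC t (abs_le.1 ht)).trans (le_abs_self C)) 1
  · have h1 := ((evalCLM ℝ ζ).hasFDerivAt (x := u t)).comp_hasDerivAt t (hu t)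
    have h2 := (h1.const_smul (w ζ)).const_add ζ
    have h3 : w ζ • (evalCLM ℝ ζ) (W (u t)) = ∫ ζ', K (Y (u t) ζ) (Y (u t) ζ') ∂μ := by
      change w ζ • ((w ζ)⁻¹ • ∫ ζ', K (Y (u t) ζ) (Y (u t) ζ') ∂μ) = _
      rw [smul_smul, mul_inv_cancel₀ (hw0 ζ).ne', one_smul]
    rw [h3] at h2
    exact h2

namespace IsMeanFieldFlow

variable {X : ℝ → E → E}

/-- Reversing time replaces K by -K, which satisfies the same bounds, so estimates are needed for t
≥ 0 only. -/
theorem neg_time (hX : IsMeanFieldFlow K μ X) :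
    IsMeanFieldFlow (fun z z' => -K z z') μ fun t => X (-t) where
  init ζ := by simpa using hX.init ζ
  continuous t := hX.continuous (-t)
  growth T := by
    obtain ⟨C, hC, h⟩ := hX.growth T
    exact ⟨C, hC, fun t ht => h (-t) (by rwa [abs_neg])⟩
  ode ζ t := by
    have := (hX.ode ζ (-t)).scomp t (hasDerivAt_neg t)
    rwa [neg_one_smul, ← integral_neg] at this

theorem continuous_left (hX : IsMeanFieldFlow K μ X) (ζ : E) : Continuous fun t => X t ζ :=
  continuous_iff_continuousAt.2 fun t => (hX.ode ζ t).continuousAt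

theorem integrable_norm (hX : IsMeanFieldFlow K μ X) (hμ : Integrable (fun x => ‖x‖) μ) (t : ℝ) :
    Integrable (fun ζ => ‖X t ζ‖) μ := by
  obtain ⟨C, _, hC⟩ := hX.growth |t|
  exact (((integrable_const 1).add hμ).const_mul C).mono' (hX.continuous t).norm.aestronglyMeasurable
    (ae_of_all _ fun ζ => by simpa using hC t le_rfl ζ)

/-- The velocity field generated by the mean-field flow. -/
noncomputable def _root_.meanFieldVelocity (K : E → E → E) (μ : Measure E) (X : ℝ → E → E) (t : ℝ)
    (z : E) : E :=
  ∫ ζ', K z (X t ζ') ∂μ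

theorem isLipschitzField (hX : IsMeanFieldFlow K μ X) (hK : IsLipschitzKernel K L)
    (hμ : Integrable (fun x => ‖x‖) μ) : IsLipschitzField (meanFieldVelocity K μ X) L := by
  refine ⟨fun t => LipschitzWith.of_dist_le_mul fun z w => ?_, fun z => ?_⟩
  · simpa [dist_eq_norm, meanFieldVelocity] using hK.norm_integral_sub_le (hX.continuous t).aestronglyMeasurable
      (hX.continuous t).aestronglyMeasurable (hX.integrable_norm hμ t) (hX.integrable_norm hμ t)
      z w
  · refine continuous_iff_continuousAt.2 fun t => ?_
    obtain ⟨C, _, hC⟩ := hX.growth (|t| + 1)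
    refine continuousAt_of_dominated (bound := fun ζ => L * (‖z‖ + C * (1 + ‖ζ‖)))
      (Eventually.of_forall fun r =>
        (hK.continuous_comp continuous_const (hX.continuous r)).aestronglyMeasurable) ?_
      (((integrable_const _).add (((integrable_const (1 : ℝ)).add hμ).const_mul C)).const_mul _)
      (ae_of_all _ fun ζ =>
        (hK.continuous_comp continuous_const (hX.continuous_left ζ)).continuousAt)
    have : ∀ᶠ r in 𝓝 t, |r| < |t| + 1 :=
      continuous_abs.tendsto t |>.eventually (gt_mem_nhds (lt_add_one _))
    filter_upwards [this] with r hr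
    refine ae_of_all _ fun ζ => (hK.norm_le _ _).trans ?_
    have := hC r hr.le ζ
    gcongr

/-- Once its velocity field is frozen, the nonlinear flow is the flow of a Lipschitz field, so
invertibility, volume distortion and the continuity equation come from the linear theory. -/
theorem eq_flow (hX : IsMeanFieldFlow K μ X) (hK : IsLipschitzKernel K L)
    (hμ : Integrable (fun x => ‖x‖) μ) {Φ : ℝ → ℝ → E → E}
    (hΦ : IsFlow (meanFieldVelocity K μ X) Φ) (t : ℝ) : Φ 0 t = X t := by
  funext ζ
  have := hΦ.eq_of_solution (hX.isLipschitzField hK hμ) (hX.ode ζ) 0 t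
  rw [hX.init] at this
  exact this.symm

/-- A flow whose velocity field is the mean-field velocity of its own image measures is a mean-field
flow. -/
theorem of_isFlow {b : ℝ → E → E} {Φ : ℝ → ℝ → E → E} (hΦ : IsFlow b Φ) (hb : IsLipschitzField b L)
    (h : ∀ t z, b t z = ∫ ζ, K z (Φ 0 t ζ) ∂μ) : IsMeanFieldFlow K μ (Φ 0) where
  init := hΦ.init 0
  continuous := hΦ.continuous_map hb 0
  growth T := by
    obtain ⟨C, hC, hCb⟩ := hΦ.exists_norm_le hb (max T 0)
    exact ⟨C, hC, fun t ht ζ => hCb 0 t (by simp) (ht.trans (le_max_left _ _)) ζ⟩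
  ode ζ t := by
    rw [← h]
    exact hΦ.ode 0 ζ t

theorem continuous_integral_norm_sub {X' : ℝ → E → E} (hX : IsMeanFieldFlow K μ X)
    (hX' : IsMeanFieldFlow K μ X') (hμ : Integrable (fun x => ‖x‖) μ) :
    Continuous fun t => ∫ ζ, ‖X t ζ - X' t ζ‖ ∂μ := by
  refine continuous_iff_continuousAt.2 fun t => ?_
  obtain ⟨C, _, hC⟩ := hX.growth (|t| + 1)
  obtain ⟨C', _, hC'⟩ := hX'.growth (|t| + 1)
  refine continuousAt_of_dominated (bound := fun ζ => C * (1 + ‖ζ‖) + C' * (1 + ‖ζ‖))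
    (Eventually.of_forall fun r =>
      ((hX.continuous r).sub (hX'.continuous r)).norm.aestronglyMeasurable) ?_
    ((((integrable_const (1 : ℝ)).add hμ).const_mul C).add
      (((integrable_const (1 : ℝ)).add hμ).const_mul C'))
    (ae_of_all _ fun ζ => ((hX.continuous_left ζ).sub (hX'.continuous_left ζ)).norm.continuousAt)
  have : ∀ᶠ r in 𝓝 t, |r| < |t| + 1 :=
    continuous_abs.tendsto t |>.eventually (gt_mem_nhds (lt_add_one _))
  filter_upwards [this] with r hr
  refine ae_of_all _ fun ζ => ?_
  rw [norm_norm]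
  exact (norm_sub_le _ _).trans (add_le_add (hC r hr.le ζ) (hC' r hr.le ζ))

theorem continuous_uncurry [CompleteSpace E] (hX : IsMeanFieldFlow K μ X)
    (hK : IsLipschitzKernel K L) (hμ : Integrable (fun x => ‖x‖) μ) :
    Continuous fun p : ℝ × E => X p.1 p.2 := by
  have hb := hX.isLipschitzField hK hμ
  obtain ⟨Φ, hΦ⟩ := IsFlow.exists_of_lipschitz hb
  simpa only [hX.eq_flow hK hμ hΦ] using hΦ.continuous_to hb 0

end IsMeanFieldFlow

/-- The mean value inequality, integrated over a parameter. -/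
theorem integral_norm_le_intervalIntegral {Ω F : Type*} [TopologicalSpace Ω] [MeasurableSpace Ω]
    [OpensMeasurableSpace Ω] [SecondCountableTopology Ω] [NormedAddCommGroup F] [NormedSpace ℝ F]
    [CompleteSpace F]
    {P : Measure Ω} [IsFiniteMeasure P] {y y' : ℝ → Ω → F} (hy0 : ∀ ω, y 0 ω = 0)
    (hy : ∀ ω t, HasDerivAt (fun t => y t ω) (y' t ω) t)
    (hy' : Continuous fun p : ℝ × Ω => y' p.1 p.2) {t : ℝ} (ht : 0 ≤ t) {G : Ω → ℝ}
    (hG : Integrable G P) (hyG : ∀ s ∈ Set.Icc 0 t, ∀ ω, ‖y' s ω‖ ≤ G ω) {g : ℝ → ℝ}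
    (hg : Continuous g) (hyg : ∀ s ∈ Set.Icc 0 t, ∫ ω, ‖y' s ω‖ ∂P ≤ g s) :
    ∫ ω, ‖y t ω‖ ∂P ≤ ∫ s in (0 : ℝ)..t, g s := by
  have : IsFiniteMeasure (volume.restrict (Set.uIoc 0 t)) := ⟨by simp [Set.uIoc]⟩
  have hc : ∀ ω, Continuous fun s => y' s ω := fun ω => hy'.comp (Continuous.prodMk_left ω)
  have hint : Integrable (Function.uncurry fun s ω => ‖y' s ω‖)
      ((volume.restrict (Set.uIoc 0 t)).prod P) := by
    refine Integrable.mono' (hG.comp_snd _) hy'.norm.aestronglyMeasurable ?_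
    have : ∀ᵐ p : ℝ × Ω ∂((volume.restrict (Set.uIoc 0 t)).prod P), p.1 ∈ Set.uIoc 0 t :=
      Measure.quasiMeasurePreserving_fst.ae (ae_restrict_mem measurableSet_uIoc)
    filter_upwards [this] with p hp
    rw [Set.uIoc_of_le ht] at hp
    simpa [Function.uncurry] using hyG p.1 ⟨hp.1.le, hp.2⟩ p.2
  have hint' : IntervalIntegrable (fun s => ∫ ω, ‖y' s ω‖ ∂P) volume 0 t := by
    have := hint.integral_prod_left
    rw [Set.uIoc_of_le ht] at this
    exact (intervalIntegrable_iff_integrableOn_Ioc_of_le ht).2 this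
  refine le_trans ?_ (intervalIntegral.integral_mono_on ht hint' (hg.intervalIntegrable _ _) hyg)
  rw [intervalIntegral_integral_swap hint]
  refine integral_mono_of_nonneg (ae_of_all _ fun _ => norm_nonneg _) ?_ (ae_of_all _ fun ω => ?_)
  · have := hint.integral_prod_right
    refine this.congr (ae_of_all _ fun ω => ?_)
    simp only [Function.uncurry]
    rw [intervalIntegral.integral_of_le ht, Set.uIoc_of_le ht]
  · have h1 := intervalIntegral.integral_eq_sub_of_hasDerivAt (a := 0) (b := t)
      (f := fun s => y s ω) (fun s _ => hy ω s) ((hc ω).intervalIntegrable _ _)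
    rw [hy0, sub_zero] at h1
    beta_reduce
    rw [← h1]
    exact intervalIntegral.norm_integral_le_integral_norm ht

namespace IsMeanFieldFlow

variable {X : ℝ → E → E}

/-- With u(t) = ∫ |X_t - X'_t| dμ, the difference of velocities is at most L(|X_t - X'_t| + u(t)),
with integral 2L u(t). Since u(0) = 0, Grönwall gives u = 0. Equality almost everywhere is enough,
as only the image laws matter. -/
theorem ae_eq_of_nonneg [CompleteSpace E] {X' : ℝ → E → E} (hX : IsMeanFieldFlow K μ X)
    (hX' : IsMeanFieldFlow K μ X') (hK : IsLipschitzKernel K L)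
    (hμ : Integrable (fun x => ‖x‖) μ) {T : ℝ} (hT : 0 ≤ T) :
    X T =ᵐ[μ] X' T := by
  have hb := hX.isLipschitzField hK hμ
  have hb' := hX'.isLipschitzField hK hμ
  let y : ℝ → E → E := fun t ζ => X t ζ - X' t ζ
  let y' : ℝ → E → E := fun t ζ =>
    meanFieldVelocity K μ X t (X t ζ) - meanFieldVelocity K μ X' t (X' t ζ)
  let u : ℝ → ℝ := fun t => ∫ ζ, ‖y t ζ‖ ∂μ
  have hu : Continuous u := hX.continuous_integral_norm_sub hX' hμ
  have hy'c : Continuous fun p : ℝ × E => y' p.1 p.2 :=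
    (hb.continuous_comp continuous_fst (hX.continuous_uncurry hK hμ)).sub
      (hb'.continuous_comp continuous_fst (hX'.continuous_uncurry hK hμ))
  have hyi : ∀ t, Integrable (fun ζ => ‖y t ζ‖) μ := fun t =>
    (((integrable_norm_iff (hX.continuous t).aestronglyMeasurable).1 (hX.integrable_norm hμ t)).sub
      ((integrable_norm_iff (hX'.continuous t).aestronglyMeasurable).1
        (hX'.integrable_norm hμ t))).norm
  have hy'le : ∀ t ζ, ‖y' t ζ‖ ≤ L * (‖y t ζ‖ + u t) := fun t ζ =>
    hK.norm_integral_sub_le (hX.continuous t).aestronglyMeasurable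
      (hX'.continuous t).aestronglyMeasurable (hX.integrable_norm hμ t)
      (hX'.integrable_norm hμ t) _ _
  obtain ⟨C, _, hC⟩ := hX.growth T
  obtain ⟨C', _, hC'⟩ := hX'.growth T
  obtain ⟨M, hM⟩ := (isCompact_Icc (a := 0) (b := T)).exists_bound_of_continuousOn hu.continuousOn
  have hG : Integrable (fun ζ : E => L * (C * (1 + ‖ζ‖) + C' * (1 + ‖ζ‖) + M)) μ :=
    ((((integrable_const 1).add hμ).const_mul C).add
      (((integrable_const 1).add hμ).const_mul C') |>.add (integrable_const M)).const_mul _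
  have hgron := le_gronwallBound_of_le_integral (u := u) (k := 2 * L) (ε := 0) (T := T) hu
    (by positivity) (fun t ht => by
      have hint : ∀ s, Integrable (fun ζ => L * (‖y s ζ‖ + u s)) μ := fun s =>
        ((hyi s).add (integrable_const _)).const_mul _
      refine integral_norm_le_intervalIntegral (y' := y') (G := fun ζ : E =>
          L * (C * (1 + ‖ζ‖) + C' * (1 + ‖ζ‖) + M)) (fun ζ => ?_) (fun ζ s => ?_) hy'c ht.1 hG
          (fun s hs ζ => ?_) (by fun_prop) (fun s _ => ?_)
      · simp [y, hX.init, hX'.init]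
      · exact (hX.ode ζ s).sub (hX'.ode ζ s)
      · refine (hy'le s ζ).trans ?_
        have hsT : |s| ≤ T := by rw [abs_of_nonneg hs.1]; exact hs.2.trans ht.2
        have h1 := (norm_sub_le (X s ζ) (X' s ζ)).trans (add_le_add (hC s hsT ζ) (hC' s hsT ζ))
        have h2 := (le_abs_self _).trans (hM s ⟨hs.1, hs.2.trans ht.2⟩)
        exact mul_le_mul_of_nonneg_left (add_le_add h1 h2) L.2
      · refine (integral_mono_of_nonneg (ae_of_all _ fun _ => norm_nonneg _) (hint s)
          (ae_of_all _ (hy'le s))).trans_eq ?_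
        rw [integral_const_mul, integral_add (hyi s) (integrable_const _)]
        simp only [integral_const, probReal_univ, smul_eq_mul, one_mul]
        change L * (u s + u s) = _
        ring) T ⟨hT, le_rfl⟩
  rw [gronwallBound_ε0_δ0] at hgron
  have h0 : u T = 0 := le_antisymm hgron (integral_nonneg fun _ => norm_nonneg _)
  have h1 := (integral_eq_zero_iff_of_nonneg (fun _ => norm_nonneg _) (hyi T)).1 h0
  filter_upwards [h1] with ζ hζ
  exact sub_eq_zero.1 (norm_eq_zero.1 hζ)

theorem ae_eq [CompleteSpace E] {X' : ℝ → E → E} (hX : IsMeanFieldFlow K μ X)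
    (hX' : IsMeanFieldFlow K μ X') (hK : IsLipschitzKernel K L)
    (hμ : Integrable (fun x => ‖x‖) μ) (t : ℝ) : X t =ᵐ[μ] X' t := by
  rcases le_total 0 t with ht | ht
  · exact hX.ae_eq_of_nonneg hX' hK hμ ht
  · have := hX.neg_time.ae_eq_of_nonneg hX'.neg_time hK.neg hμ (neg_nonneg.2 ht)
    simpa only [neg_neg] using this

end IsMeanFieldFlow

end MeanFieldFlow

/-! ### The mean-field equation: existence and uniqueness -/

section MeanFieldEquation

variable {d : ℕ} {K : Phase d → Phase d → Phase d} {L : NNReal}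

theorem integral_densityMeasure {F : Type*} [NormedAddCommGroup F] [NormedSpace ℝ F]
    {g : Phase d → ℝ} (hg : IsProbDensity g) (φ : Phase d → F) :
    ∫ z, φ z ∂(densityMeasure g hg : Measure (Phase d)) = ∫ z, g z • φ z :=
  integral_withDensity_ofReal hg.integrable.1.aemeasurable hg.nonneg φ

theorem integral_mul_density {g : Phase d → ℝ} (hg : IsProbDensity g) (φ : Phase d → ℝ) :
    ∫ z, φ z * g z = ∫ z, φ z ∂(densityMeasure g hg : Measure (Phase d)) := by
  rw [integral_densityMeasure]
  simp only [smul_eq_mul, mul_comm]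

theorem meanField_eq_integral {g : Phase d → ℝ} (hg : IsProbDensity g) (z : Phase d) :
    meanField K g z = ∫ z', K z z' ∂(densityMeasure g hg : Measure (Phase d)) :=
  (integral_densityMeasure hg _).symm

theorem integrable_densityMeasure_iff {g : Phase d → ℝ} (hg : IsProbDensity g) {φ : Phase d → ℝ} :
    Integrable φ (densityMeasure g hg : Measure (Phase d)) ↔ Integrable fun z => φ z * g z := by
  change Integrable φ (volume.withDensity fun z => ENNReal.ofReal (g z)) ↔ _
  rw [integrable_withDensity_iff_integrable_smul₀' hg.integrable.1.aemeasurable.ennreal_ofReal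
    (ae_of_all _ fun _ => ENNReal.ofReal_lt_top)]
  refine integrable_congr ?_
  filter_upwards [hg.nonneg] with z hz
  rw [ENNReal.toReal_ofReal hz, smul_eq_mul, mul_comm]

theorem densityMeasure_absolutelyContinuous {g : Phase d → ℝ} (hg : IsProbDensity g) :
    (densityMeasure g hg : Measure (Phase d)) ≪ volume :=
  withDensity_absolutelyContinuous _ _

theorem densityMeasure_congr {g h : Phase d → ℝ} (hg : IsProbDensity g) (hh : IsProbDensity h)
    (hgh : g =ᵐ[volume] h) : densityMeasure g hg = densityMeasure h hh := by
  apply Subtype.ext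
  change volume.withDensity _ = volume.withDensity _
  refine withDensity_congr_ae ?_
  filter_upwards [hgh] with z hz
  rw [hz]

theorem ae_eq_of_densityMeasure_eq {g h : Phase d → ℝ} (hg : IsProbDensity g)
    (hh : IsProbDensity h)
    (hgh : (densityMeasure g hg : Measure (Phase d)) = densityMeasure h hh) : g =ᵐ[volume] h := by
  have h1 : (fun z => ENNReal.ofReal (g z)) =ᵐ[volume] fun z => ENNReal.ofReal (h z) := by
    refine (withDensity_eq_iff hg.integrable.1.aemeasurable.ennreal_ofReal
      hh.integrable.1.aemeasurable.ennreal_ofReal ?_).1 hgh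
    exact hg.integrable.lintegral_lt_top.ne
  filter_upwards [h1, hg.nonneg, hh.nonneg] with z hz h2 h3
  have := congrArg ENNReal.toReal hz
  rwa [ENNReal.toReal_ofReal h2, ENNReal.toReal_ofReal h3] at this

theorem exists_density_of_absolutelyContinuous (ν : ProbabilityMeasure (Phase d))
    (hν : (ν : Measure (Phase d)) ≪ volume) :
    ∃ (g : Phase d →₁[volume] ℝ) (hg : IsProbDensity g), densityMeasure g hg = ν := by
  have hi : Integrable (fun z => ((ν : Measure (Phase d)).rnDeriv volume z).toReal) :=
    Measure.integrable_toReal_rnDeriv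
  have hae := hi.coeFn_toL1
  have h1 : ∫ z, ((ν : Measure (Phase d)).rnDeriv volume z).toReal = 1 := by
    rw [Measure.integral_toReal_rnDeriv hν]; simp
  have hg : IsProbDensity (hi.toL1 _) := by
    refine ⟨?_, L1.integrable_coeFn _, ?_⟩
    · filter_upwards [hae] with z hz
      rw [hz]; exact ENNReal.toReal_nonneg
    · rw [integral_congr_ae hae, h1]
  refine ⟨hi.toL1 _, hg, Subtype.ext ?_⟩
  change volume.withDensity (fun z => ENNReal.ofReal ((hi.toL1 _ : Phase d →₁[volume] ℝ) z)) = _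
  refine (withDensity_congr_ae ?_).trans
    (Measure.withDensity_rnDeriv_eq (ν : Measure (Phase d)) volume hν)
  filter_upwards [hae, Measure.rnDeriv_lt_top (ν : Measure (Phase d)) volume] with z hz h2
  rw [hz, ENNReal.ofReal_toReal h2.ne]

/-- The mean-field flow provides a solution of the mean-field equation. -/
theorem IsMeanFieldFlow.exists_solution (hK : IsLipschitzKernel K L) {f₀ : Phase d → ℝ}
    (hf₀ : IsProbDensity f₀)
    (hμ : Integrable (fun z : Phase d => ‖z‖) (densityMeasure f₀ hf₀ : Measure (Phase d)))
    {X : ℝ → Phase d → Phase d}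
    (hX : IsMeanFieldFlow K (densityMeasure f₀ hf₀ : Measure (Phase d)) X) :
    ∃ f, IsMeanFieldSolution K f₀ f := by
  set μ : Measure (Phase d) := (densityMeasure f₀ hf₀ : Measure (Phase d)) with hμdef
  have hb := hX.isLipschitzField hK hμ
  obtain ⟨Φ, hΦ⟩ := IsFlow.exists_of_lipschitz hb
  have hXΦ : ∀ t, Φ 0 t = X t := hX.eq_flow hK hμ hΦ
  have hXm : ∀ t, AEMeasurable (X t) μ := fun t => (hX.continuous t).measurable.aemeasurable
  have hac : ∀ t, μ.map (X t) ≪ volume := fun t => by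
    rw [← hXΦ]
    exact hΦ.map_absolutelyContinuous hb (densityMeasure_absolutelyContinuous hf₀) 0 t
  choose f hf hfX using fun t => exists_density_of_absolutelyContinuous
    ((densityMeasure f₀ hf₀).map (hXm t)) (hac t)
  have hfX' : ∀ t, (densityMeasure (f t) (hf t) : Measure (Phase d)) = μ.map (X t) := fun t => by
    rw [hfX]; rfl
  have hmom : ∀ t, ∫ z, ‖z‖ * f t z = ∫ z, ‖X t z‖ ∂μ := fun t => by
    rw [integral_mul_density (hf t), hfX', integral_map (hXm t) (by fun_prop)]
  refine ⟨f, ⟨?_, hf, fun t => ?_, ?_, ?_, fun φ hφ t => ?_⟩⟩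
  · refine continuous_iff_continuousAt.2 fun s => ?_
    rw [ContinuousAt, tendsto_iff_norm_sub_tendsto_zero]
    have h1 := hΦ.tendsto_integral_abs_density_sub hb volume (ν := μ) (f := fun t => f t)
      (fun t => (Lp.stronglyMeasurable (f t)).measurable) (fun t => L1.integrable_coeFn _)
      (fun t => (hf t).nonneg) (fun t => by rw [hXΦ]; exact hfX' t) s
    refine h1.congr fun t => ?_
    rw [L1.norm_eq_integral_norm]
    refine integral_congr_ae ?_
    filter_upwards [Lp.coeFn_sub (f t) (f s)] with z hz
    rw [hz]; rfl
  · rw [← integrable_densityMeasure_iff (hf t), hfX']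
    exact (integrable_map_measure (by fun_prop) (hXm t)).2 (hX.integrable_norm hμ t)
  · simp only [hmom, ← hXΦ]
    exact (hΦ.continuous_integral_norm hb hμ 0).locallyIntegrable
  · refine ae_eq_of_densityMeasure_eq (hf 0) hf₀ ?_
    rw [hfX', show X 0 = id from funext hX.init, Measure.map_id]
  · have h := hΦ.solvesContinuityEquation hb hμ φ hφ t
    -- The equation closes here: f s is the density of the law of X_s, so the frozen velocity field
    -- is the mean field of f itself.
    have hvel : ∀ s z, meanField K (f s) z = meanFieldVelocity K μ X s z := fun s z => by
      have hKz : Continuous (K z) := hK.continuous_comp continuous_const continuous_id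
      rw [meanField_eq_integral (hf s), hfX', integral_map (hXm s) hKz.aestronglyMeasurable]
      rfl
    simp only [hXΦ] at h
    rw [show X 0 = id from funext hX.init, Measure.map_id] at h
    rw [integral_mul_density (hf t), hfX', h, integral_mul_density hf₀]
    congr 1
    refine intervalIntegral.integral_congr fun s _ => ?_
    beta_reduce
    rw [integral_mul_density (hf s) fun z => fderiv ℝ φ z (meanField K (f s) z), hfX']
    simp only [hvel]

/-- The curve of probability measures attached to a solution of the mean-field equation. -/
noncomputable def IsMeanFieldSolution.measure {f₀ : Phase d → ℝ} {f : ℝ → (Phase d →₁[volume] ℝ)}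
    (hf : IsMeanFieldSolution K f₀ f) (t : ℝ) : ProbabilityMeasure (Phase d) :=
  densityMeasure (f t) (hf.density t)

namespace IsMeanFieldSolution

variable {f₀ : Phase d → ℝ} {f : ℝ → (Phase d →₁[volume] ℝ)}

theorem integral_measure (hf : IsMeanFieldSolution K f₀ f) (φ : Phase d → ℝ) (t : ℝ) :
    ∫ z, φ z ∂(hf.measure t : Measure (Phase d)) = ∫ z, φ z * f t z :=
  (integral_mul_density (hf.density t) φ).symm

theorem continuous_measure (hf : IsMeanFieldSolution K f₀ f) : Continuous hf.measure := by
  refine continuous_iff_continuousAt.2 fun s => ?_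
  refine ProbabilityMeasure.tendsto_iff_forall_integral_tendsto.2 fun g => ?_
  simp only [hf.integral_measure]
  rw [tendsto_iff_norm_sub_tendsto_zero]
  have h1 := (tendsto_iff_norm_sub_tendsto_zero.1 (hf.continuous.tendsto s)).const_mul ‖g‖
  rw [mul_zero] at h1
  refine squeeze_zero (fun _ => norm_nonneg _) (fun t => ?_) h1
  have hi : ∀ t, Integrable fun z => g z * f t z := fun t =>
    (L1.integrable_coeFn (f t)).bdd_mul g.continuous.aestronglyMeasurable (c := ‖g‖)
      (ae_of_all _ g.norm_coe_le_norm)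
  rw [← integral_sub (hi t) (hi s), L1.norm_eq_integral_norm, ← integral_const_mul]
  refine norm_integral_le_of_norm_le ((L1.integrable_coeFn (f t - f s)).norm.const_mul _) ?_
  filter_upwards [Lp.coeFn_sub (f t) (f s)] with z hz
  rw [hz, ← mul_sub, norm_mul]
  exact mul_le_mul_of_nonneg_right (g.norm_coe_le_norm z) (norm_nonneg _)

/-- It makes the solution a Markov kernel in time, so that measurability in t passes through the
nested integrals of the weak formulation. -/
theorem measurable_measure (hf : IsMeanFieldSolution K f₀ f) :
    Measurable fun t => (hf.measure t : Measure (Phase d)) := by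
  refine Measure.measurable_of_measurable_coe _ fun A hA => ?_
  have h1 : ∀ t, (hf.measure t : Measure (Phase d)) A = ENNReal.ofReal (∫ z in A, f t z) := by
    intro t
    rw [ofReal_integral_eq_lintegral_ofReal (L1.integrable_coeFn (f t)).integrableOn
      (ae_restrict_of_ae (hf.density t).nonneg)]
    exact withDensity_apply _ hA
  simp only [h1]
  exact ENNReal.measurable_ofReal.comp
    ((continuous_setIntegral A).comp hf.continuous).measurable

theorem integrable_norm_measure (hf : IsMeanFieldSolution K f₀ f) (t : ℝ) :
    Integrable (fun z => ‖z‖) (hf.measure t : Measure (Phase d)) :=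
  (integrable_densityMeasure_iff (hf.density t)).2 (hf.moment t)

theorem meanField_eq (hf : IsMeanFieldSolution K f₀ f) (t : ℝ) (z : Phase d) :
    meanField K (f t) z = ∫ z', K z z' ∂(hf.measure t : Measure (Phase d)) :=
  meanField_eq_integral (hf.density t) z

theorem measure_zero (hf : IsMeanFieldSolution K f₀ f) (hf₀ : IsProbDensity f₀) :
    hf.measure 0 = densityMeasure f₀ hf₀ :=
  densityMeasure_congr _ _ hf.init

theorem solvesContinuityEquation (hf : IsMeanFieldSolution K f₀ f) :
    SolvesContinuityEquation (fun t z => meanField K (f t) z)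
      fun t => (hf.measure t : Measure (Phase d)) := by
  intro φ hφ t
  have h := hf.weak φ hφ t
  have h0 : ∫ z, φ z * f₀ z = ∫ z, φ z * f 0 z := by
    refine integral_congr_ae ?_
    filter_upwards [hf.init] with z hz
    rw [hz]
  rw [hf.integral_measure, hf.integral_measure, h, h0]
  congr 1
  refine intervalIntegral.integral_congr fun s _ => ?_
  exact (hf.integral_measure (fun z => fderiv ℝ φ z (meanField K (f s) z)) s).symm

/-- Continuity in time of the mean field is proved only later, and that proof needs this integrand
to be interval integrable; measurability together with the moment bound suffices. -/
theorem stronglyMeasurable_integral_fderiv (hf : IsMeanFieldSolution K f₀ f)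
    (hK : IsLipschitzKernel K L) {φ : Phase d → ℝ} (hφ : IsC1b φ) :
    StronglyMeasurable fun t =>
      ∫ z, fderiv ℝ φ z (meanField K (f t) z) ∂(hf.measure t : Measure (Phase d)) := by
  let κ : ProbabilityTheory.Kernel ℝ (Phase d) := ⟨_, hf.measurable_measure⟩
  have hκ : ProbabilityTheory.IsMarkovKernel κ :=
    ⟨fun t => inferInstanceAs (IsProbabilityMeasure (hf.measure t : Measure (Phase d)))⟩
  let κ' : ProbabilityTheory.Kernel (ℝ × Phase d) (Phase d) := κ.comap Prod.fst measurable_fst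
  have h1 : StronglyMeasurable fun p : ℝ × Phase d => ∫ z', K p.2 z' ∂(κ' p) :=
    StronglyMeasurable.integral_kernel_prod_right (κ := κ') (f := fun p z' => K p.2 z')
      (hK.continuous_comp (by fun_prop) (by fun_prop)).stronglyMeasurable
  have h2 : StronglyMeasurable fun p : ℝ × Phase d => fderiv ℝ φ p.2 (∫ z', K p.2 z' ∂(κ' p)) :=
    (isBoundedBilinearMap_apply (𝕜 := ℝ) (E := Phase d) (F := ℝ)).continuous.comp_stronglyMeasurable
      ((hφ.continuous_fderiv.comp continuous_snd).stronglyMeasurable.prodMk h1)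
  have h3 := StronglyMeasurable.integral_kernel_prod_right (κ := κ)
    (f := fun t z => fderiv ℝ φ z (∫ z', K z z' ∂(κ' (t, z)))) h2
  simp only [hf.meanField_eq]
  exact h3

theorem norm_meanField_sub_le (hf : IsMeanFieldSolution K f₀ f) (hK : IsLipschitzKernel K L)
    (t : ℝ) (z w : Phase d) : ‖meanField K (f t) z - meanField K (f t) w‖ ≤ L * ‖z - w‖ := by
  have := hK.norm_integral_sub_le (μ := (hf.measure t : Measure (Phase d))) (g := id) (h := id)
    aestronglyMeasurable_id aestronglyMeasurable_id (hf.integrable_norm_measure t)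
    (hf.integrable_norm_measure t) z w
  simpa [hf.meanField_eq] using this

theorem norm_meanField_le (hf : IsMeanFieldSolution K f₀ f) (hK : IsLipschitzKernel K L)
    (t : ℝ) (z : Phase d) :
    ‖meanField K (f t) z‖ ≤ L * (‖z‖ + ∫ z, ‖z‖ * f t z) := by
  have := hK.norm_integral_le (μ := (hf.measure t : Measure (Phase d))) (g := id)
    (hf.integrable_norm_measure t) z
  rw [hf.meanField_eq, ← hf.integral_measure (fun z => ‖z‖)]
  exact this

theorem norm_integral_fderiv_le (hf : IsMeanFieldSolution K f₀ f) (hK : IsLipschitzKernel K L)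
    {φ : Phase d → ℝ} {C : ℝ} (hφ : ∀ z, ‖fderiv ℝ φ z‖ ≤ C) (t : ℝ) :
    ‖∫ z, fderiv ℝ φ z (meanField K (f t) z) ∂(hf.measure t : Measure (Phase d))‖ ≤
      2 * C * L * ∫ z, ‖z‖ * f t z := by
  have hC : 0 ≤ C := (norm_nonneg _).trans (hφ 0)
  have hi := hf.integrable_norm_measure t
  refine (norm_integral_le_of_norm_le
    (((hi.add (integrable_const (∫ z, ‖z‖ * f t z))).const_mul (L : ℝ)).const_mul C)
    (ae_of_all _ fun z => ?_)).trans_eq ?_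
  · refine (ContinuousLinearMap.le_opNorm _ _).trans ?_
    exact mul_le_mul (hφ z) (hf.norm_meanField_le hK t z) (norm_nonneg _) hC
  · simp only [Pi.add_apply]
    rw [integral_const_mul, integral_const_mul, integral_add hi (integrable_const _),
      hf.integral_measure (fun z => ‖z‖)]
    simp only [integral_const, probReal_univ, smul_eq_mul, one_mul]
    ring

theorem intervalIntegrable_moment (hf : IsMeanFieldSolution K f₀ f) (s t : ℝ) :
    IntervalIntegrable (fun t => ∫ z, ‖z‖ * f t z) volume s t :=
  (hf.moment_locallyIntegrable.integrableOn_isCompact isCompact_uIcc).intervalIntegrable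

/-- The bound sees φ only through its gradient, not its supremum, and therefore survives a limit
towards unbounded functions. -/
theorem norm_integral_sub_le_of_isC1b (hf : IsMeanFieldSolution K f₀ f)
    (hK : IsLipschitzKernel K L) {φ : Phase d → ℝ} (hφ : IsC1b φ) {C : ℝ}
    (hC : ∀ z, ‖fderiv ℝ φ z‖ ≤ C) (s t : ℝ) :
    ‖∫ z, φ z ∂(hf.measure t : Measure (Phase d)) - ∫ z, φ z ∂(hf.measure s : Measure (Phase d))‖ ≤
      |∫ r in s..t, 2 * C * L * ∫ z, ‖z‖ * f r z| := by
  have hint : ∀ a b, IntervalIntegrable (fun r =>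
      ∫ z, fderiv ℝ φ z (meanField K (f r) z) ∂(hf.measure r : Measure (Phase d))) volume a b :=
    fun a b => ((hf.intervalIntegrable_moment a b).const_mul (2 * C * L)).mono_fun'
      (hf.stronglyMeasurable_integral_fderiv hK hφ).aestronglyMeasurable
      (ae_of_all _ fun r => hf.norm_integral_fderiv_le hK hC r)
  rw [hf.solvesContinuityEquation φ hφ t, hf.solvesContinuityEquation φ hφ s,
    add_sub_add_left_eq_sub, intervalIntegral.integral_interval_sub_left (hint _ _) (hint _ _)]
  exact intervalIntegral.norm_integral_le_abs_of_norm_le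
    (ae_of_all _ fun r => hf.norm_integral_fderiv_le hK hC r)
    ((hf.intervalIntegrable_moment s t).const_mul _)

end IsMeanFieldSolution

/-- The truncation a sin(g/a) is bounded, keeps the gradient bound of g, is dominated by |g| and
tends to g as a grows. It carries the weak formulation over to unbounded g of bounded gradient. -/
theorem isC1b_mul_sin_div {g : Phase d → ℝ} (hg : ContDiff ℝ 1 g) {C : ℝ}
    (hC : ∀ z, ‖fderiv ℝ g z‖ ≤ C) {a : ℝ} (ha : 0 < a) :
    IsC1b (fun z => a * Real.sin (g z / a)) ∧
      ∀ z, ‖fderiv ℝ (fun z => a * Real.sin (g z / a)) z‖ ≤ C := by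
  have hd : ∀ z, ‖fderiv ℝ (fun z => a * Real.sin (g z / a)) z‖ ≤ C := by
    intro z
    have h1 := ((((hg.differentiable one_ne_zero z).hasFDerivAt).mul_const a⁻¹).sin.const_mul a).fderiv
    simp only [div_eq_mul_inv]
    rw [h1, smul_smul, smul_smul, norm_smul]
    refine (mul_le_of_le_one_left (norm_nonneg _) ?_).trans (hC z)
    have h2 : a * Real.cos (g z * a⁻¹) * a⁻¹ = Real.cos (g z * a⁻¹) := by field_simp
    rw [h2]
    exact Real.abs_cos_le_one _
  refine ⟨⟨by fun_prop, ⟨a, fun z => ?_⟩, C, hd⟩, hd⟩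
  rw [abs_mul, abs_of_pos ha]
  exact mul_le_of_le_one_right ha.le (Real.abs_sin_le_one _)

theorem abs_mul_sin_div_le {a : ℝ} (ha : 0 < a) (y : ℝ) : |a * Real.sin (y / a)| ≤ |y| := by
  rw [abs_mul, abs_of_pos ha]
  have h := Real.abs_sin_le_abs (x := y / a)
  rw [abs_div, abs_of_pos ha, le_div_iff₀ ha] at h
  linarith

theorem tendsto_mul_sin_div (y : ℝ) :
    Tendsto (fun n : ℕ => ((n : ℝ) + 1) * Real.sin (y / (n + 1))) atTop (𝓝 y) := by
  -- With a = n + 1, a sin(y/a) = y sinc(y/a), and sinc is continuous with value 1 at 0.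
  have h1 : Tendsto (fun n : ℕ => y * Real.sinc (y * (1 / ((n : ℝ) + 1)))) atTop
      (𝓝 (y * Real.sinc (y * 0))) :=
    ((by fun_prop : Continuous fun ε : ℝ => y * Real.sinc (y * ε)).tendsto 0).comp
      tendsto_one_div_add_atTop_nhds_zero_nat
  simp only [mul_zero, Real.sinc_zero, mul_one] at h1
  refine h1.congr fun n => ?_
  have hn : (n : ℝ) + 1 ≠ 0 := by positivity
  rcases eq_or_ne y 0 with rfl | hy
  · simp
  · rw [Real.sinc_of_ne_zero (by positivity)]
    field_simp

namespace IsMeanFieldSolution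

variable {f₀ : Phase d → ℝ} {f : ℝ → (Phase d →₁[volume] ℝ)}

/-- Integrals of `C¹` functions with bounded gradient against a solution are continuous in time. -/
theorem continuous_integral_measure (hf : IsMeanFieldSolution K f₀ f) (hK : IsLipschitzKernel K L)
    {g : Phase d → ℝ} (hg : ContDiff ℝ 1 g) {C : ℝ} (hC : ∀ z, ‖fderiv ℝ g z‖ ≤ C) :
    Continuous fun t => ∫ z, g z ∂(hf.measure t : Measure (Phase d)) := by
  have hgi : ∀ t, Integrable g (hf.measure t : Measure (Phase d)) := by
    intro t
    refine Integrable.mono' ((integrable_const |g 0|).add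
      ((hf.integrable_norm_measure t).const_mul C)) hg.continuous.aestronglyMeasurable
      (ae_of_all _ fun z => ?_)
    have h1 := convex_univ.norm_image_sub_le_of_norm_fderiv_le (𝕜 := ℝ)
      (fun x _ => hg.differentiable one_ne_zero x) (fun x _ => hC x) (Set.mem_univ 0)
      (Set.mem_univ z)
    have h2 := norm_le_norm_add_norm_sub' (g z) (g 0)
    rw [sub_zero] at h1
    simp only [Pi.add_apply, ← Real.norm_eq_abs]
    linarith
  have hle : ∀ s t, ‖∫ z, g z ∂(hf.measure t : Measure (Phase d)) -
      ∫ z, g z ∂(hf.measure s : Measure (Phase d))‖ ≤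
      |∫ r in s..t, 2 * C * L * ∫ z, ‖z‖ * f r z| := by
    intro s t
    have hlim : ∀ t, Tendsto (fun n : ℕ => ∫ z, ((n : ℝ) + 1) * Real.sin (g z / (n + 1))
        ∂(hf.measure t : Measure (Phase d))) atTop
        (𝓝 (∫ z, g z ∂(hf.measure t : Measure (Phase d)))) := fun t =>
      tendsto_integral_of_dominated_convergence (fun z => |g z|)
        (fun n => (by have := hg.continuous; fun_prop :
          Continuous fun z => ((n : ℝ) + 1) * Real.sin (g z / (n + 1))).aestronglyMeasurable)
        (hgi t).abs (fun n => ae_of_all _ fun z => abs_mul_sin_div_le (by positivity) _)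
        (ae_of_all _ fun z => tendsto_mul_sin_div _)
    refine le_of_tendsto ((hlim t).sub (hlim s)).norm (Eventually.of_forall fun n => ?_)
    obtain ⟨h1, h2⟩ := isC1b_mul_sin_div hg hC (a := (n : ℝ) + 1) (by positivity)
    exact hf.norm_integral_sub_le_of_isC1b hK h1 h2 s t
  refine continuous_iff_continuousAt.2 fun s => ?_
  rw [ContinuousAt, tendsto_iff_norm_sub_tendsto_zero]
  have h1 : Continuous fun t => |∫ r in s..t, 2 * C * L * ∫ z, ‖z‖ * f r z| :=
    (intervalIntegral.continuous_primitive
      (fun a b => (hf.intervalIntegrable_moment a b).const_mul (2 * C * L)) s).abs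
  have h2 := h1.tendsto s
  rw [intervalIntegral.integral_same, abs_zero] at h2
  exact squeeze_zero (fun _ => norm_nonneg _) (hle s) h2

/-- Lipschitz continuity in z is inherited from K. Continuity in t does not follow from L¹
continuity, as K(z, ·) is unbounded; its coordinates are C¹ with bounded gradient, so the weak
equation and the locally integrable first moment give it. -/
theorem isLipschitzField (hf : IsMeanFieldSolution K f₀ f) (hK : IsLipschitzKernel K L)
    (hKc : ContDiff ℝ 1 fun p : Phase d × Phase d => K p.1 p.2) :
    IsLipschitzField (fun t z => meanField K (f t) z) L := by
  refine ⟨fun t => LipschitzWith.of_dist_le_mul fun z w => ?_, fun z => ?_⟩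
  · rw [dist_eq_norm, dist_eq_norm]
    exact hf.norm_meanField_sub_le hK t z w
  · have hKz : ContDiff ℝ 1 (K z) := hKc.comp (contDiff_const.prodMk contDiff_id)
    have hcoord : ∀ t i, (meanField K (f t) z) i =
        ∫ z', K z z' i ∂(hf.measure t : Measure (Phase d)) := by
      intro t i
      rw [hf.meanField_eq]
      exact ((EuclideanSpace.proj i : Phase d →L[ℝ] ℝ).integral_comp_comm
        (hK.integrable aestronglyMeasurable_id (hf.integrable_norm_measure t) z)).symm
    have hi : ∀ i, Continuous fun t => (meanField K (f t) z) i := by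
      intro i
      simp only [hcoord]
      have hg : ContDiff ℝ 1 fun z' => K z z' i :=
        (EuclideanSpace.proj i : Phase d →L[ℝ] ℝ).contDiff.comp hKz
      have hl : LipschitzWith L fun z' => K z z' i := LipschitzWith.of_dist_le_mul fun x y => by
        rw [Real.dist_eq, dist_eq_norm]
        have h1 := PiLp.norm_apply_le (K z x - K z y) i
        have h2 := hK.norm_sub_le z x z y
        rw [sub_self, norm_zero, zero_add] at h2
        exact h1.trans h2
      exact hf.continuous_integral_measure hK hg fun z' => norm_fderiv_le_of_lipschitz ℝ hl
    exact (PiLp.continuous_toLp 2 (fun _ : Fin d => ℝ)).comp (continuous_pi hi)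

/-- Every solution of the mean-field equation is transported by a mean-field flow. -/
theorem exists_isMeanFieldFlow (hf : IsMeanFieldSolution K f₀ f) (hK : IsLipschitzKernel K L)
    (hKc : ContDiff ℝ 1 fun p : Phase d × Phase d => K p.1 p.2) (hf₀ : IsProbDensity f₀) :
    ∃ X, IsMeanFieldFlow K (densityMeasure f₀ hf₀ : Measure (Phase d)) X ∧ ∀ t,
      (densityMeasure (f t) (hf.density t) : Measure (Phase d)) =
        (densityMeasure f₀ hf₀ : Measure (Phase d)).map (X t) := by
  have hb := hf.isLipschitzField hK hKc
  obtain ⟨Φ, hΦ⟩ := IsFlow.exists_of_lipschitz hb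
  -- Linear uniqueness for the field frozen along f: the solution is the push-forward by the flow of
  -- its own field, which is therefore a mean-field flow.
  have hmap : ∀ t, (hf.measure t : Measure (Phase d)) =
      (densityMeasure f₀ hf₀ : Measure (Phase d)).map (Φ 0 t) := fun t => by
    rw [hΦ.eq_map_of_solves hb hf.continuous_measure hf.integrable_norm_measure
      hf.solvesContinuityEquation t, hf.measure_zero hf₀]
  refine ⟨Φ 0, IsMeanFieldFlow.of_isFlow hΦ hb fun t z => ?_, hmap⟩
  have hKz : Continuous (K z) := hK.continuous_comp continuous_const continuous_id
  rw [hf.meanField_eq, hmap, integral_map (hΦ.measurable_map hb 0 t).aemeasurable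
    hKz.aestronglyMeasurable]

theorem unique (hf : IsMeanFieldSolution K f₀ f) {g : ℝ → (Phase d →₁[volume] ℝ)}
    (hg : IsMeanFieldSolution K f₀ g) (hK : IsLipschitzKernel K L)
    (hKc : ContDiff ℝ 1 fun p : Phase d × Phase d => K p.1 p.2) (hf₀ : IsProbDensity f₀)
    (hμ : Integrable (fun z : Phase d => ‖z‖) (densityMeasure f₀ hf₀ : Measure (Phase d))) :
    f = g := by
  obtain ⟨X, hX, hXf⟩ := hf.exists_isMeanFieldFlow hK hKc hf₀
  obtain ⟨Y, hY, hYg⟩ := hg.exists_isMeanFieldFlow hK hKc hf₀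
  funext t
  refine Lp.ext (ae_eq_of_densityMeasure_eq (hf.density t) (hg.density t) ?_)
  rw [hXf, hYg]
  exact Measure.map_congr (hX.ae_eq hY hK hμ t)

end IsMeanFieldSolution

end MeanFieldEquation

/-! ### A law of large numbers for pair interactions -/

section Variance

variable {E F : Type*} [MeasurableSpace E] [NormedAddCommGroup F] [InnerProductSpace ℝ F]
  [MeasurableSpace F] [BorelSpace F] [SecondCountableTopology F] [CompleteSpace F]
  {μ : Measure E} [IsProbabilityMeasure μ] {N : ℕ}

theorem integral_comp_eval (μ : Measure E) [IsProbabilityMeasure μ] {G : Type*}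
    [NormedAddCommGroup G] [NormedSpace ℝ G] {f : E → G} (hf : AEStronglyMeasurable f μ)
    (i : Fin N) : ∫ ζ, f (ζ i) ∂(Measure.pi fun _ : Fin N => μ) = ∫ x, f x ∂μ := by
  have h := measurePreserving_eval (fun _ : Fin N => μ) i
  have h2 := integral_map (μ := Measure.pi fun _ : Fin N => μ) h.measurable.aemeasurable
    (f := f) (by rw [h.map_eq]; exact hf)
  rw [h.map_eq] at h2
  exact h2.symm

theorem MeasureTheory.Integrable.comp_eval' {G : Type*} [NormedAddCommGroup G] {f : E → G}
    (hf : Integrable f μ) (i : Fin N) :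
    Integrable (fun ζ : Fin N → E => f (ζ i)) (Measure.pi fun _ : Fin N => μ) :=
  (measurePreserving_eval (fun _ : Fin N => μ) i).integrable_comp_of_integrable hf

/-- Distinct centred pair interactions are uncorrelated. -/
theorem integral_inner_eq_zero {f : E → E → F} (hf0 : ∀ x, ∫ y, f x y ∂μ = 0)
    (hfi : ∀ x, Integrable (f x) μ) {i j k : Fin N} (hjk : j ≠ k) (hik : i ≠ k)
    (hi : Integrable (fun ζ : Fin N → E => inner ℝ (f (ζ i) (ζ j)) (f (ζ i) (ζ k)))
      (Measure.pi fun _ => μ)) :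
    ∫ ζ : Fin N → E, inner ℝ (f (ζ i) (ζ j)) (f (ζ i) (ζ k)) ∂(Measure.pi fun _ => μ) = 0 := by
  obtain _ | n := N
  · exact k.elim0
  obtain ⟨i', rfl⟩ := Fin.exists_succAbove_eq hik
  obtain ⟨j', rfl⟩ := Fin.exists_succAbove_eq hjk
  -- Coordinate k is split off and integrated first; the other factor does not depend on it. The
  -- case i = j is allowed.
  have he := measurePreserving_piFinSuccAbove (fun _ : Fin (n + 1) => μ) k
  let G : E × (Fin n → E) → ℝ := fun p => inner ℝ (f (p.2 i') (p.2 j')) (f (p.2 i') p.1)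
  have hG : (fun ζ : Fin (n + 1) → E => inner ℝ (f (ζ (k.succAbove i')) (ζ (k.succAbove j')))
      (f (ζ (k.succAbove i')) (ζ k))) =
      G ∘ MeasurableEquiv.piFinSuccAbove (fun _ : Fin (n + 1) => E) k := rfl
  rw [hG] at hi ⊢
  have hGi := (he.integrable_comp_emb (MeasurableEquiv.measurableEmbedding _)).1 hi
  have h1 := he.integral_comp (MeasurableEquiv.measurableEmbedding _) G
  refine h1.trans ?_
  rw [integral_prod_symm _ hGi]
  refine integral_eq_zero_of_ae (ae_of_all _ fun r => ?_)
  simp only [G]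
  rw [integral_inner (hfi _), hf0, inner_zero_right]
  rfl

/-- The law of large numbers in mean for centred pair interactions. -/
theorem integral_norm_average_le {f : E → E → F} (hfm : Measurable (Function.uncurry f))
    (hf0 : ∀ x, ∫ y, f x y ∂μ = 0) (hfi : ∀ x, Integrable (f x) μ) {q : E → ℝ}
    (hq : Integrable (fun x => q x ^ 2) μ) {A : ℝ} (hA : ∀ x y, ‖f x y‖ ≤ A * (q x + q y))
    (hN : 1 ≤ N) (i : Fin N) :
    ∫ ζ : Fin N → E, ‖(N : ℝ)⁻¹ • ∑ j, f (ζ i) (ζ j)‖ ∂(Measure.pi fun _ => μ) ≤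
      (1 + 4 * A ^ 2 * ∫ x, q x ^ 2 ∂μ) / Real.sqrt N := by
  set P : Measure (Fin N → E) := Measure.pi fun _ => μ with hP
  set Q : ℝ := ∫ x, q x ^ 2 ∂μ with hQ
  have hN0 : (0 : ℝ) < N := by exact_mod_cast hN
  have hfm' : ∀ j, Measurable fun ζ : Fin N → E => f (ζ i) (ζ j) := fun j => by
    have h : Measurable fun ζ : Fin N → E => (ζ i, ζ j) :=
      (measurable_pi_apply i).prodMk (measurable_pi_apply j)
    exact hfm.comp h
  have hsq : ∀ x y, ‖f x y‖ ^ 2 ≤ 2 * A ^ 2 * (q x ^ 2 + q y ^ 2) := fun x y => by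
    have h1 := pow_le_pow_left₀ (norm_nonneg _) (hA x y) 2
    nlinarith [sq_nonneg (A * (q x - q y))]
  have hbi : ∀ j, Integrable (fun ζ : Fin N → E => 2 * A ^ 2 * (q (ζ i) ^ 2 + q (ζ j) ^ 2)) P :=
    fun j => ((hq.comp_eval' i).add (hq.comp_eval' j)).const_mul _
  have hsqi : ∀ j, Integrable (fun ζ : Fin N → E => ‖f (ζ i) (ζ j)‖ ^ 2) P := fun j =>
    (hbi j).mono' ((hfm' j).norm.pow_const 2).aestronglyMeasurable
      (ae_of_all _ fun ζ => by rw [Real.norm_of_nonneg (by positivity)]; exact hsq _ _)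
  have hsqle : ∀ j, ∫ ζ : Fin N → E, ‖f (ζ i) (ζ j)‖ ^ 2 ∂P ≤ 4 * A ^ 2 * Q := fun j => by
    refine (integral_mono (hsqi j) (hbi j) fun ζ => hsq _ _).trans_eq ?_
    rw [integral_const_mul, integral_add (hq.comp_eval' i) (hq.comp_eval' j),
      integral_comp_eval μ hq.1 i, integral_comp_eval μ hq.1 j]
    ring
  have hinn : ∀ j k, Integrable (fun ζ : Fin N → E => inner ℝ (f (ζ i) (ζ j)) (f (ζ i) (ζ k))) P :=
    fun j k => ((hsqi j).add (hsqi k)).mono' ((hfm' j).inner (hfm' k)).aestronglyMeasurable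
      (ae_of_all _ fun ζ => by
        refine (norm_inner_le_norm _ _).trans ?_
        simp only [Pi.add_apply]
        nlinarith [sq_nonneg (‖f (ζ i) (ζ j)‖ - ‖f (ζ i) (ζ k)‖), sq_nonneg (‖f (ζ i) (ζ j)‖),
          sq_nonneg (‖f (ζ i) (ζ k)‖)])
  have hexp : ∀ ζ : Fin N → E, ‖(N : ℝ)⁻¹ • ∑ j, f (ζ i) (ζ j)‖ ^ 2 =
      ((N : ℝ)⁻¹) ^ 2 * ∑ j, ∑ k, inner ℝ (f (ζ i) (ζ j)) (f (ζ i) (ζ k)) := fun ζ => by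
    rw [norm_smul, mul_pow, Real.norm_of_nonneg (by positivity), ← real_inner_self_eq_norm_sq,
      sum_inner]
    simp only [inner_sum]
  have hRi : Integrable (fun ζ : Fin N → E => ‖(N : ℝ)⁻¹ • ∑ j, f (ζ i) (ζ j)‖ ^ 2) P := by
    simp only [hexp]
    exact (integrable_finsetSum _ fun j _ => integrable_finsetSum _ fun k _ => hinn j k).const_mul _
  have hR : ∫ ζ : Fin N → E, ‖(N : ℝ)⁻¹ • ∑ j, f (ζ i) (ζ j)‖ ^ 2 ∂P ≤ 4 * A ^ 2 * Q / N := by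
    simp only [hexp]
    rw [integral_const_mul, integral_finsetSum _ fun j _ => integrable_finsetSum _ fun k _ => hinn j k]
    have h1 : ∀ j, ∫ ζ : Fin N → E, ∑ k, inner ℝ (f (ζ i) (ζ j)) (f (ζ i) (ζ k)) ∂P ≤
        4 * A ^ 2 * Q := by
      intro j
      rw [integral_finsetSum _ fun k _ => hinn j k, Finset.sum_eq_single j]
      · simp only [real_inner_self_eq_norm_sq]
        exact hsqle j
      · intro k _ hkj
        -- If k = i, the free variable is ζ_j, as j then differs from i and from k; otherwise it is
        -- ζ_k. Only the diagonal terms survive, N of them against the factor 1/N².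
        by_cases hik : i = k
        · have := integral_inner_eq_zero hf0 hfi (i := i) hkj (fun h => hkj (hik ▸ h)) (hinn k j)
          simpa only [real_inner_comm] using this
        · exact integral_inner_eq_zero hf0 hfi hkj.symm hik (hinn j k)
      · simp
    refine (mul_le_mul_of_nonneg_left (Finset.sum_le_sum fun j _ => h1 j) (by positivity)).trans_eq ?_
    simp only [Finset.sum_const, Finset.card_univ, Fintype.card_fin, nsmul_eq_mul]
    field_simp
  have hs : 0 < Real.sqrt N := Real.sqrt_pos.2 hN0
  have hs2 : Real.sqrt N ^ 2 = N := Real.sq_sqrt hN0.le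
  -- The inequality r ≤ 1/√N + √N r² passes from second to first moments without Cauchy–Schwarz; its
  -- first term is the 1 in the numerator of the final bound.
  have hle : ∀ ζ : Fin N → E, ‖(N : ℝ)⁻¹ • ∑ j, f (ζ i) (ζ j)‖ ≤
      (Real.sqrt N)⁻¹ + Real.sqrt N * ‖(N : ℝ)⁻¹ • ∑ j, f (ζ i) (ζ j)‖ ^ 2 := fun ζ => by
    set r := ‖(N : ℝ)⁻¹ • ∑ j, f (ζ i) (ζ j)‖
    have h1 : (Real.sqrt N)⁻¹ + Real.sqrt N * r ^ 2 - r =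
        (Real.sqrt N)⁻¹ * ((Real.sqrt N * r - 1 / 2) ^ 2 + 3 / 4) := by
      field_simp; ring
    have h2 : 0 ≤ (Real.sqrt N)⁻¹ * ((Real.sqrt N * r - 1 / 2) ^ 2 + 3 / 4) := by positivity
    linarith
  refine (integral_mono_of_nonneg (ae_of_all _ fun _ => norm_nonneg _)
    ((integrable_const _).add (hRi.const_mul _)) (ae_of_all _ hle)).trans ?_
  simp only [Pi.add_apply]
  rw [integral_add (integrable_const _) (hRi.const_mul _), integral_const_mul]
  simp only [integral_const, probReal_univ, smul_eq_mul, one_mul]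
  refine (add_le_add_right (mul_le_mul_of_nonneg_left hR hs.le) _).trans_eq ?_
  rw [show 4 * A ^ 2 * Q / (N : ℝ) = 4 * A ^ 2 * Q / Real.sqrt N ^ 2 by rw [hs2]]
  field_simp

/-- The law of the images of finitely many distinct independent particles. -/
theorem map_pi_comp_injective {G : Type*} [MeasurableSpace G] {a : E → G} (ha : Measurable a)
    {j : ℕ} {σ : Fin j → Fin N} (hσ : Function.Injective σ) :
    (Measure.pi fun _ : Fin N => μ).map (fun ζ i => a (ζ (σ i))) =
      Measure.pi fun _ : Fin j => μ.map a := by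
  have h1 := ProbabilityTheory.iIndepFun_pi (μ := fun _ : Fin N => μ) (X := fun _ => a)
    fun _ => ha.aemeasurable
  rw [(ProbabilityTheory.iIndepFun_iff_map_fun_eq_pi_map
    (f := fun i (ω : Fin N → E) => a (ω (σ i)))
    fun i => (ha.comp (measurable_pi_apply (σ i))).aemeasurable).1 (h1.precomp hσ)]
  congr 1
  funext i
  have h3 := measurePreserving_eval (fun _ : Fin N => μ) (σ i)
  have h4 := Measure.map_map (μ := Measure.pi fun _ : Fin N => μ) ha h3.measurable
  rw [h3.map_eq] at h4
  exact h4.symm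

end Variance

/-! ### The particle system and its coupling with the mean-field flow -/

section NBody

variable {d N : ℕ} {K : Phase d → Phase d → Phase d} {L : NNReal}

theorem norm_average_le {E : Type*} [NormedAddCommGroup E] [NormedSpace ℝ E] {v : Fin N → E}
    {a : Fin N → ℝ} (h : ∀ j, ‖v j‖ ≤ a j) :
    ‖(N : ℝ)⁻¹ • ∑ j, v j‖ ≤ (N : ℝ)⁻¹ * ∑ j, a j := by
  rw [norm_smul, Real.norm_of_nonneg (by positivity)]
  exact mul_le_mul_of_nonneg_left ((norm_sum_le _ _).trans (Finset.sum_le_sum fun j _ => h j))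
    (by positivity)

theorem average_le_of_le {a : Fin N → ℝ} {c : ℝ} (hc : 0 ≤ c) (h : ∀ j, a j ≤ c) :
    (N : ℝ)⁻¹ * ∑ j, a j ≤ c := by
  have h1 : ∑ j, a j ≤ N * c := by simpa using Finset.sum_le_sum fun j (_ : j ∈ Finset.univ) => h j
  refine (mul_le_mul_of_nonneg_left h1 (by positivity)).trans ?_
  rw [← mul_assoc]
  -- This covers N = 0, where the inverse is 0 and the average vanishes.
  exact mul_le_of_le_one_left hc inv_mul_le_one

theorem norm_nBodyField_apply_sub_le (hK : IsLipschitzKernel K L) (Z W : PhaseN d N) (i : Fin N) :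
    ‖nBodyField K N Z i - nBodyField K N W i‖ ≤
      (N : ℝ)⁻¹ * ∑ j, (L * (‖Z i - W i‖ + ‖Z j - W j‖)) := by
  simp only [nBodyField]
  rw [← smul_sub, ← Finset.sum_sub_distrib]
  exact norm_average_le fun j => hK.norm_sub_le _ _ _ _

/-- In the supremum norm over particles, the weight 1/N gives a Lipschitz constant that is the same
for all N. -/
theorem isLipschitzField_nBodyField (hK : IsLipschitzKernel K L) (N : ℕ) :
    IsLipschitzField (fun _ => nBodyField K N) (2 * L) := by
  refine ⟨fun _ => LipschitzWith.of_dist_le_mul fun Z W => ?_, fun _ => continuous_const⟩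
  rw [dist_eq_norm, dist_eq_norm]
  refine (pi_norm_le_iff_of_nonneg (by positivity)).2 fun i => ?_
  refine (norm_nBodyField_apply_sub_le hK Z W i).trans (average_le_of_le (by positivity) fun j => ?_)
  have h1 := norm_le_pi_norm (Z - W) i
  have h2 := norm_le_pi_norm (Z - W) j
  have := mul_le_mul_of_nonneg_left (add_le_add h1 h2) L.coe_nonneg
  refine this.trans_eq ?_
  push_cast
  ring

theorem nBodyField_zero (hK : IsLipschitzKernel K L) : nBodyField K N 0 = 0 := by
  funext i
  simp [nBodyField, hK.zero]

theorem IsNBodyFlow.neg_time {T : ℝ → PhaseN d N → PhaseN d N} (hT : IsNBodyFlow K N T) :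
    IsNBodyFlow (fun z z' => -K z z') N fun t => T (-t) where
  init Z := by simpa using hT.init Z
  ode Z t := by
    have h1 := (hT.ode Z (-t)).scomp t (hasDerivAt_neg t)
    have h2 : nBodyField (fun z z' => -K z z') N (T (-t) Z) =
        (-1 : ℝ) • nBodyField K N (T (-t) Z) := by
      funext i
      simp [nBodyField]
    rw [h2]
    exact h1

theorem IsFlow.isNBodyFlow {Φ : ℝ → ℝ → PhaseN d N → PhaseN d N}
    (hΦ : IsFlow (fun _ => nBodyField K N) Φ) : IsNBodyFlow K N (Φ 0) :=
  ⟨hΦ.init 0, hΦ.ode 0⟩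

theorem IsNBodyFlow.eq_flow {T : ℝ → PhaseN d N → PhaseN d N} (hT : IsNBodyFlow K N T)
    (hK : IsLipschitzKernel K L) {Φ : ℝ → ℝ → PhaseN d N → PhaseN d N}
    (hΦ : IsFlow (fun _ => nBodyField K N) Φ) : T = Φ 0 := by
  funext t Z
  have := hΦ.eq_of_solution (isLipschitzField_nBodyField hK N) (hT.ode Z) 0 t
  rwa [hT.init] at this

/-- The flow of the particle system commutes with permutations of the particles. -/
theorem IsNBodyFlow.comp_perm {T : ℝ → PhaseN d N → PhaseN d N} (hT : IsNBodyFlow K N T)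
    (hK : IsLipschitzKernel K L) (σ : Equiv.Perm (Fin N)) (t : ℝ) (Z : PhaseN d N) :
    (T t fun i => Z (σ i)) = fun i => T t Z (σ i) := by
  refine congrFun ((isLipschitzField_nBodyField hK N).solution_unique (t₀ := 0)
    (x := fun t => T t fun i => Z (σ i)) (y := fun t i => T t Z (σ i)) (hT.ode _)
    (fun s => ?_) ?_) t
  · refine hasDerivAt_pi.2 fun i => ?_
    convert hasDerivAt_pi.1 (hT.ode Z s) (σ i) using 1
    simp only [nBodyField]
    rw [Equiv.sum_comp σ fun j => K (T s Z (σ i)) (T s Z j)]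
  · simp only [hT.init]

variable {μ : Measure (Phase d)} [IsProbabilityMeasure μ]

theorem integrable_norm_pi (hμ : Integrable (fun x : Phase d => ‖x‖) μ) :
    Integrable (fun ζ : PhaseN d N => ‖ζ‖) (Measure.pi fun _ => μ) := by
  refine (integrable_finsetSum Finset.univ fun i _ => hμ.comp_eval' i).mono'
    continuous_norm.aestronglyMeasurable (ae_of_all _ fun ζ => ?_)
  rw [norm_norm]
  exact (pi_norm_le_iff_of_nonneg (Finset.sum_nonneg fun _ _ => norm_nonneg _)).2 fun i =>
    Finset.single_le_sum (f := fun i => ‖ζ i‖) (fun _ _ => norm_nonneg _) (Finset.mem_univ i)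

theorem integrable_of_norm_le_linear (hμ : Integrable (fun x : Phase d => ‖x‖) μ) {F : Type*}
    [NormedAddCommGroup F] {g : PhaseN d N → F} [SecondCountableTopology F]
    (hg : Continuous g) {C : ℝ} (h : ∀ ζ, ‖g ζ‖ ≤ C * (1 + ‖ζ‖)) :
    Integrable g (Measure.pi fun _ => μ) :=
  (((integrable_const (1 : ℝ)).add (integrable_norm_pi hμ)).const_mul C).mono'
    hg.aestronglyMeasurable (ae_of_all _ h)

namespace IsMeanFieldFlow

variable {X : ℝ → Phase d → Phase d}

theorem norm_meanFieldVelocity_le (hX : IsMeanFieldFlow K μ X) (hK : IsLipschitzKernel K L)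
    (hμ : Integrable (fun x : Phase d => ‖x‖) μ) {t C : ℝ}
    (hC : ∀ ζ, ‖X t ζ‖ ≤ C * (1 + ‖ζ‖)) (z : Phase d) :
    ‖meanFieldVelocity K μ X t z‖ ≤ L * (‖z‖ + C * (1 + ∫ x, ‖x‖ ∂μ)) := by
  refine (hK.norm_integral_le (hX.integrable_norm hμ t) z).trans ?_
  gcongr
  refine (integral_mono (hX.integrable_norm hμ t)
    (((integrable_const (1 : ℝ)).add hμ).const_mul C) hC).trans_eq ?_
  simp only [Pi.add_apply]
  rw [integral_const_mul, integral_add (integrable_const _) hμ]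
  simp

/-- The fluctuation of the empirical velocity around the mean-field velocity, for independent
particles moving along the mean-field flow. -/
theorem exists_fluctuation_le (hX : IsMeanFieldFlow K μ X) (hK : IsLipschitzKernel K L)
    (hμ : Integrable (fun x : Phase d => ‖x‖) μ)
    (hμ2 : Integrable (fun x : Phase d => ‖x‖ ^ 2) μ) (T : ℝ) :
    ∃ B, ∀ N, 1 ≤ N → ∀ t, |t| ≤ T → ∀ i : Fin N,
      ∫ ζ, ‖nBodyField K N (fun j => X t (ζ j)) i - meanFieldVelocity K μ X t (X t (ζ i))‖
        ∂(Measure.pi fun _ => μ) ≤ B / Real.sqrt N := by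
  obtain ⟨C, hC0, hC⟩ := hX.growth T
  set m := ∫ x, ‖x‖ ∂μ
  have hm : 0 ≤ m := integral_nonneg fun _ => norm_nonneg _
  have hq : Integrable (fun x : Phase d => (1 + ‖x‖) ^ 2) μ := by
    simp only [add_sq]
    exact ((integrable_const _).add (hμ.const_mul _)).add hμ2
  -- B is read off from the law of large numbers for the centred interaction, with q = 1 + ‖x‖. The
  -- four growth terms, two from K and two from the mean velocity, add up to A = L C (3 + m),
  -- independent of N, of i and of t in [-T, T].
  refine ⟨_, fun N hN t ht i => le_trans (le_of_eq ?_) (integral_norm_average_le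
    (f := fun x y => K (X t x) (X t y) - meanFieldVelocity K μ X t (X t x))
    ?_ (fun x => ?_) (fun x => ?_) hq (A := L * C * (3 + m)) (fun x y => ?_) hN i)⟩
  · refine integral_congr_ae (ae_of_all _ fun ζ => ?_)
    have hN0 : (N : ℝ) ≠ 0 := by positivity
    simp only [nBodyField, Finset.sum_sub_distrib, smul_sub, Finset.sum_const, Finset.card_univ,
      Fintype.card_fin, ← Nat.cast_smul_eq_nsmul ℝ, smul_smul, inv_mul_cancel₀ hN0, one_smul]
  · refine Continuous.measurable ?_
    refine (hK.continuous_comp ((hX.continuous t).comp continuous_fst)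
      ((hX.continuous t).comp continuous_snd)).sub ?_
    exact (hX.isLipschitzField hK hμ).continuous_comp continuous_const
      ((hX.continuous t).comp continuous_fst)
  · rw [integral_sub (hK.integrable (hX.continuous t).aestronglyMeasurable
      (hX.integrable_norm hμ t) _) (integrable_const _)]
    simp [meanFieldVelocity]
  · exact (hK.integrable (hX.continuous t).aestronglyMeasurable
      (hX.integrable_norm hμ t) _).sub (integrable_const _)
  · have h1 := norm_sub_le (K (X t x) (X t y)) (meanFieldVelocity K μ X t (X t x))
    have h2 := hK.norm_le (X t x) (X t y)
    have h3 := hX.norm_meanFieldVelocity_le hK hμ (hC t ht) (X t x)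
    have h4 : ‖X t x‖ + ‖X t y‖ + (‖X t x‖ + C * (1 + m)) ≤
        C * (3 + m) * (1 + ‖x‖ + (1 + ‖y‖)) := by
      have h5 := hC t ht x
      have h6 := hC t ht y
      have h7 : 0 ≤ C * ‖x‖ := by positivity
      have h8 : 0 ≤ C * ‖y‖ := by positivity
      have h9 : 0 ≤ C * m := by positivity
      have h10 : 0 ≤ C * m * ‖x‖ := by positivity
      have h11 : 0 ≤ C * m * ‖y‖ := by positivity
      nlinarith
    have h5 := mul_le_mul_of_nonneg_left h4 L.2
    have h6 : (L : ℝ) * (C * (3 + m) * (1 + ‖x‖ + (1 + ‖y‖))) =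
      L * C * (3 + m) * (1 + ‖x‖ + (1 + ‖y‖)) := by ring
    refine h1.trans ?_
    rw [← h6]
    refine le_trans ?_ h5
    change _ ≤ (L : ℝ) * _
    linarith

/-- Coupling of the particle system with independent particles moving along the mean-field flow. -/
theorem exists_coupling_le (hX : IsMeanFieldFlow K μ X) (hK : IsLipschitzKernel K L)
    (hμ : Integrable (fun x : Phase d => ‖x‖) μ)
    (hμ2 : Integrable (fun x : Phase d => ‖x‖ ^ 2) μ) {t : ℝ} (ht : 0 ≤ t) :
    ∃ B, ∀ N, 1 ≤ N → ∀ T, IsNBodyFlow K N T → ∀ i : Fin N,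
      ∫ ζ, ‖T t ζ i - X t (ζ i)‖ ∂(Measure.pi fun _ => μ) ≤
        gronwallBound 0 (2 * L) (B / Real.sqrt N) t := by
  obtain ⟨B, hB⟩ := hX.exists_fluctuation_le hK hμ hμ2 t
  refine ⟨B, fun N hN T hT i => ?_⟩
  set P : Measure (PhaseN d N) := Measure.pi fun _ => μ with hP
  have hb := isLipschitzField_nBodyField hK N
  have hv := hX.isLipschitzField hK hμ
  obtain ⟨Φ, hΦ⟩ := IsFlow.exists_of_lipschitz hb
  obtain rfl := hT.eq_flow hK hΦ
  have hXu := hX.continuous_uncurry hK hμ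
  have hΦc := hΦ.continuous_to hb 0
  set m := ∫ x, ‖x‖ ∂μ
  have hm : 0 ≤ m := integral_nonneg fun _ => norm_nonneg _
  let y : Fin N → ℝ → PhaseN d N → Phase d := fun i s ζ => Φ 0 s ζ i - X s (ζ i)
  let R : Fin N → ℝ → PhaseN d N → Phase d := fun i s ζ =>
    nBodyField K N (fun j => X s (ζ j)) i - meanFieldVelocity K μ X s (X s (ζ i))
  let y' : Fin N → ℝ → PhaseN d N → Phase d := fun i s ζ =>
    nBodyField K N (Φ 0 s ζ) i - meanFieldVelocity K μ X s (X s (ζ i))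
  -- The largest mean error over the particles. The error of particle i involves those of all j, and
  -- the maximum closes the Grönwall inequality with no appeal to exchangeability.
  let w : ℝ → ℝ := fun s => ‖fun i => ∫ ζ, ‖y i s ζ‖ ∂P‖
  have hyc : ∀ i s, Continuous (y i s) := fun i s =>
    ((continuous_apply i).comp (hΦ.continuous_map hb 0 s)).sub
      ((hX.continuous s).comp (continuous_apply i))
  have hRc : ∀ i s, Continuous (R i s) := fun i s =>
    ((continuous_apply i).comp (hb.continuous_comp (s := fun _ => (0 : ℝ)) continuous_const
      (continuous_pi fun j => (hX.continuous s).comp (continuous_apply j)))).sub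
      (hv.continuous_comp continuous_const ((hX.continuous s).comp (continuous_apply i)))
  have hfield : ∀ (Z : PhaseN d N) i, ‖nBodyField K N Z i‖ ≤ 2 * L * ‖Z‖ := fun Z i => by
    have := hb.norm_sub_le 0 Z 0
    rw [nBodyField_zero hK, sub_zero, sub_zero] at this
    exact (norm_le_pi_norm _ i).trans (by simpa using this)
  -- These bounds serve only for integrability and domination; their constants do not enter the
  -- estimate.
  have hgrowth : ∀ S : ℝ, ∃ C, 0 ≤ C ∧ ∀ s, |s| ≤ S → ∀ i ζ, ‖y i s ζ‖ ≤ C * (1 + ‖ζ‖) ∧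
      ‖R i s ζ‖ ≤ C * (1 + ‖ζ‖) ∧ ‖y' i s ζ‖ ≤ C * (1 + ‖ζ‖) := by
    intro S
    obtain ⟨C, hC0, hC⟩ := hΦ.exists_norm_le hb (max S 0)
    obtain ⟨D, hD0, hD⟩ := hX.growth S
    have hL : (0 : ℝ) ≤ L := L.2
    refine ⟨C + D + 2 * L * C + 2 * L * D + L * (D + D * (1 + m)), by positivity, fun s hs i ζ => ?_⟩
    have h1 : ‖Φ 0 s ζ‖ ≤ C * (1 + ‖ζ‖) := hC 0 s (by simp) (hs.trans (le_max_left _ _)) ζ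
    have h2 : ∀ j, ‖X s (ζ j)‖ ≤ D * (1 + ‖ζ‖) := fun j => (hD s hs _).trans (by
      have := norm_le_pi_norm ζ j
      gcongr)
    have h3 : ‖fun j => X s (ζ j)‖ ≤ D * (1 + ‖ζ‖) :=
      (pi_norm_le_iff_of_nonneg (by positivity)).2 h2
    have h4 : ‖meanFieldVelocity K μ X s (X s (ζ i))‖ ≤ L * (D + D * (1 + m)) * (1 + ‖ζ‖) := by
      refine (hX.norm_meanFieldVelocity_le hK hμ (hD s hs) _).trans ?_
      rw [mul_assoc]
      refine mul_le_mul_of_nonneg_left ?_ hL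
      have h5 : 0 ≤ D * (1 + m) * ‖ζ‖ := by positivity
      nlinarith [h2 i]
    have h5 : ‖nBodyField K N (Φ 0 s ζ) i‖ ≤ 2 * L * C * (1 + ‖ζ‖) := by
      refine (hfield _ i).trans ?_
      rw [mul_assoc _ C]
      gcongr
    have h6 : ‖nBodyField K N (fun j => X s (ζ j)) i‖ ≤ 2 * L * D * (1 + ‖ζ‖) := by
      refine (hfield _ i).trans ?_
      rw [mul_assoc _ D]
      gcongr
    have hζ : 0 ≤ 1 + ‖ζ‖ := by positivity
    have e1 : 0 ≤ C * (1 + ‖ζ‖) := by positivity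
    have e2 : 0 ≤ D * (1 + ‖ζ‖) := by positivity
    have e3 : 0 ≤ 2 * L * C * (1 + ‖ζ‖) := by positivity
    have e4 : 0 ≤ 2 * L * D * (1 + ‖ζ‖) := by positivity
    have e5 : 0 ≤ L * (D + D * (1 + m)) * (1 + ‖ζ‖) := by positivity
    simp only [add_mul (_ + _) _ (1 + ‖ζ‖), add_mul C D]
    have h7 := norm_le_pi_norm (Φ 0 s ζ) i
    refine ⟨(norm_sub_le _ _).trans ?_, (norm_sub_le _ _).trans ?_, (norm_sub_le _ _).trans ?_⟩
    · linarith [h2 i]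
    · linarith
    · linarith
  have hyi : ∀ i s, Integrable (fun ζ => ‖y i s ζ‖) P := fun i s => by
    obtain ⟨C, _, hC⟩ := hgrowth |s|
    exact (integrable_of_norm_le_linear hμ (hyc i s) fun ζ => (hC s le_rfl i ζ).1).norm
  have hRi : ∀ i s, Integrable (fun ζ => ‖R i s ζ‖) P := fun i s => by
    obtain ⟨C, _, hC⟩ := hgrowth |s|
    exact (integrable_of_norm_le_linear hμ (hRc i s) fun ζ => (hC s le_rfl i ζ).2.1).norm
  have hwc : Continuous w := by
    refine (continuous_pi fun i => ?_).norm
    refine continuous_iff_continuousAt.2 fun s => ?_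
    obtain ⟨C, _, hC⟩ := hgrowth (|s| + 1)
    refine continuousAt_of_dominated (bound := fun ζ => C * (1 + ‖ζ‖))
      (Eventually.of_forall fun r => (hyc i r).norm.aestronglyMeasurable) ?_
      (((integrable_const (1 : ℝ)).add (integrable_norm_pi hμ)).const_mul C)
      (ae_of_all _ fun ζ => (((continuous_apply i).comp (hΦ.continuous_right 0 ζ)).sub
        (hX.continuous_left (ζ i))).norm.continuousAt)
    have : ∀ᶠ r in 𝓝 s, |r| < |s| + 1 :=
      continuous_abs.tendsto s |>.eventually (gt_mem_nhds (lt_add_one _))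
    filter_upwards [this] with r hr
    refine ae_of_all _ fun ζ => ?_
    rw [norm_norm]
    exact (hC r hr.le i ζ).1
  have huw : ∀ i s, ∫ ζ, ‖y i s ζ‖ ∂P ≤ w s := fun i s =>
    (le_abs_self _).trans (norm_le_pi_norm (fun i => ∫ ζ, ‖y i s ζ‖ ∂P) i)
  have hw0 : ∀ s, 0 ≤ w s := fun s => norm_nonneg _
  -- The empirical velocity of the independent particles is inserted: the first part is Lipschitz in
  -- the errors, the second is the fluctuation R of mean size B/√N.
  have hy'le : ∀ i s ζ, ‖y' i s ζ‖ ≤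
      (N : ℝ)⁻¹ * ∑ j, (L * (‖y i s ζ‖ + ‖y j s ζ‖)) + ‖R i s ζ‖ := fun i s ζ => by
    have h1 : y' i s ζ = (nBodyField K N (Φ 0 s ζ) i - nBodyField K N (fun j => X s (ζ j)) i) +
        R i s ζ := (sub_add_sub_cancel _ _ _).symm
    rw [h1]
    exact (norm_add_le _ _).trans (add_le_add_left (norm_nBodyField_apply_sub_le hK _ _ i) _)
  have hε : ∀ s ∈ Set.Icc 0 t, ∀ i, ∫ ζ, ‖y' i s ζ‖ ∂P ≤ 2 * L * w s + B / Real.sqrt N := by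
    intro s hs i
    have hi : ∀ j, Integrable (fun ζ => L * (‖y i s ζ‖ + ‖y j s ζ‖)) P := fun j =>
      ((hyi i s).add (hyi j s)).const_mul _
    have hi2 : Integrable (fun ζ => (N : ℝ)⁻¹ * ∑ j, (L * (‖y i s ζ‖ + ‖y j s ζ‖))) P :=
      (integrable_finsetSum _ fun j _ => hi j).const_mul _
    refine (integral_mono_of_nonneg (ae_of_all _ fun _ => norm_nonneg _) (hi2.add (hRi i s))
      (ae_of_all _ (hy'le i s))).trans ?_
    simp only [Pi.add_apply]
    rw [integral_add hi2 (hRi i s), integral_const_mul, integral_finsetSum _ fun j _ => hi j]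
    refine add_le_add (average_le_of_le (mul_nonneg (by positivity) (hw0 s)) fun j => ?_)
      (hB N hN s (by rw [abs_of_nonneg hs.1]; exact hs.2) i)
    rw [integral_const_mul, integral_add (hyi i s) (hyi j s)]
    have := mul_le_mul_of_nonneg_left (add_le_add (huw i s) (huw j s)) L.2
    refine this.trans_eq ?_
    change (L : ℝ) * _ = _
    ring
  have hB0 : 0 ≤ B / Real.sqrt N := (integral_nonneg fun _ => norm_nonneg _).trans
    (hB N hN 0 (by simpa using ht) i)
  refine (huw i t).trans (le_gronwallBound_of_le_integral hwc (by positivity)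
    (fun r hr => ?_) t ⟨ht, le_rfl⟩)
  have hpos : 0 ≤ ∫ s in (0 : ℝ)..r, (2 * L * w s + B / Real.sqrt N) :=
    intervalIntegral.integral_nonneg hr.1 fun s _ =>
      add_nonneg (mul_nonneg (by positivity) (hw0 s)) hB0
  refine (pi_norm_le_iff_of_nonneg hpos).2 fun k => ?_
  rw [Real.norm_of_nonneg (integral_nonneg fun _ => norm_nonneg _)]
  obtain ⟨C, _, hC⟩ := hgrowth t
  refine integral_norm_le_intervalIntegral (y' := y' k) (G := fun ζ => C * (1 + ‖ζ‖))
    (fun ζ => ?_) (fun ζ s => ?_) ?_ hr.1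
    (((integrable_const (1 : ℝ)).add (integrable_norm_pi hμ)).const_mul C)
    (fun s hs ζ => (hC s ?_ k ζ).2.2) (by fun_prop)
    (fun s hs => hε s ⟨hs.1, hs.2.trans hr.2⟩ k)
  · simp [y, hΦ.init, hX.init]
  · exact (hasDerivAt_pi.1 (hΦ.ode 0 ζ s) k).sub (hX.ode (ζ k) s)
  · have h1 : Continuous fun p : ℝ × PhaseN d N => X p.1 (p.2 k) :=
      hXu.comp (continuous_fst.prodMk ((continuous_apply k).comp continuous_snd))
    exact ((continuous_apply k).comp
      (hb.continuous_comp (s := fun _ : ℝ × PhaseN d N => (0 : ℝ)) continuous_const hΦc)).sub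
      (hv.continuous_comp continuous_fst h1)
  · rw [abs_of_nonneg hs.1]
    exact hs.2.trans hr.2

/-- The particle system stays close to independent particles moving along the mean-field flow. -/
theorem exists_tendsto_coupling (hX : IsMeanFieldFlow K μ X) (hK : IsLipschitzKernel K L)
    (hμ : Integrable (fun x : Phase d => ‖x‖) μ)
    (hμ2 : Integrable (fun x : Phase d => ‖x‖ ^ 2) μ) (t : ℝ) :
    ∃ ε : ℕ → ℝ, Tendsto ε atTop (𝓝 0) ∧ ∀ N, 1 ≤ N → ∀ T, IsNBodyFlow K N T → ∀ i : Fin N,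
      ∫ ζ, ‖T t ζ i - X t (ζ i)‖ ∂(Measure.pi fun _ => μ) ≤ ε N := by
  have hlim : ∀ B s : ℝ, Tendsto (fun N : ℕ => gronwallBound 0 (2 * L) (B / Real.sqrt N) s) atTop
      (𝓝 0) := fun B s => by
    have h1 : Tendsto (fun N : ℕ => B / Real.sqrt N) atTop (𝓝 0) :=
      (Real.tendsto_sqrt_atTop.comp tendsto_natCast_atTop_atTop).const_div_atTop B
    simpa [gronwallBound_ε0_δ0, Function.comp_def] using
      ((gronwallBound_continuous_ε 0 (2 * L) s).tendsto 0).comp h1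
  rcases le_total 0 t with ht | ht
  · obtain ⟨B, hB⟩ := hX.exists_coupling_le hK hμ hμ2 ht
    exact ⟨_, hlim B t, hB⟩
  · obtain ⟨B, hB⟩ := hX.neg_time.exists_coupling_le hK.neg hμ hμ2 (neg_nonneg.2 ht)
    refine ⟨_, hlim B (-t), fun N hN T hT i => ?_⟩
    simpa only [neg_neg] using hB N hN _ hT.neg_time i

end IsMeanFieldFlow

end NBody

/-! ### Propagation of chaos -/

section Chaos

variable {d N : ℕ} {K : Phase d → Phase d → Phase d} {L : NNReal}
  {p₀ : ProbabilityMeasure (Phase d)}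

theorem IsNBodyFlow.continuous_map {T : ℝ → PhaseN d N → PhaseN d N} (hT : IsNBodyFlow K N T)
    (hK : IsLipschitzKernel K L) (t : ℝ) : Continuous (T t) := by
  have hb := isLipschitzField_nBodyField hK N
  obtain ⟨Φ, hΦ⟩ := IsFlow.exists_of_lipschitz hb
  rw [hT.eq_flow hK hΦ]
  exact hΦ.continuous_map hb 0 t

theorem IsNBodyFlow.integrable_norm {T : ℝ → PhaseN d N → PhaseN d N} (hT : IsNBodyFlow K N T)
    (hK : IsLipschitzKernel K L) {μ : Measure (PhaseN d N)} [IsFiniteMeasure μ]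
    (hμ : Integrable (fun Z => ‖Z‖) μ) (t : ℝ) : Integrable (fun Z => ‖T t Z‖) μ := by
  have hb := isLipschitzField_nBodyField hK N
  obtain ⟨Φ, hΦ⟩ := IsFlow.exists_of_lipschitz hb
  rw [hT.eq_flow hK hΦ]
  exact hΦ.integrable_norm hb hμ 0 t

/-- The particle flow transports tensor powers to symmetric measures. -/
theorem IsNBodyFlow.isSymmetric {T : ℝ → PhaseN d N → PhaseN d N} (hT : IsNBodyFlow K N T)
    (hK : IsLipschitzKernel K L) {t : ℝ} {F : ProbabilityMeasure (PhaseN d N)}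
    (hF : (F : Measure (PhaseN d N)) = (tensorPower p₀ N : Measure (PhaseN d N)).map (T t)) :
    IsSymmetric F := by
  intro σ
  have hσ : Measurable fun (Z : PhaseN d N) i => Z (σ i) :=
    measurable_pi_lambda _ fun i => measurable_pi_apply _
  have hTm := (hT.continuous_map hK t).measurable
  have h1 : (fun (Z : PhaseN d N) i => Z (σ i)) ∘ T t = T t ∘ fun Z i => Z (σ i) :=
    funext fun Z => (hT.comp_perm hK σ t Z).symm
  have h2 := map_pi_comp_injective (μ := (p₀ : Measure (Phase d))) measurable_id σ.injective
  rw [Measure.map_id] at h2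
  rw [hF, Measure.map_map hσ hTm, h1, ← Measure.map_map hTm hσ]
  exact congrArg (Measure.map (T t)) h2

/-- Propagation of chaos for the particle flow. -/
theorem IsMeanFieldFlow.tendsto_marginal {X : ℝ → Phase d → Phase d}
    (hX : IsMeanFieldFlow K (p₀ : Measure (Phase d)) X) (hK : IsLipschitzKernel K L)
    (hμ : Integrable (fun x : Phase d => ‖x‖) (p₀ : Measure (Phase d)))
    (hμ2 : Integrable (fun x : Phase d => ‖x‖ ^ 2) (p₀ : Measure (Phase d)))
    {T : (N : ℕ) → ℝ → PhaseN d N → PhaseN d N} (hT : ∀ N, 1 ≤ N → IsNBodyFlow K N (T N)) {t : ℝ}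
    {F : (N : ℕ) → ProbabilityMeasure (PhaseN d N)}
    (hF : ∀ N, 1 ≤ N → (F N : Measure (PhaseN d N)) =
      (tensorPower p₀ N : Measure (PhaseN d N)).map (T N t))
    {p : ProbabilityMeasure (Phase d)}
    (hp : (p : Measure (Phase d)) = (p₀ : Measure (Phase d)).map (X t)) {j : ℕ} (hj : 1 ≤ j) :
    Tendsto (fun N => marginal (F N) j) atTop (𝓝 (tensorPower p j).toFiniteMeasure) := by
  have hr : ∀ {N} (h : j ≤ N), Measurable fun (Z : PhaseN d N) i => Z (Fin.castLE h i) := fun h =>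
    measurable_pi_lambda _ fun i => measurable_pi_apply _
  -- For j > N the marginal is 0, not a probability measure. Q takes an arbitrary value there, which
  -- does not affect the limit, and bounded Lipschitz functions can be used as tests.
  let Q : ℕ → ProbabilityMeasure (PhaseN d j) := fun N =>
    if h : j ≤ N then (F N).map (hr h).aemeasurable else tensorPower p j
  have hQ : ∀ N, j ≤ N → (Q N).toFiniteMeasure = marginal (F N) j := fun N h => by
    apply Subtype.ext
    simp only [Q, marginal, dif_pos h]
    exact (ProbabilityMeasure.toMeasure_map (F N) (hr h).aemeasurable).trans
      (FiniteMeasure.toMeasure_map (F N).toFiniteMeasure _).symm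
  refine Tendsto.congr' ((eventually_ge_atTop j).mono hQ)
    ((ProbabilityMeasure.tendsto_nhds_iff_toFiniteMeasure_tendsto_nhds _).1 ?_)
  refine tendsto_iff_forall_lipschitz_integral_tendsto.2 ?_
  rintro f ⟨C, hC⟩ ⟨l, hl⟩
  obtain ⟨ε, hε, hεT⟩ := hX.exists_tendsto_coupling hK hμ hμ2 t
  rw [tendsto_iff_norm_sub_tendsto_zero]
  have hlim : Tendsto (fun N => (l : ℝ) * (j * ε N)) atTop (𝓝 0) := by
    simpa using (hε.const_mul (j : ℝ)).const_mul (l : ℝ)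
  refine squeeze_zero' (Eventually.of_forall fun _ => norm_nonneg _)
    ((eventually_ge_atTop j).mono fun N hN => ?_) hlim
  have hN1 := hj.trans hN
  set P : Measure (PhaseN d N) := Measure.pi fun _ => (p₀ : Measure (Phase d)) with hP
  have hTN := hT N hN1
  have hfi : ∀ {g : PhaseN d N → PhaseN d j}, Continuous g → Integrable (fun ζ => f (g ζ)) P :=
    fun {g} hg => (integrable_const (‖f 0‖ + C)).mono'
      (hl.continuous.comp hg).aestronglyMeasurable (ae_of_all _ fun ζ => by
        have h1 := hC (g ζ) 0
        rw [dist_eq_norm] at h1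
        have h2 := norm_le_norm_add_norm_sub' (f (g ζ)) (f 0)
        linarith)
  have hg1 : Continuous fun (ζ : PhaseN d N) (i : Fin j) => T N t ζ (Fin.castLE hN i) :=
    continuous_pi fun i => (continuous_apply _).comp (hTN.continuous_map hK t)
  have hg2 : Continuous fun (ζ : PhaseN d N) (i : Fin j) => X t (ζ (Fin.castLE hN i)) :=
    continuous_pi fun i => (hX.continuous t).comp (continuous_apply _)
  have h1 : ∫ Z, f Z ∂(Q N : Measure (PhaseN d j)) =
      ∫ ζ, f (fun i => T N t ζ (Fin.castLE hN i)) ∂P := by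
    simp only [Q, dif_pos hN]
    rw [ProbabilityMeasure.toMeasure_map, hF N hN1,
      Measure.map_map (hr hN) (hTN.continuous_map hK t).measurable]
    exact integral_map hg1.measurable.aemeasurable hl.continuous.aestronglyMeasurable
  -- The target law is realised on the same probability space: j independent particles transported
  -- by X have exactly the law p^{⊗j}, for each N ≥ j.
  have h2 : ∫ Z, f Z ∂(tensorPower p j : Measure (PhaseN d j)) =
      ∫ ζ, f (fun i => X t (ζ (Fin.castLE hN i))) ∂P := by
    have h3 : (tensorPower p j : Measure (PhaseN d j)) =
        P.map fun ζ i => X t (ζ (Fin.castLE hN i)) := by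
      rw [map_pi_comp_injective (hX.continuous t).measurable (Fin.castLE_injective hN), ← hp]
      rfl
    rw [h3]
    exact integral_map hg2.measurable.aemeasurable hl.continuous.aestronglyMeasurable
  have hyi : ∀ i, Integrable (fun ζ : PhaseN d N => ‖T N t ζ i - X t (ζ i)‖) P := fun i => by
    refine ((hTN.integrable_norm hK (integrable_norm_pi hμ) t).add
      ((hX.integrable_norm hμ t).comp_eval' i)).mono'
      (((continuous_apply i).comp (hTN.continuous_map hK t)).sub
        ((hX.continuous t).comp (continuous_apply i))).norm.aestronglyMeasurable
      (ae_of_all _ fun ζ => ?_)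
    rw [norm_norm]
    exact (norm_sub_le _ _).trans (add_le_add_left (norm_le_pi_norm _ i) _)
  rw [h1, h2, ← integral_sub (hfi hg1) (hfi hg2)]
  refine (norm_integral_le_of_norm_le (g := fun ζ => (l : ℝ) *
    ∑ i : Fin j, ‖T N t ζ (Fin.castLE hN i) - X t (ζ (Fin.castLE hN i))‖)
    ((integrable_finsetSum _ fun i _ => hyi _).const_mul _) (ae_of_all _ fun ζ => ?_)).trans ?_
  · rw [← dist_eq_norm]
    refine (hl.dist_le_mul _ _).trans (mul_le_mul_of_nonneg_left ?_ l.coe_nonneg)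
    refine (dist_pi_le_iff (Finset.sum_nonneg fun _ _ => norm_nonneg _)).2 fun i => ?_
    rw [dist_eq_norm]
    exact Finset.single_le_sum
      (f := fun i => ‖T N t ζ (Fin.castLE hN i) - X t (ζ (Fin.castLE hN i))‖)
      (fun _ _ => norm_nonneg _) (Finset.mem_univ i)
  · rw [integral_const_mul, integral_finsetSum _ fun i _ => hyi _]
    refine mul_le_mul_of_nonneg_left ?_ l.coe_nonneg
    refine (Finset.sum_le_sum fun i _ => hεT N hN1 _ hTN (Fin.castLE hN i)).trans_eq ?_
    simp

end Chaos

/-! ### Assembly of the main theorem -/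

section Main

variable {d : ℕ} {K : Phase d → Phase d → Phase d}

/-- Skew-symmetry on the diagonal gives K(0,0) = 0; the mean value inequality in each variable gives
the Lipschitz bound. -/
theorem exists_isLipschitzKernel (hK : ContDiff ℝ 1 fun p : Phase d × Phase d => K p.1 p.2)
    (hK1 : HK1 K) (hK2 : HK2 K) : ∃ L : NNReal, IsLipschitzKernel K L := by
  obtain ⟨L, hL, h⟩ := hK2
  have hd := hK.differentiable one_ne_zero
  have h0 : K 0 0 = 0 := by
    have h1 : (2 : ℝ) • K 0 0 = 0 := by rw [two_smul]; exact eq_neg_iff_add_eq_zero.1 (hK1 0 0)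
    exact (smul_eq_zero.1 h1).resolve_left two_ne_zero
  refine ⟨⟨L, hL⟩, fun z z' w w' => ?_, h0⟩
  have h1 : ‖K z z' - K w z'‖ ≤ L * ‖z - w‖ :=
    convex_univ.norm_image_sub_le_of_norm_fderiv_le (𝕜 := ℝ) (f := fun x => K x z')
      (fun x _ => (hd.comp (differentiable_id.prodMk (differentiable_const z'))) x)
      (fun x _ => (h x z').1) (Set.mem_univ _) (Set.mem_univ _)
  have h2 : ‖K w z' - K w w'‖ ≤ L * ‖z' - w'‖ :=
    convex_univ.norm_image_sub_le_of_norm_fderiv_le (𝕜 := ℝ) (f := fun x => K w x)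
      (fun x _ => (hd.comp ((differentiable_const w).prodMk differentiable_id)) x)
      (fun x _ => (h w x).2) (Set.mem_univ _) (Set.mem_univ _)
  have h3 := norm_add_le (K z z' - K w z') (K w z' - K w w')
  rw [sub_add_sub_cancel] at h3
  rw [mul_add]
  exact h3.trans (add_le_add h1 h2)

theorem integrable_norm_pow_of_le {μ : Measure (Phase d)} [IsFiniteMeasure μ] {k n : ℕ}
    (hkn : k ≤ n) (h : Integrable (fun z : Phase d => ‖z‖ ^ n) μ) :
    Integrable (fun z : Phase d => ‖z‖ ^ k) μ := by
  refine ((integrable_const 1).add h).mono' (continuous_norm.pow k).aestronglyMeasurable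
    (ae_of_all _ fun z => ?_)
  rw [Real.norm_of_nonneg (by positivity)]
  simp only [Pi.add_apply]
  rcases le_total ‖z‖ 1 with hz | hz
  · have := pow_le_one₀ (n := k) (norm_nonneg z) hz
    have := pow_nonneg (norm_nonneg z) n
    linarith
  · have := pow_le_pow_right₀ hz hkn
    linarith

/-- The law of the particle system is the unique solution of the Liouville equation. -/
theorem isLiouvilleSolution_iff {L : NNReal} {N : ℕ} (hK : IsLipschitzKernel K L)
    {Φ : ℝ → ℝ → PhaseN d N → PhaseN d N} (hΦ : IsFlow (fun _ => nBodyField K N) Φ)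
    {P₀ : ProbabilityMeasure (PhaseN d N)}
    (hP₀ : Integrable (fun Z => ‖Z‖) (P₀ : Measure (PhaseN d N)))
    (G : ℝ → ProbabilityMeasure (PhaseN d N)) :
    IsLiouvilleSolution K N P₀ G ↔ G = fun t => P₀.map
      (hΦ.measurable_map (isLipschitzField_nBodyField hK N) 0 t).aemeasurable := by
  have hb := isLipschitzField_nBodyField hK N
  have hm := fun t => (hΦ.measurable_map hb 0 t).aemeasurable (μ := (P₀ : Measure (PhaseN d N)))
  constructor
  · intro hG
    funext t
    apply Subtype.ext
    have hs : SolvesContinuityEquation (fun _ => nBodyField K N)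
        fun t => (G t : Measure (PhaseN d N)) := fun φ hφ t => by
      beta_reduce
      rw [hG.init]
      exact hG.weak φ hφ t
    have := hΦ.eq_map_of_solves hb hG.continuous hG.moment hs t
    rw [hG.init] at this
    exact this.trans (ProbabilityMeasure.toMeasure_map _ _).symm
  · rintro rfl
    have h0 : P₀.map (hm 0) = P₀ := by
      apply Subtype.ext
      refine (ProbabilityMeasure.toMeasure_map _ _).trans ?_
      rw [funext (hΦ.init 0)]
      exact Measure.map_id
    refine ⟨hΦ.continuous_map_probabilityMeasure hb P₀ 0, fun t => ?_, ?_, h0, fun φ hφ t => ?_⟩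
    · rw [ProbabilityMeasure.toMeasure_map,
        integrable_map_measure continuous_norm.aestronglyMeasurable (hm t)]
      exact hΦ.integrable_norm hb hP₀ 0 t
    · refine Continuous.locallyIntegrable ?_
      simp only [ProbabilityMeasure.toMeasure_map]
      simp_rw [fun t => integral_map (hm t) continuous_norm.aestronglyMeasurable]
      exact hΦ.continuous_integral_norm hb hP₀ 0
    · have := hΦ.solvesContinuityEquation hb hP₀ φ hφ t
      simp only [ProbabilityMeasure.toMeasure_map]
      beta_reduce at this
      rwa [show (P₀ : Measure (PhaseN d N)).map (Φ 0 0) = P₀ by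
        rw [funext (hΦ.init 0)]; exact Measure.map_id] at this

end Main

theorem mainTheorem4 {d : ℕ} (K : Phase d → Phase d → Phase d)
    (hK : ContDiff ℝ 1 (fun p : Phase d × Phase d => K p.1 p.2))
    (hK1 : HK1 K) (hK2 : HK2 K)
    (f₀ : Phase d → ℝ) (hf₀ : IsProbDensity f₀)
    (hmoment : Integrable (fun z : Phase d => ‖z‖ ^ (d + 5) * f₀ z) volume) :
    (∀ N, 1 ≤ N → ∃! T : ℝ → PhaseN d N → PhaseN d N, IsNBodyFlow K N T) ∧
    (∃! f : ℝ → (Phase d →₁[volume] ℝ), IsMeanFieldSolution K f₀ f) ∧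
    ∀ T : (N : ℕ) → ℝ → PhaseN d N → PhaseN d N,
      (∀ N, 1 ≤ N → IsNBodyFlow K N (T N)) →
      ∀ (f : ℝ → (Phase d →₁[volume] ℝ)) (hf : IsMeanFieldSolution K f₀ f),
        ∃ F : (N : ℕ) → ℝ → ProbabilityMeasure (PhaseN d N),
          (∀ N, 1 ≤ N →
            (∀ t, (F N t : Measure (PhaseN d N)) =
              (tensorPower (densityMeasure f₀ hf₀) N : Measure (PhaseN d N)).map (T N t)) ∧
            IsLiouvilleSolution K N (tensorPower (densityMeasure f₀ hf₀) N) (F N) ∧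
            ∀ G, IsLiouvilleSolution K N (tensorPower (densityMeasure f₀ hf₀) N) G → G = F N) ∧
          ∀ t, IsChaotic (fun N => F N t) (densityMeasure (f t) (hf.density t)) := by
  obtain ⟨L, hKL⟩ := exists_isLipschitzKernel hK hK1 hK2
  have hμn := (integrable_densityMeasure_iff hf₀).2 hmoment
  -- The second moment makes the variance in the law of large numbers finite; d + 5 ≥ 2.
  have hμ2 : Integrable (fun z : Phase d => ‖z‖ ^ 2) (densityMeasure f₀ hf₀ : Measure (Phase d)) :=
    integrable_norm_pow_of_le (by lia) hμn
  have hμ : Integrable (fun z : Phase d => ‖z‖) (densityMeasure f₀ hf₀ : Measure (Phase d)) := by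
    simpa only [pow_one] using integrable_norm_pow_of_le (k := 1) (by lia) hμn
  choose Φ hΦ using fun N => IsFlow.exists_of_lipschitz (isLipschitzField_nBodyField hKL N)
  refine ⟨fun N _ => ⟨Φ N 0, (hΦ N).isNBodyFlow, fun T hT => hT.eq_flow hKL (hΦ N)⟩, ?_,
    fun T hT f hf => ?_⟩
  · obtain ⟨X, hX⟩ := exists_isMeanFieldFlow hKL hμ
    obtain ⟨f, hf⟩ := hX.exists_solution hKL hf₀ hμ
    exact ⟨f, hf, fun g hg => hg.unique hf hKL hK hf₀ hμ⟩
  · have hP₀ : ∀ N, Integrable (fun Z => ‖Z‖)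
        (tensorPower (densityMeasure f₀ hf₀) N : Measure (PhaseN d N)) := fun N =>
      integrable_norm_pi hμ
    -- F is built from Φ N, which is available for N = 0 too; for N ≥ 1 the given T N equals Φ N 0
    -- by uniqueness of the flow.
    have hF : ∀ N, 1 ≤ N → ∀ t, ((tensorPower (densityMeasure f₀ hf₀) N).map
        ((hΦ N).measurable_map (isLipschitzField_nBodyField hKL N) 0 t).aemeasurable :
        Measure (PhaseN d N)) =
        (tensorPower (densityMeasure f₀ hf₀) N : Measure (PhaseN d N)).map (T N t) :=
      fun N hN t => by
        rw [ProbabilityMeasure.toMeasure_map, (hT N hN).eq_flow hKL (hΦ N)]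
    obtain ⟨X, hX, hXf⟩ := hf.exists_isMeanFieldFlow hKL hK hf₀
    exact ⟨_, fun N hN => ⟨hF N hN, (isLiouvilleSolution_iff hKL (hΦ N) (hP₀ N) _).2 rfl,
      fun G hG => (isLiouvilleSolution_iff hKL (hΦ N) (hP₀ N) G).1 hG⟩, fun t =>
      ⟨fun N hN => (hT N hN).isSymmetric hKL (hF N hN t), fun j hj =>
        hX.tendsto_marginal hKL hμ hμ2 hT (fun N hN => hF N hN t) (hXf t) hj⟩⟩
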